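/- Let $p\ge 3$ be a prime, $\mathbb F_q$ the field with $q=p^f$ elements, $\Gamma=\mathrm{GL}_2(\mathbb F_q)$, and let $\mathbb F$ be a field containing $\mathbb F_q$. All representations are over $\mathbb F$. For $n\ge 0$ let $V_n=\mathrm{Sym}^n\mathbb F^2$, a representation of $\mathrm{GL}_2(\mathbb F)$, realised on homogeneous polynomials of degree $n$ in the standard basis $x,y$ of $\mathbb F^2$. For a representation $M$ of $\mathrm{GL}_2(\mathbb F)$ let $M^{\mathrm{Fr}^i}$ be the representation of $\Gamma$ on $M$ in which a matrix acts through the matrix of the $p^i$-th powers of its entries. For $0\le r\le p-1$ realise $V_{p-1-r}\otimes V_{p-1}$ as the space of polynomials that are homogeneous of degree $p-1-r$ in $(x,y)$ and of degree $p-1$ in $(x',y')$, and let $$N=(xy'-yx')\Bigl(\frac{\partial}{\partial x}\frac{\partial}{\partial y'}-\frac{\partial}{\partial y}\frac{\partial}{\partial x'}\Bigr),$$ a $\mathrm{GL}_2(\mathbb F)$-equivariant endomorphism of it. Put $R_r=\ker N^2$ and $W_r=\ker N\subseteq R_r$. (For $r\le p-2$, $R_r$ is a $2p$-dimensional direct summand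 of $V_{p-1-r}\otimes V_{p-1}$ with a filtration with graded pieces $V_r\otimes\det^{p-1-r}$, $V_{p-2-r}\otimes V_1^{\mathrm{Fr}}$, $V_r\otimes\det^{p-1-r}$, where $V_1^{\mathrm{Fr}}$ denotes $V_1$ with $\mathrm{GL}_2(\mathbb F)$ acting through the $p$-th powers of the entries, and $0\to W_r\to R_r\to V_r\otimes\det^{p-1-r}\to 0$ is exact; for $r=p-1$ one has $R_r=V_{p-1}$.) Let $\sigma=\Bigl(\bigotimes_{i=0}^{f-1}V_{r_i}^{\mathrm{Fr}^i}\Bigr)\otimes\det^a$ be a weight, where $0\le r_i\le p-1$ and $a\in\mathbb Z$. Assume that $\sigma$ is regular, i.e. $r_i\ne p-1$ for all $i$, and that $\dim_{\mathbb F}\sigma\ge 2$. Put $b=a+\sum_{i=0}^{f-1}p^ir_i$ and $$R_\sigma=\Bigl(\bigotimes_{i=0}^{f-1}R_{r_i}^{\mathrm{Fr}^i}\Bigr)\otimes{\det}^{b},\qquad A_\sigma=\Bigl(\bigotimes_{i=0}^{f-1}W_{r_i}^{\mathrm{Fr}^i}\Bigr)\otimes{\det}^{b}\subseteq R_\sigma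 .$$ Then the $\Gamma$-socle of $R_\sigma/A_\sigma$ (the sum of its irreducible subrepresentations) is isomorphic to $\sigma^{\oplus f}$, and $\dim_{\mathbb F}\mathrm{Ext}^1_\Gamma(\sigma,A_\sigma)=f$. -/

import Mathlib

open scoped TensorProduct DirectSum
open CategoryTheory

namespace SocleB

universe u v

/-! ### Generalities on representations over a field -/

section General

variable {F : Type v} [Field F] {G : Type u} [Group G]

/-- The twist `ρ ⊗ χ` of a representation by a one-dimensional character `χ : G → Fˣ`, realised on
the underlying space of `ρ`. -/
def twist {V : Type*} [AddCommMonoid V] [Module F V] (ρ : Representation F G V) (χ : G →* Fˣ) :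
    Representation F G V where
  toFun g := (χ g : F) • ρ g
  map_one' := by simp
  map_mul' g h := by
    ext v
    simp [mul_smul, smul_comm ((χ g : F))]

/-- The tensor product `⨂ i, V i` of a family of representations, with the diagonal action. -/
noncomputable def piTensor {ι : Type*} {V : ι → Type*} [∀ i, AddCommMonoid (V i)]
    [∀ i, Module F (V i)] (ρ : ∀ i, Representation F G (V i)) :
    Representation F G (⨂[F] i, V i) :=
  PiTensorProduct.mapMonoidHom.comp (MonoidHom.pi ρ)

/-- The quotient of a representation by a subrepresentation. -/
def quot {V : Type*} [AddCommGroup V] [Module F V] {ρ : Representation F G V}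
    (W : Subrepresentation ρ) : Representation F G (V ⧸ W.toSubmodule) :=
  ρ.quotient W.toSubmodule fun g _ hv => W.apply_mem_toSubmodule g hv

/-- The socle of a representation: the sum of all its irreducible subrepresentations. -/
def socle {V : Type*} [AddCommGroup V] [Module F V] (ρ : Representation F G V) :
    Subrepresentation ρ where
  toSubmodule := ⨆ W : {W : Subrepresentation ρ // W.toRepresentation.IsIrreducible},
    W.1.toSubmodule
  apply_mem_toSubmodule g := by
    suffices h : (⨆ W : {W : Subrepresentation ρ // W.toRepresentation.IsIrreducible},
        W.1.toSubmodule) ≤ (⨆ W : {W : Subrepresentation ρ // W.toRepresentation.IsIrreducible},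
        W.1.toSubmodule).comap (ρ g) from fun v hv => h hv
    refine iSup_le fun W v hv => ?_
    exact Submodule.mem_iSup_of_mem W (W.1.apply_mem_toSubmodule g hv)

end General

/-- `Ext`-groups exist in the category of `F`-linear representations of `G`. -/
instance hasExtRep (F : Type v) [Field F] (G : Type u) [Group G] :
    HasExt.{max u (v + 1)} (Rep.{v} F G) := HasExt.standard _

/-! ### Symmetric powers of the standard representation of `GL₂` -/

section Sym

variable (F : Type v) [Field F]

/-- `V_n = Symⁿ F²`: homogeneous polynomials of degree `n` in the basis `X 0, X 1` of `F²`. -/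
def SymPow (n : ℕ) : Type v := MvPolynomial.homogeneousSubmodule (Fin 2) F n

noncomputable instance (n : ℕ) : AddCommGroup (SymPow F n) :=
  inferInstanceAs (AddCommGroup (MvPolynomial.homogeneousSubmodule (Fin 2) F n))

noncomputable instance (n : ℕ) : Module F (SymPow F n) :=
  inferInstanceAs (Module F (MvPolynomial.homogeneousSubmodule (Fin 2) F n))

variable {F}

namespace SymPow

/-- The inclusion of `Symⁿ F²` into the polynomial ring. -/
noncomputable def val (n : ℕ) : SymPow F n →ₗ[F] MvPolynomial (Fin 2) F :=
  (MvPolynomial.homogeneousSubmodule (Fin 2) F n).subtype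

lemma val_injective (n : ℕ) : Function.Injective (val (F := F) n) := Subtype.val_injective

lemma val_mem {n : ℕ} (P : SymPow F n) : (val n P).IsHomogeneous n := P.2

/-- The endomorphism of `Symⁿ F²` induced by an endomorphism of the polynomial ring which preserves
homogeneous polynomials of degree `n`. -/
noncomputable def restrict (n : ℕ) (φ : MvPolynomial (Fin 2) F →ₗ[F] MvPolynomial (Fin 2) F)
    (h : ∀ P : MvPolynomial (Fin 2) F, P.IsHomogeneous n → (φ P).IsHomogeneous n) :
    SymPow F n →ₗ[F] SymPow F n :=
  LinearMap.restrict (p := MvPolynomial.homogeneousSubmodule (Fin 2) F n)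
    (q := MvPolynomial.homogeneousSubmodule (Fin 2) F n) φ h

lemma val_restrict (n : ℕ) (φ : MvPolynomial (Fin 2) F →ₗ[F] MvPolynomial (Fin 2) F)
    (h : ∀ P : MvPolynomial (Fin 2) F, P.IsHomogeneous n → (φ P).IsHomogeneous n)
    (P : SymPow F n) : val n (restrict n φ h P) = φ (val n P) := rfl

end SymPow

/-- The algebra endomorphism of the symmetric algebra of `F²` induced by a matrix `g` acting on column vectors:
`X j ↦ ∑ i, g i j • X i`. -/
noncomputable def subst (g : Matrix (Fin 2) (Fin 2) F) :
    MvPolynomial (Fin 2) F →ₐ[F] MvPolynomial (Fin 2) F :=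
  MvPolynomial.aeval fun j => ∑ i, MvPolynomial.C (g i j) * MvPolynomial.X i

lemma subst_isHomogeneous (g : Matrix (Fin 2) (Fin 2) F) (n : ℕ) (P : MvPolynomial (Fin 2) F)
    (hP : P.IsHomogeneous n) : ((subst g).toLinearMap P).IsHomogeneous n := by
  have h := MvPolynomial.IsHomogeneous.aeval (n := 1) (R := F) hP
    (fun j => ∑ i, MvPolynomial.C (g i j) * MvPolynomial.X (R := F) i) (fun j =>
      MvPolynomial.IsHomogeneous.sum _ _ _ fun i _ => by
        simpa using (MvPolynomial.isHomogeneous_C (Fin 2) (g i j)).mul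
          (MvPolynomial.isHomogeneous_X F i))
  simpa [subst] using h

lemma subst_one : subst (1 : Matrix (Fin 2) (Fin 2) F) = AlgHom.id F _ := by
  refine MvPolynomial.algHom_ext fun j => ?_
  fin_cases j <;> simp [subst, Fin.sum_univ_two]

lemma subst_mul (g h : Matrix (Fin 2) (Fin 2) F) :
    subst (g * h) = (subst g).comp (subst h) := by
  refine MvPolynomial.algHom_ext fun j => ?_
  simp only [subst, AlgHom.comp_apply, MvPolynomial.aeval_X, map_mul, Fin.sum_univ_two,
    Matrix.mul_apply, MvPolynomial.aeval_C, MvPolynomial.algebraMap_eq, map_add]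
  ring

variable (F) in
/-- The representation `Symⁿ F²` of `GL₂(F)`. -/
noncomputable def symRep (n : ℕ) : Representation F (GL (Fin 2) F) (SymPow F n) where
  toFun g := SymPow.restrict n (subst (g : Matrix (Fin 2) (Fin 2) F)).toLinearMap
    (subst_isHomogeneous (g : Matrix (Fin 2) (Fin 2) F) n)
  map_one' := by
    refine LinearMap.ext fun P => SymPow.val_injective n ?_
    simp [SymPow.val_restrict, subst_one]
  map_mul' g h := by
    refine LinearMap.ext fun P => SymPow.val_injective n ?_
    simp [SymPow.val_restrict, subst_mul]

lemma val_symRep (n : ℕ) (g : GL (Fin 2) F) (P : SymPow F n) :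
    SymPow.val n (symRep F n g P) = subst (g : Matrix (Fin 2) (Fin 2) F) (SymPow.val n P) := rfl

lemma X_mul_pderiv_isHomogeneous (n : ℕ) (i j : Fin 2) (P : MvPolynomial (Fin 2) F)
    (hP : P.IsHomogeneous n) :
    (((LinearMap.mulLeft F (MvPolynomial.X i)).comp
      (MvPolynomial.pderiv j).toLinearMap) P).IsHomogeneous n := by
  rcases n with _ | n
  · have h0 : P = MvPolynomial.C (MvPolynomial.coeff 0 P) :=
      MvPolynomial.totalDegree_eq_zero_iff_eq_C.mp
        (Nat.le_zero.mp (MvPolynomial.IsHomogeneous.totalDegree_le hP))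
    rw [h0]
    simpa using MvPolynomial.isHomogeneous_zero (Fin 2) F 0
  · have h1 := (MvPolynomial.isHomogeneous_X F i).mul
      (MvPolynomial.IsHomogeneous.pderiv (i := j) hP)
    rw [Nat.add_sub_cancel, Nat.add_comm] at h1
    exact h1

variable (F) in
/-- The operator `Xᵢ ∂/∂Xⱼ` on `Symⁿ F²`. -/
noncomputable def polar (n : ℕ) (i j : Fin 2) : SymPow F n →ₗ[F] SymPow F n :=
  SymPow.restrict n ((LinearMap.mulLeft F (MvPolynomial.X i)).comp
    (MvPolynomial.pderiv j).toLinearMap) (X_mul_pderiv_isHomogeneous n i j)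

lemma val_polar (n : ℕ) (i j : Fin 2) (P : SymPow F n) :
    SymPow.val n (polar F n i j P) =
      MvPolynomial.X i * MvPolynomial.pderiv j (SymPow.val n P) := rfl

lemma pderiv_subst (g : Matrix (Fin 2) (Fin 2) F) (j : Fin 2) (P : MvPolynomial (Fin 2) F) :
    MvPolynomial.pderiv j (subst g P) = ∑ m, g j m • subst g (MvPolynomial.pderiv m P) := by
  induction P using MvPolynomial.induction_on with
  | C c => simp [subst]
  | add P Q hP hQ => simp only [map_add, hP, hQ, smul_add, Finset.sum_add_distrib]
  | mul_X P i hP =>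
    have hX : MvPolynomial.pderiv j (subst g (MvPolynomial.X i)) = MvPolynomial.C (g j i) := by
      fin_cases j <;> fin_cases i <;> simp [subst, Fin.sum_univ_two, MvPolynomial.pderiv_X]
    have hY : ∀ m, subst g (MvPolynomial.pderiv m (MvPolynomial.X i)) =
        if m = i then 1 else 0 := by
      intro m
      by_cases h : m = i
      · subst h; simp
      · simp [h, MvPolynomial.pderiv_X_of_ne (Ne.symm h)]
    rw [map_mul, Derivation.leibniz, hX, hP]
    simp only [Derivation.leibniz, map_add, smul_eq_mul, map_mul, hY, MvPolynomial.smul_eq_C_mul,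
      Fin.sum_univ_two]
    fin_cases i <;> simp <;> ring


lemma polar_symRep (g : GL (Fin 2) F) (n : ℕ) (l j : Fin 2) (P : SymPow F n) :
    polar F n l j (symRep F n g P) =
      ∑ i, ∑ m, ((↑g⁻¹ : Matrix (Fin 2) (Fin 2) F) i l * (g : Matrix (Fin 2) (Fin 2) F) j m) •
        symRep F n g (polar F n i m P) := by
  refine SymPow.val_injective n ?_
  have hX : (MvPolynomial.X l : MvPolynomial (Fin 2) F) =
      ∑ i, MvPolynomial.C ((↑g⁻¹ : Matrix (Fin 2) (Fin 2) F) i l) *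
        subst (g : Matrix (Fin 2) (Fin 2) F) (MvPolynomial.X i) := by
    have h1 : subst ((g : Matrix (Fin 2) (Fin 2) F) * (↑g⁻¹ : Matrix (Fin 2) (Fin 2) F))
        (MvPolynomial.X l) = MvPolynomial.X l := by
      rw [Units.mul_inv, subst_one, AlgHom.id_apply]
    rw [← h1, subst_mul, AlgHom.comp_apply]
    nth_rewrite 2 [subst]
    simp only [MvPolynomial.aeval_X, map_sum, map_mul, MvPolynomial.algHom_C,
      MvPolynomial.algebraMap_eq]
  rw [val_polar, val_symRep, pderiv_subst, hX]
  simp only [map_smul, val_polar, val_symRep, map_mul,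
    Fin.sum_univ_two, MvPolynomial.smul_eq_C_mul, map_add]
  ring

/-- The polarised determinant
`E₀₀ ⊗ E₁₁ + E₁₁ ⊗ E₀₀ - E₀₁ ⊗ E₁₀ - E₁₀ ⊗ E₀₁` on `Symᵐ F² ⊗ Symⁿ F²`, where `Eᵢⱼ = Xᵢ ∂/∂Xⱼ`. In
terms of polynomials in two sets of variables `(x, y)`, `(x', y')`, homogeneous of degree `m` in
the first and `n` in the second, it is
`(x y' - y x') (∂/∂x ∂/∂y' - ∂/∂y ∂/∂x')`. -/
noncomputable def capelli (F : Type v) [Field F] (m n : ℕ) :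
    SymPow F m ⊗[F] SymPow F n →ₗ[F] SymPow F m ⊗[F] SymPow F n :=
  TensorProduct.map (polar F m 0 0) (polar F n 1 1) +
    TensorProduct.map (polar F m 1 1) (polar F n 0 0) -
    TensorProduct.map (polar F m 0 1) (polar F n 1 0) -
    TensorProduct.map (polar F m 1 0) (polar F n 0 1)

lemma capelli_comm (m n : ℕ) (g : GL (Fin 2) F) :
    capelli F m n ∘ₗ ((symRep F m).tprod (symRep F n)) g =
      ((symRep F m).tprod (symRep F n)) g ∘ₗ capelli F m n := by
  have hdet : ((↑g⁻¹ : Matrix (Fin 2) (Fin 2) F) 0 0 * (↑g⁻¹ : Matrix (Fin 2) (Fin 2) F) 1 1 -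
      (↑g⁻¹ : Matrix (Fin 2) (Fin 2) F) 0 1 * (↑g⁻¹ : Matrix (Fin 2) (Fin 2) F) 1 0) *
      ((g : Matrix (Fin 2) (Fin 2) F) 0 0 * (g : Matrix (Fin 2) (Fin 2) F) 1 1 -
      (g : Matrix (Fin 2) (Fin 2) F) 0 1 * (g : Matrix (Fin 2) (Fin 2) F) 1 0) = 1 := by
    rw [← Matrix.det_fin_two, ← Matrix.det_fin_two, ← Matrix.det_mul, Units.inv_mul,
      Matrix.det_one]
  refine TensorProduct.ext' fun P Q => ?_
  simp only [capelli, LinearMap.comp_apply, Representation.tprod_apply, TensorProduct.map_tmul,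
    LinearMap.add_apply, LinearMap.sub_apply, polar_symRep, Fin.sum_univ_two, map_add, map_sub,
    TensorProduct.add_tmul, TensorProduct.tmul_add, TensorProduct.smul_tmul_smul]
  linear_combination (norm := module) hdet •
    ((symRep F m g (polar F m 0 0 P)) ⊗ₜ[F] (symRep F n g (polar F n 1 1 Q)) +
    (symRep F m g (polar F m 1 1 P)) ⊗ₜ[F] (symRep F n g (polar F n 0 0 Q)) -
    (symRep F m g (polar F m 0 1 P)) ⊗ₜ[F] (symRep F n g (polar F n 1 0 Q)) -
    (symRep F m g (polar F m 1 0 P)) ⊗ₜ[F] (symRep F n g (polar F n 0 1 Q)))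

end Sym

/-! ### The representations `W_r ⊆ R_r` of `GL₂(F)` in characteristic `p` -/

section Blocks

variable (F : Type v) [Field F] (p : ℕ)

/-- The space `V_{p-1-r} ⊗ V_{p-1}`. -/
def BigSpace (r : ℕ) : Type v := SymPow F (p - 1 - r) ⊗[F] SymPow F (p - 1)

noncomputable instance (r : ℕ) : AddCommGroup (BigSpace F p r) :=
  inferInstanceAs (AddCommGroup (SymPow F (p - 1 - r) ⊗[F] SymPow F (p - 1)))

noncomputable instance (r : ℕ) : Module F (BigSpace F p r) :=
  inferInstanceAs (Module F (SymPow F (p - 1 - r) ⊗[F] SymPow F (p - 1)))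

/-- `V_{p-1-r} ⊗ V_{p-1}`, as a representation of `GL₂(F)`. -/
noncomputable def bigRep (r : ℕ) : Representation F (GL (Fin 2) F) (BigSpace F p r) :=
  (symRep F (p - 1 - r)).tprod (symRep F (p - 1))

/-- The polarised determinant, as an endomorphism of `V_{p-1-r} ⊗ V_{p-1}`. -/
noncomputable def bigCapelli (r : ℕ) : BigSpace F p r →ₗ[F] BigSpace F p r :=
  capelli F (p - 1 - r) (p - 1)

lemma bigCapelli_comm (r : ℕ) (g : GL (Fin 2) F) (v : BigSpace F p r) :
    bigCapelli F p r (bigRep F p r g v) = bigRep F p r g (bigCapelli F p r v) :=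
  LinearMap.congr_fun (capelli_comm (F := F) (p - 1 - r) (p - 1) g) v

/-- `R_r ⊆ V_{p-1-r} ⊗ V_{p-1}`, for `0 ≤ r ≤ p - 1` and `F` of characteristic `p`: the kernel of
the square of the polarised determinant. Up to an additive constant and a scalar, that operator is
the Casimir operator of `𝔤𝔩₂`; on the filtration of `V_{p-1-r} ⊗ V_{p-1}` with layers of highest
weight `2p-2-r-2j` (`0 ≤ j ≤ p-1-r`) it acts by `j (2p-1-r-j)`, which vanishes in `F` exactly for
`j = 0` and `j = p-1-r`. So `R_r` is the direct summand of `V_{p-1-r} ⊗ V_{p-1}` consisting of these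
two layers; if `r ≤ p - 2` it has dimension `2p` and graded pieces `V_r ⊗ det^(p-1-r)`,
`V_{p-2-r} ⊗ V_1^Fr`, `V_r ⊗ det^(p-1-r)`. For `r = p - 1` it is `V_{p-1}`. -/
noncomputable def projR (r : ℕ) : Subrepresentation (bigRep F p r) where
  toSubmodule := LinearMap.ker (bigCapelli F p r ∘ₗ bigCapelli F p r)
  apply_mem_toSubmodule g v hv := by
    simp only [LinearMap.mem_ker, LinearMap.comp_apply] at hv ⊢
    rw [bigCapelli_comm, bigCapelli_comm, hv, map_zero]

/-- `W_r ⊆ R_r`, the kernel of the projection of `R_r` onto `V_r ⊗ det^(p-1-r)`. For `r ≤ p - 2` the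
polarised determinant maps `R_r` onto its subrepresentation
`(x y' - y x')^(p-1-r) V_r(x', y') ≅ V_r ⊗ det^(p-1-r)`, so that this projection can be taken to be
the polarised determinant itself. -/
noncomputable def projW (r : ℕ) : Subrepresentation (projR F p r).toRepresentation where
  toSubmodule := LinearMap.ker (bigCapelli F p r ∘ₗ (projR F p r).toSubmodule.subtype)
  apply_mem_toSubmodule g v hv := by
    simp only [LinearMap.mem_ker, LinearMap.comp_apply, Submodule.subtype_apply] at hv ⊢
    change bigCapelli F p r (bigRep F p r g v.1) = 0
    rw [bigCapelli_comm, hv, map_zero]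

end Blocks

/-! ### Weights, `R_σ` and `A_σ` -/

section Weights

variable {k : Type u} [Field k] (F : Type v) [Field F] [Algebra k F]
  (p : ℕ) [Fact p.Prime] [CharP k p]

variable (k) in
/-- The `i`-th Frobenius twist `Γ = GL₂(k) → GL₂(F)`: apply `x ↦ x ^ (p ^ i)` to the entries and
then the inclusion `k → F`. -/
noncomputable def frob (i : ℕ) : GL (Fin 2) k →* GL (Fin 2) F :=
  Matrix.GeneralLinearGroup.map ((algebraMap k F).comp (iterateFrobenius k p i))

variable (k) in
/-- The character `det ^ a` of `Γ = GL₂(k)`, with values in `Fˣ`. -/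
noncomputable def detPow (a : ℤ) : GL (Fin 2) k →* Fˣ :=
  (zpowGroupHom a).comp
    ((Units.map (algebraMap k F : k →* F)).comp Matrix.GeneralLinearGroup.det)

variable (k) in
/-- The weight `(r_0, …, r_{f-1}) ⊗ det ^ a`. -/
noncomputable def weight {f : ℕ} (r : Fin f → ℕ) (a : ℤ) :
    Representation F (GL (Fin 2) k) (⨂[F] i, SymPow F (r i)) :=
  twist (piTensor fun i : Fin f => (symRep F (r i)).comp (frob k F p i)) (detPow k F a)

/-- A weight `(r_0, …, r_{f-1}) ⊗ det ^ a` is regular if no `r_i` is equal to `p - 1`. -/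
def IsRegular {f : ℕ} (r : Fin f → ℕ) : Prop := ∀ i, r i ≠ p - 1

variable (k) in
/-- `R_σ = (⨂ i, R_{r_i}^{Fr^i}) ⊗ det ^ (a + ∑ i, p ^ i r_i)` for the weight
`σ = (r_0, …, r_{f-1}) ⊗ det ^ a`. -/
noncomputable def repR {f : ℕ} (r : Fin f → ℕ) (a : ℤ) :
    Representation F (GL (Fin 2) k) (⨂[F] i, (projR F p (r i)).toSubmodule) :=
  twist (piTensor fun i : Fin f => (projR F p (r i)).toRepresentation.comp (frob k F p i))
    (detPow k F (a + ∑ i : Fin f, (p : ℤ) ^ (i : ℕ) * (r i : ℤ)))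

variable (k) in
/-- `A_σ = (⨂ i, W_{r_i}^{Fr^i}) ⊗ det ^ (a + ∑ i, p ^ i r_i)`, as a subrepresentation of `R_σ`:
the image of `⨂ i, W_{r_i}` in `⨂ i, R_{r_i}`. -/
noncomputable def repA {f : ℕ} (r : Fin f → ℕ) (a : ℤ) : Subrepresentation (repR k F p r a) where
  toSubmodule := LinearMap.range
    (PiTensorProduct.mapIncl fun i : Fin f => (projW F p (r i)).toSubmodule)
  apply_mem_toSubmodule g v hv := by
    obtain ⟨w, rfl⟩ := hv
    refine Submodule.smul_mem _ _
      ⟨piTensor (fun i : Fin f => (projW F p (r i)).toRepresentation.comp (frob k F p i)) g w, ?_⟩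
    induction w using PiTensorProduct.induction_on with
    | smul_tprod c x =>
      simp only [map_smul]
      congr 1
    | add x y hx hy => simp only [map_add, hx, hy]

end Weights

end SocleB

/-! Put `m i = p - 1 - r i`. The representation `R_σ` sits inside the ambient tensor product of the
Frobenius twists of `V_{m i} ⊗ V_{p-1}`. Letting `N` act on the `i`-th factor alone gives
equivariant endomorphisms `N i` of `R_σ`, of square zero, whose common kernel is `A_σ`
(`repA_toSubmodule`). Hence `(N i)` embeds `R_σ / A_σ` in a sum of `f` copies of `R_σ`, and three
facts suffice: (1) every nonzero subrepresentation of `R_σ` contains a fixed copy of `σ`, and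
`Hom(σ, R_σ)` is one-dimensional; (2) each `N i` hits this copy on the common kernel of the other `N
j`; (3) `R_σ` is injective. By (1) the socle of the quotient lies in `σ^f`, by (2) it fills it.
Every map `σ → R_σ` lands in `A_σ`, so by (3) the long exact sequence identifies `Ext¹(σ, A_σ)` with
`Hom(σ, R_σ / A_σ) = F^f`. `SocleData` packages (1) and (2); the formal conclusions are
`nonempty_socle_equiv` and `finrank_ext`.

For (1), a nonzero subrepresentation has a vector fixed by the unipotent group `U`. The
`U`-invariants of the ambient space are spanned by tensors of the vectors `(x y' - y x')^l x^(m-l)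
x'^(n-l)`, with `n = p - 1` (`mem_span_piHvec`); the torus separates these, and `N² = 0` forces each
`l` to be `0` or `m`. Applying the Weyl element and then `U`, and extracting one coefficient in the
parameter of `U`, produces the vector with all `l = m`, the highest weight vector of `σ`
(`piHvec_last_mem`).

For (2), `N u = (x y' - y x')^m x'^(n-m)` is solved explicitly with harmonic numbers
(`exists_capelli_eq_hvec`).

For (3), the ambient space has the Steinberg representation as a tensor factor. Summing over the
group the conjugates of a rank one endomorphism of that factor gives the identity
(`sum_conj_ambient`), so Higman's criterion applies, and `R_σ` is cut out by an equivariant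
retraction that is factorwise a polynomial in `N` (`exists_projection`). -/

namespace SocleB

universe u v

/-! ### Irreducible subrepresentations and Higman's criterion for injectivity. -/

section Abstract

variable {F : Type v} [Field F] {G : Type u} [Group G]

section Irreducible

variable {V : Type*} [AddCommGroup V] [Module F V] {ρ : Representation F G V}

lemma isIrreducible_of_forall_le {M : Subrepresentation ρ} (h0 : M.toSubmodule ≠ ⊥)
    (h : ∀ M' : Subrepresentation ρ, M'.toSubmodule ≤ M.toSubmodule → M'.toSubmodule ≠ ⊥ →
      M.toSubmodule ≤ M'.toSubmodule) : M.toRepresentation.IsIrreducible := by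
  have hne : (⊥ : Subrepresentation M.toRepresentation) ≠ ⊤ := by
    intro hbt
    apply h0
    rw [Submodule.eq_bot_iff]
    intro x hx
    have hx' : (⟨x, hx⟩ : M.toSubmodule) ∈ (⊤ : Subrepresentation M.toRepresentation).toSubmodule :=
      Submodule.mem_top
    rw [← hbt] at hx'
    exact congrArg Subtype.val ((Submodule.mem_bot F).mp hx')
  refine { exists_pair_ne := ⟨_, _, hne⟩, eq_bot_or_eq_top := fun K => ?_ }
  let M' : Subrepresentation ρ :=
    { toSubmodule := K.toSubmodule.map M.toSubmodule.subtype
      apply_mem_toSubmodule := by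
        rintro g _ ⟨x, hx, rfl⟩
        exact ⟨_, K.apply_mem_toSubmodule g hx, rfl⟩ }
  by_cases hK : K.toSubmodule = ⊥
  · exact Or.inl (Subrepresentation.toSubmodule_injective hK)
  · right
    refine Subrepresentation.toSubmodule_injective (eq_top_iff.mpr fun x _ => ?_)
    have := h M' (Submodule.map_subtype_le _ _) (fun hb => hK ((Submodule.eq_bot_iff _).mpr
      fun y hy => Subtype.ext ((Submodule.eq_bot_iff _).mp hb y ⟨y, hy, rfl⟩))) x.2
    obtain ⟨y, hy, hyx⟩ := this
    rwa [show x = y from Subtype.ext hyx.symm]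

lemma le_of_isIrreducible {M : Subrepresentation ρ} (hM : M.toRepresentation.IsIrreducible)
    {M' : Subrepresentation ρ} {x : V} (hx : x ∈ M.toSubmodule) (hx' : x ∈ M'.toSubmodule)
    (hx0 : x ≠ 0) : M.toSubmodule ≤ M'.toSubmodule := by
  let K : Subrepresentation M.toRepresentation :=
    { toSubmodule := M'.toSubmodule.comap M.toSubmodule.subtype
      apply_mem_toSubmodule := fun g y hy => M'.apply_mem_toSubmodule g hy }
  rcases hM.eq_bot_or_eq_top K with hK | hK
  · have : (⟨x, hx⟩ : M.toSubmodule) ∈ K.toSubmodule := hx'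
    rw [hK] at this
    exact absurd (congrArg Subtype.val ((Submodule.mem_bot F).mp this)) hx0
  · intro y hy
    have : (⟨y, hy⟩ : M.toSubmodule) ∈ K.toSubmodule := by rw [hK]; exact Submodule.mem_top
    exact this

end Irreducible

/-- A representation of a finite group on which the identity is a trace of a linear endomorphism is
an injective object. -/
lemma injective_of_sum_conj [Fintype G] {V : Type v} [AddCommGroup V] [Module F V]
    (ρ : Representation F G V) (φ : V →ₗ[F] V)
    (hφ : ∑ g : G, ρ g ∘ₗ φ ∘ₗ ρ g⁻¹ = LinearMap.id) : Injective (Rep.of ρ) where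
  factors {X Y} a i hi := by
    have hinj := (Rep.mono_iff_injective i).1 hi
    obtain ⟨s, hs⟩ := i.hom.toLinearMap.exists_leftInverse_of_injective
      (LinearMap.ker_eq_bot.mpr hinj)
    have hsi : ∀ x, s (i.hom x) = x := fun x => LinearMap.congr_fun hs x
    -- The linear extension `a ∘ s` is averaged with `φ` inserted. Reindexing the sum makes `H`
    -- equivariant. On the image of `i` the equivariance of `i` and `a` moves `g⁻¹` past `s`,
    -- leaving the trace of `φ`, which is the identity.
    let H : Y.V →ₗ[F] V := ∑ g : G, ρ g ∘ₗ φ ∘ₗ a.hom.toLinearMap ∘ₗ s ∘ₗ Y.ρ g⁻¹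
    have hH : ∀ y, H y = ∑ g : G, ρ g (φ (a.hom (s (Y.ρ g⁻¹ y)))) := fun y => by
      simp [H, LinearMap.sum_apply]
    let H' : Y.ρ.IntertwiningMap ρ := LinearMap.intertwiningMap_of_isIntertwiningMap _ _ H
      (fun g y => by
        rw [hH, hH, map_sum]
        refine Fintype.sum_equiv (Equiv.mulLeft g⁻¹) _ _ fun x => ?_
        simp only [Equiv.coe_mulLeft, mul_inv_rev, inv_inv, map_mul, Module.End.mul_apply]
        rw [← Module.End.mul_apply (ρ g) (ρ g⁻¹), ← map_mul, mul_inv_cancel, map_one]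
        rfl)
    refine ⟨Rep.ofHom H', ?_⟩
    ext x
    change H (i.hom x) = a.hom x
    rw [hH]
    have h1 : ∀ g : G, a.hom (s (Y.ρ g⁻¹ (i.hom x))) = ρ g⁻¹ (a.hom x) := fun g => by
      rw [← Rep.hom_comm_apply i, hsi]
      exact Rep.hom_comm_apply a _ _
    simp only [h1]
    simpa [LinearMap.sum_apply] using LinearMap.congr_fun hφ (a.hom x)

end Abstract

end SocleB

/-! ### Socle and first extension group of a quotient by a common kernel. -/

namespace SocleB

universe u v

/-- A representation `ρ` with simple socle `ε : σ → ρ`, with `End σ = F`, and with commuting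
endomorphisms `N i` each of which hits the socle on the common kernel of the others. -/
structure SocleData {F : Type v} [Field F] {G : Type u} [Group G] {V R : Type v} [AddCommGroup V]
    [Module F V] [AddCommGroup R] [Module F R] (σ : Representation F G V)
    (ρ : Representation F G R) (f : ℕ) where
  N : Fin f → ρ.IntertwiningMap ρ
  ε : σ.IntertwiningMap ρ
  v₀ : V
  v₀_ne : v₀ ≠ 0
  ε_inj : Function.Injective ε
  le_of_ne_bot : ∀ M : Subrepresentation ρ, M.toSubmodule ≠ ⊥ →
    LinearMap.range ε.toLinearMap ≤ M.toSubmodule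
  hom_eq : ∀ ψ : σ.IntertwiningMap ρ, ∃ c : F, ψ = c • ε
  exists_lift : ∀ i, ∃ z, N i z = ε v₀ ∧ ∀ j, j ≠ i → N j z = 0
  N_ε : ∀ i v, N i (ε v) = 0

namespace SocleData

variable {F : Type v} [Field F] {G : Type u} [Group G] {V R : Type v} [AddCommGroup V]
    [Module F V] [AddCommGroup R] [Module F R] {σ : Representation F G V}
    {ρ : Representation F G R} {f : ℕ} (D : SocleData σ ρ f) {A : Subrepresentation ρ}
    (hA : A.toSubmodule = ⨅ i, LinearMap.ker (D.N i).toLinearMap)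

include D in
-- The image under `ε` of a nonzero subrepresentation of `σ` is nonzero in `ρ`, so it contains the
-- whole range of `ε`.
lemma eq_top_of_ne_bot (M : Subrepresentation σ) (hM : M.toSubmodule ≠ ⊥) :
    M.toSubmodule = ⊤ := by
  let M' : Subrepresentation ρ :=
    { toSubmodule := M.toSubmodule.map D.ε.toLinearMap
      apply_mem_toSubmodule := by
        rintro g _ ⟨x, hx, rfl⟩
        exact ⟨_, M.apply_mem_toSubmodule g hx, D.ε.isIntertwining _ _ g x⟩ }
  have h := D.le_of_ne_bot M' fun hb => hM ((Submodule.eq_bot_iff _).mpr fun y hy => D.ε_inj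
    (((Submodule.eq_bot_iff _).mp hb _ ⟨y, hy, rfl⟩).trans (map_zero D.ε).symm))
  refine eq_top_iff.mpr fun x _ => ?_
  obtain ⟨y, hy, hyx⟩ := h ⟨x, rfl⟩
  rwa [← D.ε_inj hyx]

lemma exists_lift_all (i : Fin f) (v : V) :
    ∃ z, D.N i z = D.ε v ∧ ∀ j, j ≠ i → D.N j z = 0 := by
  let M : Subrepresentation σ :=
    { toSubmodule := ((⨅ j : {j // j ≠ i}, LinearMap.ker (D.N j).toLinearMap).map
        (D.N i).toLinearMap).comap D.ε.toLinearMap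
      apply_mem_toSubmodule := by
        rintro g v ⟨z, hz, hzv⟩
        refine ⟨ρ g z, ?_, ?_⟩
        · simp only [SetLike.mem_coe, Submodule.mem_iInf, LinearMap.mem_ker] at hz ⊢
          intro j
          exact ((D.N j).isIntertwining _ _ g z).trans ((congrArg _ (hz j)).trans (map_zero _))
        · exact ((D.N i).isIntertwining _ _ g z).trans ((congrArg _ hzv).trans
            (D.ε.isIntertwining _ _ g v).symm) }
  have hM : M.toSubmodule = ⊤ := D.eq_top_of_ne_bot M fun hb => by
    obtain ⟨z, hz, hz'⟩ := D.exists_lift i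
    refine D.v₀_ne ((Submodule.eq_bot_iff _).mp hb _ ⟨z, ?_, hz⟩)
    simp only [SetLike.mem_coe, Submodule.mem_iInf, LinearMap.mem_ker]
    exact fun j => hz' j j.2
  obtain ⟨z, hz, hz'⟩ : v ∈ M.toSubmodule := by rw [hM]; exact Submodule.mem_top
  simp only [SetLike.mem_coe, Submodule.mem_iInf, LinearMap.mem_ker] at hz
  exact ⟨z, hz', fun j hj => hz ⟨j, hj⟩⟩

/-- The embedding of `R / ⋂ ker (N i)` into a power of `R`. -/
def embed : R ⧸ A.toSubmodule →ₗ[F] Fin f → R :=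
  A.toSubmodule.liftQ (LinearMap.pi fun i => (D.N i).toLinearMap) (by
    rw [hA, LinearMap.ker_pi])

lemma embed_mk (z : R) (i : Fin f) : D.embed hA (A.toSubmodule.mkQ z) i = D.N i z := rfl

lemma embed_injective : Function.Injective (D.embed hA) := by
  rw [← LinearMap.ker_eq_bot, embed, Submodule.ker_liftQ_eq_bot]
  rw [LinearMap.ker_pi, hA]

lemma embed_quot (g : G) (x : R ⧸ A.toSubmodule) (i : Fin f) :
    D.embed hA (quot A g x) i = ρ g (D.embed hA x i) := by
  obtain ⟨z, rfl⟩ := A.toSubmodule.mkQ_surjective x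
  exact (D.N i).isIntertwining _ _ g z

/-- The lift chosen for index `i` contributes to coordinate `i` only, so the lifts can simply be
added. -/
lemma exists_embed_eq (d : Fin f → V) : ∃ x, D.embed hA x = fun i => D.ε (d i) := by
  choose z hz hz' using fun i => D.exists_lift_all i (d i)
  refine ⟨A.toSubmodule.mkQ (∑ i, z i), funext fun i => ?_⟩
  rw [embed_mk, map_sum, Finset.sum_eq_single i (fun j _ hj => hz' j i hj.symm) (by simp), hz]

/-- The embedding of a power of `σ` into `R / ⋂ ker (N i)`. -/
noncomputable def lift : (Fin f → V) →ₗ[F] R ⧸ A.toSubmodule :=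
  (LinearEquiv.ofInjective _ (D.embed_injective hA)).symm.toLinearMap ∘ₗ
    LinearMap.codRestrict _ (LinearMap.pi fun i => D.ε.toLinearMap ∘ₗ LinearMap.proj i)
      (fun d => by obtain ⟨x, hx⟩ := D.exists_embed_eq hA d; exact ⟨x, hx⟩)

lemma embed_lift (d : Fin f → V) (i : Fin f) : D.embed hA (D.lift hA d) i = D.ε (d i) := by
  have := congrArg Subtype.val ((LinearEquiv.ofInjective _ (D.embed_injective hA)).apply_symm_apply
    (LinearMap.codRestrict _ (LinearMap.pi fun i => D.ε.toLinearMap ∘ₗ LinearMap.proj i)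
      (fun d => by obtain ⟨x, hx⟩ := D.exists_embed_eq hA d; exact ⟨x, hx⟩) d))
  exact congrFun this i

lemma lift_injective : Function.Injective (D.lift hA) := fun d d' h => funext fun i =>
  D.ε_inj (by rw [← D.embed_lift hA, h, embed_lift])

lemma lift_smul (g : G) (d : Fin f → V) :
    D.lift hA (fun i => σ g (d i)) = quot A g (D.lift hA d) :=
  D.embed_injective hA (funext fun i => by
    rw [embed_lift, embed_quot, embed_lift, D.ε.isIntertwining])

lemma mem_range_lift {x : R ⧸ A.toSubmodule}
    (hx : ∀ i, D.embed hA x i ∈ LinearMap.range D.ε.toLinearMap) :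
    x ∈ LinearMap.range (D.lift hA) := by
  choose d hd using hx
  exact ⟨d, D.embed_injective hA (funext fun i => (D.embed_lift hA d i).trans (hd i))⟩

/-- For an irreducible `M` in the quotient, each coordinate image of `M` in `R` is zero or meets the
range of `ε`; irreducibility then puts the entire coordinate image inside that range. Conversely
each coordinate copy of `σ` is irreducible. -/
lemma socle_quot : (socle (quot A)).toSubmodule = LinearMap.range (D.lift hA) := by
  apply le_antisymm
  · refine iSup_le fun ⟨M, hM⟩ => ?_
    change M.toSubmodule ≤ _
    suffices h : ∀ i, ∀ x ∈ M.toSubmodule, D.embed hA x i ∈ LinearMap.range D.ε.toLinearMap from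
      fun x hx => D.mem_range_lift hA fun i => h i x hx
    intro i
    let M₁ : Subrepresentation ρ :=
      { toSubmodule := M.toSubmodule.map (LinearMap.proj i ∘ₗ D.embed hA)
        apply_mem_toSubmodule := by
          rintro g _ ⟨x, hx, rfl⟩
          exact ⟨_, M.apply_mem_toSubmodule g hx, D.embed_quot hA g x i⟩ }
    by_cases h₁ : M₁.toSubmodule = ⊥
    · intro x hx
      rw [show D.embed hA x i = 0 from (Submodule.eq_bot_iff _).mp h₁ _ ⟨x, hx, rfl⟩]
      exact Submodule.zero_mem _
    -- A vector of `M` with `i`-th coordinate `ε v₀` is a nonzero common element of `M` and of the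
    -- preimage `M₂` of the range of `ε`, so `M` lies in `M₂`.
    · obtain ⟨x, hx, hxv⟩ := D.le_of_ne_bot M₁ h₁ ⟨D.v₀, rfl⟩
      let M₂ : Subrepresentation (quot A) :=
        { toSubmodule := (LinearMap.range D.ε.toLinearMap).comap (LinearMap.proj i ∘ₗ D.embed hA)
          apply_mem_toSubmodule := by
            rintro g x ⟨v, hv⟩
            refine ⟨σ g v, ?_⟩
            refine (D.ε.isIntertwining _ _ g v).trans ?_
            exact (congrArg (ρ g) hv).trans (D.embed_quot hA g x i).symm }
      refine le_of_isIrreducible hM (M' := M₂) hx ⟨D.v₀, hxv.symm⟩ ?_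
      rintro rfl
      refine D.v₀_ne (D.ε_inj ?_)
      rw [map_zero]
      exact hxv.symm.trans (map_zero _)
  · rintro _ ⟨d, rfl⟩
    have hd : d = ∑ i, Pi.single i (d i) := (Finset.univ_sum_single d).symm
    rw [hd, map_sum]
    refine Submodule.sum_mem _ fun i _ => ?_
    let M : Subrepresentation (quot A) :=
      { toSubmodule := LinearMap.range (D.lift hA ∘ₗ LinearMap.single F (fun _ => V) i)
        apply_mem_toSubmodule := by
          rintro g _ ⟨v, rfl⟩
          refine ⟨σ g v, ?_⟩
          simp only [LinearMap.comp_apply, LinearMap.single_apply]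
          rw [← lift_smul]
          congr 1
          funext j
          exact (Pi.apply_single (fun _ => σ g) (fun _ => map_zero _) i v j).symm }
    have hM : M.toRepresentation.IsIrreducible := by
      refine isIrreducible_of_forall_le ?_ fun M' _ hM' => ?_
      · intro hb
        have := (Submodule.eq_bot_iff _).mp hb _ ⟨D.v₀, rfl⟩
        rw [LinearMap.comp_apply] at this
        have := congrFun (D.lift_injective hA (this.trans (map_zero (D.lift hA)).symm)) i
        simp only [LinearMap.single_apply, Pi.single_eq_same, Pi.zero_apply] at this
        exact D.v₀_ne this
      · let K : Subrepresentation σ :=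
          { toSubmodule := M'.toSubmodule.comap (D.lift hA ∘ₗ LinearMap.single F (fun _ => V) i)
            apply_mem_toSubmodule := by
              intro g v hv
              have := M'.apply_mem_toSubmodule g hv
              simp only [LinearMap.comp_apply, LinearMap.single_apply, Submodule.mem_comap]
                 at this ⊢
              rw [← lift_smul] at this
              convert this using 2
              funext j
              exact (Pi.apply_single (fun _ => σ g) (fun _ => map_zero _) i v j).symm }
        have hK : K.toSubmodule = ⊤ := by
          obtain ⟨x, hx, hx0⟩ := (Submodule.ne_bot_iff _).mp hM'
          obtain ⟨v, rfl⟩ := ‹M'.toSubmodule ≤ M.toSubmodule› hx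
          refine D.eq_top_of_ne_bot K ((Submodule.ne_bot_iff _).mpr ⟨v, hx, ?_⟩)
          rintro rfl
          exact hx0 (map_zero _)
        rintro _ ⟨v, rfl⟩
        have : v ∈ K.toSubmodule := by rw [hK]; exact Submodule.mem_top
        exact this
    refine Submodule.mem_iSup_of_mem ⟨M, hM⟩ ⟨d i, rfl⟩

include hA in
theorem nonempty_socle_equiv : Nonempty ((socle (quot A)).toRepresentation.Equiv
    (Representation.directSum fun _ : Fin f => σ)) := by
  let e : (⨁ _ : Fin f, V) ≃ₗ[F] (socle (quot A)).toSubmodule :=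
    (DirectSum.linearEquivFunOnFintype F (Fin f) fun _ => V).trans
      ((LinearEquiv.ofInjective _ (D.lift_injective hA)).trans
        (LinearEquiv.ofEq _ _ (D.socle_quot hA).symm))
  have he : ∀ d, (e d : R ⧸ A.toSubmodule) = D.lift hA (fun i => d i) := fun d => rfl
  refine ⟨(Representation.Equiv.mk e fun g => LinearMap.ext fun d => Subtype.ext ?_).symm⟩
  change (e (Representation.directSum (fun _ : Fin f => σ) g d) : R ⧸ A.toSubmodule) =
    quot A g (e d : R ⧸ A.toSubmodule)
  rw [he, he, ← lift_smul]
  rfl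

/-- The homomorphism `σ → R / ⋂ ker (N i)` with given coordinates. -/
noncomputable def homOfCoeff : (Fin f → F) →ₗ[F] (Rep.of σ ⟶ Rep.of (quot A)) where
  toFun c := Rep.ofHom (LinearMap.intertwiningMap_of_isIntertwiningMap σ (quot A)
    (D.lift hA ∘ₗ LinearMap.pi fun i => c i • LinearMap.id) fun g v => by
      simp only [LinearMap.comp_apply]
      rw [← lift_smul]
      congr 1
      funext i
      simp)
  map_add' c c' := by
    ext v
    change D.lift hA _ = D.lift hA _ + D.lift hA _
    rw [← map_add]
    congr 1
    funext i
    simp [add_smul]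
  map_smul' a c := by
    ext v
    change D.lift hA _ = a • D.lift hA _
    rw [← map_smul]
    congr 1
    funext i
    simp [mul_smul]

lemma homOfCoeff_apply (c : Fin f → F) (v : V) :
    (D.homOfCoeff hA c).hom v = D.lift hA (fun i => c i • v) := rfl

/-- Each coordinate of a map `σ → R / A ⊆ R^f` is a map `σ → R`, hence a scalar multiple of `ε`. -/
lemma homOfCoeff_bijective : Function.Bijective (D.homOfCoeff hA) := by
  constructor
  · intro c c' h
    funext i
    have : (D.homOfCoeff hA c).hom D.v₀ = (D.homOfCoeff hA c').hom D.v₀ := by rw [h]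
    rw [homOfCoeff_apply, homOfCoeff_apply] at this
    exact smul_left_injective F D.v₀_ne (congrFun (D.lift_injective hA this) i)
  · intro θ
    choose c hc using fun i => D.hom_eq (LinearMap.intertwiningMap_of_isIntertwiningMap σ ρ
      (LinearMap.proj i ∘ₗ D.embed hA ∘ₗ θ.hom.toLinearMap) fun g v => by
        refine Eq.trans ?_ (D.embed_quot hA g (θ.hom v) i)
        exact congrArg (fun x => D.embed hA x i) (Rep.hom_comm_apply θ g v))
    refine ⟨c, ?_⟩
    ext v
    refine D.embed_injective hA (funext fun i => ?_)
    have := congrArg (fun ψ : σ.IntertwiningMap ρ => ψ v) (hc i)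
    refine Eq.trans ?_ this.symm
    change D.embed hA (D.lift hA _) i = c i • D.ε v
    rw [embed_lift]
    exact map_smul D.ε (c i) v

/-- The short complex `0 → A → R → R / A → 0`. -/
@[simps]
noncomputable def shortComplex (A : Subrepresentation ρ) : ShortComplex (Rep.{v} F G) where
  X₁ := Rep.of (X := A.toSubmodule) A.toRepresentation
  X₂ := Rep.of ρ
  X₃ := Rep.of (quot A)
  f := Rep.ofHom (LinearMap.intertwiningMap_of_isIntertwiningMap _ _ A.toSubmodule.subtype
    fun _ _ => rfl)
  g := Rep.ofHom (LinearMap.intertwiningMap_of_isIntertwiningMap _ _ A.toSubmodule.mkQ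
    fun _ _ => rfl)
  zero := by
    ext x
    exact (Submodule.Quotient.mk_eq_zero _).mpr x.2

lemma shortComplex_shortExact (A : Subrepresentation ρ) : (shortComplex A).ShortExact := by
  have hf : Mono (shortComplex A).f :=
    (Rep.mono_iff_injective _).2 A.toSubmodule.injective_subtype
  have hg : Epi (shortComplex A).g := (Rep.epi_iff_surjective _).2 A.toSubmodule.mkQ_surjective
  refine ⟨ShortComplex.exact_of_f_is_kernel _
    (Limits.KernelFork.IsLimit.ofι' _ _ fun {T} k hk => ?_)⟩
  have hk' : ∀ x, k.hom x ∈ A.toSubmodule := fun x =>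
    (Submodule.Quotient.mk_eq_zero _).mp (congrArg (fun h : T ⟶ _ => h.hom x) hk)
  refine ⟨Rep.ofHom (LinearMap.intertwiningMap_of_isIntertwiningMap _ A.toRepresentation
    (LinearMap.codRestrict A.toSubmodule k.hom.toLinearMap hk') fun g x =>
      Subtype.ext (Rep.hom_comm_apply k g x)), ?_⟩
  ext x
  rfl

-- In the long exact sequence of `Hom(σ, -)` the connecting map `Hom(σ, R / A) → Ext¹(σ, A)` is an
-- isomorphism: it is onto because `R` is injective, and one-to-one because no nonzero map `σ → R /
-- A` lifts to `R`.
include D hA in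
theorem finrank_ext [Injective (Rep.of ρ)] : Module.finrank F
    (Abelian.Ext (Rep.of σ) (Rep.of (X := A.toSubmodule) A.toRepresentation) 1) = f := by
  have hS := shortComplex_shortExact A
  let δ : (Rep.of σ ⟶ Rep.of (quot A)) →ₗ[F]
      Abelian.Ext (Rep.of σ) (Rep.of (X := A.toSubmodule) A.toRepresentation) 1 :=
    (Abelian.Ext.postcompOfLinear hS.extClass F (Rep.of σ) (zero_add 1)) ∘ₗ
      (Abelian.Ext.linearEquiv₀ (R := F)).symm.toLinearMap
  have hδ : Function.Bijective δ := by
    constructor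
    · rw [← LinearMap.ker_eq_bot, Submodule.eq_bot_iff]
      intro θ hθ
      have hθ' : (Abelian.Ext.mk₀ θ).comp hS.extClass (zero_add 1) = 0 := by
        simpa [δ] using! hθ
      obtain ⟨x, hx⟩ := Abelian.Ext.covariant_sequence_exact₃ _ hS _ _ hθ'
      obtain ⟨ψ, rfl⟩ := (Abelian.Ext.linearEquiv₀ (R := F)).symm.surjective x
      rw [Abelian.Ext.linearEquiv₀_symm_apply] at hx
      erw [Abelian.Ext.mk₀_comp_mk₀] at hx
      have hθψ : ψ ≫ (shortComplex A).g = θ :=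
        (Abelian.Ext.linearEquiv₀ (R := F)).symm.injective (by
          simpa using! hx)
      rw [← hθψ]
      -- A map that lifts to `R` is induced by a multiple of `ε`; as all `N i` kill the range of
      -- `ε`, it dies in `R / A`.
      obtain ⟨c, hc⟩ := D.hom_eq ψ.hom
      ext v
      refine (Submodule.Quotient.mk_eq_zero _).mpr ?_
      change ψ.hom v ∈ A.toSubmodule
      rw [hc]
      have hmem : D.ε v ∈ A.toSubmodule := by
        rw [hA, Submodule.mem_iInf]
        exact fun i => D.N_ε i v
      exact A.toSubmodule.smul_mem c hmem
    · intro x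
      obtain ⟨y, hy⟩ := Abelian.Ext.covariant_sequence_exact₁ _ hS x
        (Abelian.Ext.eq_zero_of_injective (I := Rep.of ρ) _) (zero_add 1)
      obtain ⟨θ, rfl⟩ := (Abelian.Ext.linearEquiv₀ (R := F)).symm.surjective y
      exact ⟨θ, hy⟩
  rw [← (LinearEquiv.ofBijective δ hδ).finrank_eq,
    ← (LinearEquiv.ofBijective _ (D.homOfCoeff_bijective hA)).finrank_eq]
  simp

end SocleData

end SocleB

namespace SocleB

universe u v

/-! ### Power sums and digits -/

section Digits

/-- For `i > 0` this is the power sum over the units. For `i = 0` the term `0 ^ 0 = 1` brings the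
sum to the cardinality of `k`, which is zero in `k`; this is why positivity appears. -/
lemma sum_pow_eq_ite (k : Type*) [Field k] [Fintype k] (i : ℕ) :
    ∑ x : k, x ^ i = if 0 < i ∧ Fintype.card k - 1 ∣ i then -1 else 0 := by
  classical
  rcases Nat.eq_zero_or_pos i with rfl | hi
  · simp
  · rw [← Finset.sum_erase_add _ _ (Finset.mem_univ (0 : k)), zero_pow hi.ne', add_zero]
    have h := FiniteField.sum_pow_units k i
    simp only [hi, true_and]
    rw [← h]
    symm
    refine Finset.sum_bij (fun x _ => (x : k)) (by simp) (by simp [Units.val_inj]) ?_ (by simp)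
    intro b hb
    exact ⟨Units.mk0 b (by simpa using hb), by simp, rfl⟩

lemma sum_pow_mul_pred (p : ℕ) : ∀ f : ℕ,
    ∑ i : Fin f, (p : ℤ) ^ (i : ℕ) * ((p : ℤ) - 1) = (p : ℤ) ^ f - 1
  | 0 => by simp
  | f + 1 => by
    rw [Fin.sum_univ_castSucc]
    simp only [Fin.val_castSucc, Fin.val_last]
    rw [sum_pow_mul_pred p f]
    ring

/-- The lowest digit is divisible by `p` and smaller than `p` in absolute value, so it vanishes;
then divide by `p`. -/
lemma digits_eq_zero {p : ℕ} : ∀ {f : ℕ} (δ : Fin f → ℤ) (_ : ∀ i, |δ i| ≤ (p : ℤ) - 1)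
    (_ : ∑ i : Fin f, (p : ℤ) ^ (i : ℕ) * δ i = 0), ∀ i, δ i = 0
  | 0, _, _, _ => fun i => i.elim0
  | f + 1, δ, h, hs => by
    rw [Fin.sum_univ_succ] at hs
    simp only [Fin.val_zero, pow_zero, one_mul, Fin.val_succ, pow_succ] at hs
    have h0 : δ 0 = (p : ℤ) * -(∑ i : Fin f, (p : ℤ) ^ (i : ℕ) * δ i.succ) := by
      rw [mul_neg, Finset.mul_sum, eq_neg_iff_add_eq_zero, ← hs]
      congr 1
      exact Finset.sum_congr rfl fun i _ => by ring
    have hp : (0 : ℤ) < p := by have := (abs_nonneg _).trans (h 0); linarith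
    have h00 : δ 0 = 0 := Int.eq_zero_of_abs_lt_dvd ⟨_, h0⟩ (by linarith [h 0])
    have hs' : ∑ i : Fin f, (p : ℤ) ^ (i : ℕ) * δ i.succ = 0 := by
      rw [h00] at h0
      rcases mul_eq_zero.mp h0.symm with h1 | h1
      · exact absurd h1 hp.ne'
      · simpa using h1
    exact Fin.cases h00 (digits_eq_zero (fun i => δ i.succ) (fun i => h _) hs')

/-- The sum lies between `-(p ^ f - 1)` and `p ^ f - 1`, so a multiple of `p ^ f - 1` is `0` or an
extreme value, and an extreme value is reached only when all digits are extreme. -/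
lemma digits_eq_of_dvd {p f : ℕ} (hp : 0 < p) (δ : Fin f → ℤ) (h : ∀ i, |δ i| ≤ (p : ℤ) - 1)
    (hs : (p : ℤ) ^ f - 1 ∣ ∑ i : Fin f, (p : ℤ) ^ (i : ℕ) * δ i) :
    (∀ i, δ i = 0) ∨ (∀ i, δ i = (p : ℤ) - 1) ∨ (∀ i, δ i = -((p : ℤ) - 1)) := by
  have hp' : ∀ i : ℕ, (0 : ℤ) < (p : ℤ) ^ i := fun i => by positivity
  have hext : ∀ δ : Fin f → ℤ, (∀ i, |δ i| ≤ (p : ℤ) - 1) →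
      ∑ i : Fin f, (p : ℤ) ^ (i : ℕ) * δ i ≤ (p : ℤ) ^ f - 1 ∧
      (∑ i : Fin f, (p : ℤ) ^ (i : ℕ) * δ i = (p : ℤ) ^ f - 1 → ∀ i, δ i = (p : ℤ) - 1) := by
    intro δ h
    have hnn : ∀ i ∈ (Finset.univ : Finset (Fin f)), 0 ≤ (p : ℤ) ^ (i : ℕ) *
        ((p : ℤ) - 1 - δ i) := fun i _ =>
      mul_nonneg (hp' i).le (by linarith [le_abs_self (δ i), h i])
    have he : ∑ i : Fin f, (p : ℤ) ^ (i : ℕ) * ((p : ℤ) - 1 - δ i) =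
        (p : ℤ) ^ f - 1 - ∑ i : Fin f, (p : ℤ) ^ (i : ℕ) * δ i := by
      rw [← sum_pow_mul_pred, ← Finset.sum_sub_distrib]
      exact Finset.sum_congr rfl fun i _ => by ring
    refine ⟨by linarith [Finset.sum_nonneg hnn], fun h1 i => ?_⟩
    rw [h1, sub_self] at he
    have := (Finset.sum_eq_zero_iff_of_nonneg hnn).mp he i (Finset.mem_univ i)
    rcases mul_eq_zero.mp this with h2 | h2
    · exact absurd h2 (hp' i).ne'
    · linarith
  obtain ⟨hu, hu'⟩ := hext δ h
  obtain ⟨hl, hl'⟩ := hext (fun i => -δ i) (fun i => by simpa using h i)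
  simp only [mul_neg, Finset.sum_neg_distrib] at hl hl'
  obtain ⟨c, hc⟩ := hs
  have hq : (0 : ℤ) ≤ (p : ℤ) ^ f - 1 := by have := hp' f; omega
  -- When `p ^ f = 1`, in particular for `f = 0`, the modulus is zero and divisibility already says
  -- that the sum vanishes.
  rcases hq.eq_or_lt with hq0 | hq0
  · exact Or.inl (digits_eq_zero δ h (by rw [hc, ← hq0, zero_mul]))
  have hc1 : c ≤ 1 := by nlinarith
  have hc2 : -1 ≤ c := by nlinarith
  rcases (by omega : c = 0 ∨ c = 1 ∨ c = -1) with rfl | rfl | rfl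
  · exact Or.inl (digits_eq_zero δ h (by rw [hc, mul_zero]))
  · exact Or.inr (Or.inl (hu' (by rw [hc, mul_one])))
  · refine Or.inr (Or.inr fun i => ?_)
    have := hl' (by rw [hc]; ring) i
    linarith

end Digits

/-! ### Extracting coefficients from values at the points of a finite field -/

section Extraction

variable {k : Type*} [Field k] [Fintype k] {F : Type*} [Field F] [Algebra k F]
  {X : Type*} [AddCommGroup X] [Module F X]

/-- Multiplying by `t ^ (q - 1 - e a₀)` and summing over `t` in `k` (where `q` is the cardinality of
`k`) is a discrete Fourier inversion: `huniq` says that only the term `a₀` survives, with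
coefficient `-1`. -/
lemma coeff_mem_of_forall_sum_mem {κ : Type*} (M : Submodule F X) (S : Finset κ) (w : κ → X)
    (e : κ → ℕ) (h : ∀ t : k, ∑ a ∈ S, (algebraMap k F t) ^ e a • w a ∈ M) {a₀ : κ}
    (ha₀ : a₀ ∈ S) (hle : e a₀ ≤ Fintype.card k - 1)
    (huniq : ∀ a ∈ S, 0 < Fintype.card k - 1 - e a₀ + e a →
      Fintype.card k - 1 ∣ Fintype.card k - 1 - e a₀ + e a → a = a₀) : w a₀ ∈ M := by
  classical
  have hq : 0 < Fintype.card k - 1 := Nat.sub_pos_of_lt Fintype.one_lt_card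
  have h1 : ∑ t : k, (algebraMap k F t) ^ (Fintype.card k - 1 - e a₀) •
      ∑ a ∈ S, (algebraMap k F t) ^ e a • w a ∈ M :=
    Submodule.sum_mem _ fun t _ => Submodule.smul_mem _ _ (h t)
  have h2 : ∑ t : k, (algebraMap k F t) ^ (Fintype.card k - 1 - e a₀) •
      ∑ a ∈ S, (algebraMap k F t) ^ e a • w a = - w a₀ := by
    simp only [Finset.smul_sum, smul_smul, ← pow_add]
    rw [Finset.sum_comm]
    simp only [← Finset.sum_smul, ← map_pow, ← map_sum, sum_pow_eq_ite]
    rw [Finset.sum_eq_single a₀]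
    · rw [Nat.sub_add_cancel hle]
      simp [hq]
    · intro a ha hne
      rw [if_neg, map_zero, zero_smul]
      exact fun hh => hne (huniq a ha hh.1 hh.2)
    · exact fun hh => absurd ha₀ hh
  rw [h2] at h1
  simpa using M.neg_mem h1

variable {p f : ℕ}

/-- The digit differences `a i - a₀ i` satisfy `digits_eq_of_dvd`. Of its two exceptional cases, all
differences `p - 1` contradicts `hex`, and all differences `-(p - 1)` makes the exponent zero,
against `hpos`. -/
lemma tuple_eq_of_dvd (hp : 2 ≤ p) {d a a₀ : Fin f → ℕ} (ha : ∀ i, a i ≤ d i)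
    (ha₀ : ∀ i, a₀ i ≤ p - 1) (hd : ∀ i, d i ≤ a₀ i + (p - 1))
    (hex : ∃ i, d i < a₀ i + (p - 1))
    (hpos : 0 < p ^ f - 1 - ∑ i : Fin f, p ^ (i : ℕ) * a₀ i + ∑ i : Fin f, p ^ (i : ℕ) * a i)
    (hdvd : p ^ f - 1 ∣
      p ^ f - 1 - ∑ i : Fin f, p ^ (i : ℕ) * a₀ i + ∑ i : Fin f, p ^ (i : ℕ) * a i) :
    a = a₀ := by
  have h1p : 1 ≤ p ^ f := Nat.one_le_pow _ _ (by omega)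
  have hle : ∑ i : Fin f, p ^ (i : ℕ) * a₀ i ≤ p ^ f - 1 := by
    zify [h1p]
    rw [← sum_pow_mul_pred]
    refine Finset.sum_le_sum fun i _ => mul_le_mul_of_nonneg_left ?_ (by positivity)
    have := ha₀ i
    omega
  have hcast : ((p ^ f - 1 - ∑ i : Fin f, p ^ (i : ℕ) * a₀ i + ∑ i : Fin f, p ^ (i : ℕ) *
      a i : ℕ) : ℤ) =
      ((p : ℤ) ^ f - 1) + ∑ i : Fin f, (p : ℤ) ^ (i : ℕ) * ((a i : ℤ) - a₀ i) := by
    push_cast [Nat.cast_sub hle, Nat.cast_sub h1p]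
    simp only [mul_sub, Finset.sum_sub_distrib]
    ring
  have hdvd' : (p : ℤ) ^ f - 1 ∣ ∑ i : Fin f, (p : ℤ) ^ (i : ℕ) * ((a i : ℤ) - a₀ i) := by
    have := Int.natCast_dvd_natCast.mpr hdvd
    rw [hcast] at this
    push_cast [Nat.cast_sub h1p] at this
    exact (dvd_add_right dvd_rfl).mp this
  have hpos' : (0 : ℤ) <
      ((p : ℤ) ^ f - 1) + ∑ i : Fin f, (p : ℤ) ^ (i : ℕ) * ((a i : ℤ) - a₀ i) := by
    rw [← hcast]
    exact_mod_cast hpos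
  rcases digits_eq_of_dvd (by omega) _ (fun i => by
    have h1 := ha i; have h2 := ha₀ i; have h3 := hd i
    rw [abs_le]; omega) hdvd' with h | h | h
  · funext i
    have := h i
    omega
  · obtain ⟨i, hi⟩ := hex
    have h1 := h i
    have h2 := ha i
    omega
  · exfalso
    simp only [h, mul_neg, Finset.sum_neg_distrib, sum_pow_mul_pred] at hpos'
    linarith

variable (hk : Fintype.card k = p ^ f)
include hk

omit [Field k] in
lemma sum_digits_le (hp : 2 ≤ p) {a₀ : Fin f → ℕ} (ha₀ : ∀ i, a₀ i ≤ p - 1) :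
    ∑ i : Fin f, p ^ (i : ℕ) * a₀ i ≤ Fintype.card k - 1 := by
  rw [hk]
  have h1p : 1 ≤ p ^ f := Nat.one_le_pow _ _ (by omega)
  zify [h1p]
  rw [← sum_pow_mul_pred]
  refine Finset.sum_le_sum fun i _ => mul_le_mul_of_nonneg_left ?_ (by positivity)
  have := ha₀ i
  omega

lemma tuple_coeff_mem (hp : 2 ≤ p) (M : Submodule F X) (d : Fin f → ℕ) (w : (Fin f → ℕ) → X)
    (h : ∀ t : k, ∑ a ∈ Fintype.piFinset fun i => Finset.range (d i + 1),
      (algebraMap k F t) ^ (∑ i : Fin f, p ^ (i : ℕ) * a i) • w a ∈ M) {a₀ : Fin f → ℕ}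
    (h₀ : ∀ i, a₀ i ≤ d i) (ha₀ : ∀ i, a₀ i ≤ p - 1) (hd : ∀ i, d i ≤ a₀ i + (p - 1))
    (hex : ∃ i, d i < a₀ i + (p - 1)) : w a₀ ∈ M := by
  refine coeff_mem_of_forall_sum_mem (k := k) M _ w (fun a => ∑ i : Fin f, p ^ (i : ℕ) * a i) h
    (by simpa [Nat.lt_succ_iff] using h₀) (sum_digits_le hk hp ha₀) ?_
  intro a ha hpos hdvd
  rw [hk] at hpos hdvd
  exact tuple_eq_of_dvd hp (by simpa [Nat.lt_succ_iff] using ha) ha₀ hd hex hpos hdvd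

/-- The zero tuple needs separate care, since its exponent `0` and the exponent `q - 1` of the tuple
with all entries `p - 1` agree on units. The nonzero tuples are handled first, and `t = 1` then
isolates the remaining coefficient. -/
lemma tuple_coeff_eq_zero (hp : 2 ≤ p) (w : (Fin f → ℕ) → X)
    (h : ∀ t : k, ∑ a ∈ Fintype.piFinset fun _ : Fin f => Finset.range (p - 1 + 1),
      (algebraMap k F t) ^ (∑ i : Fin f, p ^ (i : ℕ) * a i) • w a = 0) {a₀ : Fin f → ℕ}
    (ha₀ : ∀ i, a₀ i ≤ p - 1) : w a₀ = 0 := by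
  have h1 : ∀ a₀ : Fin f → ℕ, (∀ i, a₀ i ≤ p - 1) → a₀ ≠ 0 → w a₀ = 0 := by
    intro a₀ ha₀ hne
    obtain ⟨i, hi⟩ := Function.ne_iff.mp hne
    exact (Submodule.mem_bot F).mp (tuple_coeff_mem hk hp ⊥ (fun _ => p - 1) w
      (fun t => (Submodule.mem_bot F).mpr (h t)) ha₀ ha₀ (fun i => by omega)
      ⟨i, by simp at hi; omega⟩)
  by_cases hne : a₀ = 0
  · subst hne
    have := h 1
    rw [Finset.sum_eq_single 0] at this
    · simpa using this
    · intro b hb hb0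
      rw [h1 b (by simpa [Nat.lt_succ_iff] using hb) hb0, smul_zero]
    · intro hh
      simp at hh
  · exact h1 a₀ ha₀ hne

end Extraction

/-! ### Fixed vectors of elementary abelian groups -/

/-- In characteristic `p` one has `(u s - 1) ^ p = u (p • s) - 1 = 0`, so the `u s` are commuting
unipotent operators, which have a common fixed vector in every nonzero stable subspace. -/
lemma exists_fixed_of_add_hom {k : Type*} [AddCommGroup k] [Finite k] {F : Type*} [Field F] (p : ℕ)
    [Fact p.Prime] [CharP F p] (hk : ∀ t : k, p • t = 0) {X : Type*} [AddCommGroup X] [Module F X]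
    (u : k → X →ₗ[F] X) (h0 : u 0 = 1) (hadd : ∀ s t, u (s + t) = u s * u t) (M : Submodule F X)
    (hM : M ≠ ⊥) (hstab : ∀ t, ∀ x ∈ M, u t x ∈ M) :
    ∃ m ∈ M, m ≠ 0 ∧ ∀ t, u t m = m := by
  classical
  have := Fintype.ofFinite k
  suffices h : ∀ S : Finset k, ∃ m ∈ M, m ≠ 0 ∧ ∀ t ∈ S, u t m = m by
    obtain ⟨m, hm, hm0, h⟩ := h Finset.univ
    exact ⟨m, hm, hm0, fun t => h t (Finset.mem_univ t)⟩
  have hcomm : ∀ s t, Commute (u s) (u t) := fun s t => by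
    rw [Commute, SemiconjBy, ← hadd, add_comm, hadd]
  have hpow : ∀ (n : ℕ) t, u t ^ n = u (n • t) := by
    intro n t
    induction n with
    | zero => simp [h0]
    | succ n ih => rw [pow_succ, ih, succ_nsmul, hadd]
  intro S
  induction S using Finset.induction_on with
  | empty =>
    obtain ⟨m, hm, hm0⟩ := (Submodule.ne_bot_iff _).mp hM
    exact ⟨m, hm, hm0, by simp⟩
  | insert s S _ ih =>
    obtain ⟨m, hm, hm0, hfix⟩ := ih
    have hnil : ((u s - 1) ^ p : Module.End F X) m = 0 := by
      have : Nontrivial X := ⟨m, 0, hm0⟩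
      have : CharP (Module.End F X) p :=
        charP_of_injective_algebraMap (algebraMap F (Module.End F X)).injective p
      rw [sub_pow_char_of_commute _ (Commute.one_right (u s)), hpow, hk, h0]
      simp
    have hex : ∃ n, ((u s - 1) ^ n : Module.End F X) m = 0 := ⟨p, hnil⟩
    -- The last nonzero power of `u s - 1` applied to `m` is fixed by `u s`, and by commutativity it
    -- stays fixed by the operators treated before.
    obtain ⟨n, hn⟩ : ∃ n, Nat.find hex = n + 1 := by
      refine Nat.exists_eq_succ_of_ne_zero fun h => hm0 ?_
      have := Nat.find_spec hex
      rw [h] at this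
      simpa using this
    refine ⟨((u s - 1) ^ n : Module.End F X) m, ?_, Nat.find_min hex (by omega), fun t ht => ?_⟩
    · have : ∀ n, ((u s - 1) ^ n : Module.End F X) m ∈ M := by
        intro n
        induction n with
        | zero => simpa using hm
        | succ n ih =>
          rw [pow_succ', Module.End.mul_apply]
          exact M.sub_mem (hstab _ _ ih) ih
      exact this n
    · rcases Finset.mem_insert.mp ht with rfl | ht
      · have := Nat.find_spec hex
        rw [hn, pow_succ', Module.End.mul_apply] at this
        exact sub_eq_zero.mp this
      · have hc : Commute (u t) ((u s - 1) ^ n : Module.End F X) :=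
          ((hcomm t s).sub_right (Commute.one_right _)).pow_right n
        rw [← Module.End.mul_apply, hc.eq, Module.End.mul_apply, hfix t ht]

/-! ### Tensor products of families of linear maps -/

section PiTensor

variable {F : Type*} [Field F] {ι : Type*} [Fintype ι] {V W : ι → Type*}
  [∀ i, AddCommGroup (V i)] [∀ i, Module F (V i)] [∀ i, AddCommGroup (W i)] [∀ i, Module F (W i)]

lemma map_sum_smul [DecidableEq ι] {κ : ι → Type*} (S : ∀ i, Finset (κ i)) (c : ∀ i, κ i → F)
    (E : ∀ i, κ i → V i →ₗ[F] W i) :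
    PiTensorProduct.map (fun i => ∑ a ∈ S i, c i a • E i a) =
      ∑ a ∈ Fintype.piFinset S, (∏ i, c i (a i)) • PiTensorProduct.map fun i => E i (a i) := by
  have := (PiTensorProduct.mapMultilinear F V W).map_sum_finset (fun i a => c i a • E i a) S
  simp only [PiTensorProduct.mapMultilinear_apply] at this
  rw [this]
  refine Finset.sum_congr rfl fun a _ => ?_
  have := (PiTensorProduct.mapMultilinear F V W).map_smul_univ (fun i => c i (a i))
    (fun i => E i (a i))
  simpa using this

lemma tprod_sum_smul [DecidableEq ι] {κ : ι → Type*} (S : ∀ i, Finset (κ i)) (c : ∀ i, κ i → F)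
    (w : ∀ i, κ i → V i) :
    PiTensorProduct.tprod F (fun i => ∑ a ∈ S i, c i a • w i a) =
      ∑ a ∈ Fintype.piFinset S, (∏ i, c i (a i)) • PiTensorProduct.tprod F fun i => w i (a i) := by
  rw [(PiTensorProduct.tprod F).map_sum_finset]
  exact Finset.sum_congr rfl fun a _ => (PiTensorProduct.tprod F).map_smul_univ _ _

lemma map_smul_univ' (c : ι → F) (E : ∀ i, V i →ₗ[F] W i) :
    PiTensorProduct.map (fun i => c i • E i) = (∏ i, c i) • PiTensorProduct.map E := by
  have := (PiTensorProduct.mapMultilinear F V W).map_smul_univ c E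
  simpa using this

/-- The endomorphism of `⨂ i, V i` acting on the `i`-th factor only. -/
noncomputable def factorMap [DecidableEq ι] (i : ι) (N : V i →ₗ[F] V i) :
    (⨂[F] i, V i) →ₗ[F] ⨂[F] i, V i :=
  PiTensorProduct.map (Function.update (fun _ => LinearMap.id) i N)

omit [Fintype ι] in
lemma factorMap_tprod [DecidableEq ι] (i : ι) (N : V i →ₗ[F] V i) (x : ∀ i, V i) :
    factorMap i N (PiTensorProduct.tprod F x) =
      PiTensorProduct.tprod F (Function.update x i (N (x i))) := by
  rw [factorMap, PiTensorProduct.map_tprod]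
  congr 1
  funext j
  by_cases h : j = i
  · subst h; simp
  · simp [h]

omit [Fintype ι] in
lemma factorMap_comp [DecidableEq ι] (i : ι) (N N' : V i →ₗ[F] V i) :
    factorMap i (N ∘ₗ N') = factorMap i N ∘ₗ factorMap i N' := by
  refine PiTensorProduct.ext (MultilinearMap.ext fun x => ?_)
  simp [factorMap_tprod]

omit [Fintype ι] in
lemma factorMap_comm_map [DecidableEq ι] (i : ι) (N : V i →ₗ[F] V i) (N' : W i →ₗ[F] W i)
    (g : ∀ i, V i →ₗ[F] W i) (h : ∀ x, g i (N x) = N' (g i x)) (x : ⨂[F] i, V i) :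
    PiTensorProduct.map g (factorMap i N x) = factorMap i N' (PiTensorProduct.map g x) := by
  refine LinearMap.congr_fun (f := PiTensorProduct.map g ∘ₗ factorMap i N)
    (g := factorMap i N' ∘ₗ PiTensorProduct.map g)
    (PiTensorProduct.ext (MultilinearMap.ext fun x => ?_)) x
  simp only [LinearMap.compMultilinearMap_apply, LinearMap.comp_apply, factorMap_tprod,
    PiTensorProduct.map_tprod]
  congr 1
  funext j
  by_cases hj : j = i
  · subst hj; simp [h]
  · simp [hj]

/-- Over a field each kernel has a projector `1 - s N` with `N s N = N`. On a vector killed by every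
factor operator each projector acts trivially, so the vector equals its image under the tensor
product of all projectors, which factors through the tensor product of the kernels. -/
lemma range_mapIncl_ker [DecidableEq ι] (N : ∀ i, V i →ₗ[F] V i) :
    LinearMap.range (PiTensorProduct.mapIncl fun i => LinearMap.ker (N i)) =
      ⨅ i, LinearMap.ker (factorMap i (N i)) := by
  apply le_antisymm
  · rintro _ ⟨x, rfl⟩
    simp only [Submodule.mem_iInf, LinearMap.mem_ker]
    intro i
    have h := factorMap_comm_map i 0 (N i) (fun i => (LinearMap.ker (N i)).subtype)
      (fun x => by simp) x
    rw [PiTensorProduct.mapIncl, ← h]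
    have h0 : factorMap (V := fun i => LinearMap.ker (N i)) i 0 x = 0 := by
      refine LinearMap.congr_fun (g := 0) (PiTensorProduct.ext (MultilinearMap.ext fun x => ?_)) x
      simp only [LinearMap.compMultilinearMap_apply, factorMap_tprod, LinearMap.zero_apply]
      exact (PiTensorProduct.tprod F).map_coord_zero i (by simp)
    rw [h0, map_zero]
  · intro x hx
    simp only [Submodule.mem_iInf, LinearMap.mem_ker] at hx
    have hs : ∀ i, ∃ s : V i →ₗ[F] V i, ∀ v, v - s (N i v) ∈ LinearMap.ker (N i) := by
      intro i
      obtain ⟨s, hs⟩ := (N i).rangeRestrict.exists_rightInverse_of_surjective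
        (LinearMap.range_rangeRestrict _)
      obtain ⟨s', hs'⟩ := s.exists_extend
      refine ⟨s', fun v => ?_⟩
      have h1 : N i (s' (N i v)) = N i v := by
        have h2 : s' (N i v) = s ((N i).rangeRestrict v) :=
          LinearMap.congr_fun hs' ((N i).rangeRestrict v)
        rw [h2]
        exact congrArg Subtype.val (LinearMap.congr_fun hs ((N i).rangeRestrict v))
      simp [h1]
    choose s hs using hs
    let π : ∀ i, V i →ₗ[F] LinearMap.ker (N i) := fun i =>
      LinearMap.codRestrict _ (LinearMap.id - s i ∘ₗ N i) (hs i)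
    let P : ∀ i, V i →ₗ[F] V i := fun i => LinearMap.id - s i ∘ₗ N i
    have key : ∀ S : Finset ι, PiTensorProduct.map (fun i => if i ∈ S then P i else LinearMap.id) x
        = x := by
      intro S
      induction S using Finset.induction_on with
      | empty => simp
      | insert j S hj ih =>
        have h1 : (fun i => if i ∈ insert j S then P i else (LinearMap.id : V i →ₗ[F] V i)) =
            fun i => (if i ∈ S then P i else LinearMap.id) ∘ₗ
              Function.update (fun _ => LinearMap.id) j (P j) i := by
          funext i
          by_cases hij : i = j
          · subst hij; simp [hj]
          · simp [hij]
        rw [h1, PiTensorProduct.map_comp, LinearMap.comp_apply]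
        have h2 : factorMap j (P j) x = x := by
          have h3 : factorMap j (P j) = LinearMap.id - factorMap j (s j ∘ₗ N j) := by
            refine PiTensorProduct.ext (MultilinearMap.ext fun y => ?_)
            simp only [LinearMap.compMultilinearMap_apply, factorMap_tprod, LinearMap.sub_apply,
              LinearMap.id_apply, P, (PiTensorProduct.tprod F).map_update_sub,
              Function.update_eq_self]
          rw [h3, LinearMap.sub_apply, factorMap_comp, LinearMap.comp_apply, hx j, map_zero]
          simp
        exact (congrArg _ h2).trans ih
    refine ⟨PiTensorProduct.map π x, ?_⟩
    rw [PiTensorProduct.mapIncl, ← LinearMap.comp_apply, ← PiTensorProduct.map_comp]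
    simpa using! key Finset.univ

end PiTensor

end SocleB

namespace SocleB

universe u v

open MvPolynomial

/-! ### The monomial basis of `Symⁿ F²`. -/

section Monomials

variable (F : Type v) [Field F]

variable {F} in
/-- A homogeneous polynomial of degree `n`, as an element of `Symⁿ F²`. -/
def symMk {n : ℕ} (P : MvPolynomial (Fin 2) F) (h : P.IsHomogeneous n) : SymPow F n := ⟨P, h⟩

variable {F} in
lemma val_symMk {n : ℕ} (P : MvPolynomial (Fin 2) F) (h : P.IsHomogeneous n) :
    SymPow.val n (symMk P h) = P := rfl

/-- The monomial `X₀ ^ a * X₁ ^ (n - a)` in `Symⁿ F²`, or `0` if `n < a`. -/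
noncomputable def mono (n a : ℕ) : SymPow F n :=
  if h : a ≤ n then symMk (X 0 ^ a * X 1 ^ (n - a)) (by
    have := ((isHomogeneous_X F (0 : Fin 2)).pow a).mul
      ((isHomogeneous_X F (1 : Fin 2)).pow (n - a))
    rw [show 1 * a + 1 * (n - a) = n by omega] at this
    exact this) else 0

variable {F}

lemma val_mono {n a : ℕ} (h : a ≤ n) : SymPow.val n (mono F n a) = X 0 ^ a * X 1 ^ (n - a) := by
  rw [mono, dif_pos h, val_symMk]

/-- The coefficient of `X₀ ^ a * X₁ ^ (n - a)`. -/
noncomputable def coeffL (n a : ℕ) : SymPow F n →ₗ[F] F :=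
  MvPolynomial.lcoeff F (Finsupp.single 0 a + Finsupp.single 1 (n - a)) ∘ₗ SymPow.val n

lemma coeff_X_pow_mul (a b a' b' : ℕ) :
    coeff (Finsupp.single 0 a + Finsupp.single 1 b) (X 0 ^ a' * X 1 ^ b' : MvPolynomial (Fin 2) F) =
      if a' = a ∧ b' = b then 1 else 0 := by
  rw [X_pow_eq_monomial, X_pow_eq_monomial, monomial_mul, coeff_monomial, one_mul]
  congr 1
  rw [eq_iff_iff]
  constructor
  · intro h
    exact ⟨by simpa using DFunLike.congr_fun h 0, by simpa using DFunLike.congr_fun h 1⟩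
  · rintro ⟨rfl, rfl⟩
    rfl

lemma coeffL_mono {n a b : ℕ} (hb : b ≤ n) :
    coeffL n a (mono F n b) = if b = a then 1 else 0 := by
  rw [coeffL, LinearMap.comp_apply, val_mono hb, lcoeff_apply, coeff_X_pow_mul]
  refine if_congr ⟨fun h => h.1, fun h => ⟨h, by rw [h]⟩⟩ rfl rfl

lemma sum_coeffL_mono (n : ℕ) (v : SymPow F n) :
    ∑ a ∈ Finset.range (n + 1), coeffL n a v • mono F n a = v := by
  refine SymPow.val_injective n (MvPolynomial.ext _ _ fun d => ?_)
  have hd : d = Finsupp.single 0 (d 0) + Finsupp.single 1 (d 1) := by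
    ext i; fin_cases i <;> simp
  rw [map_sum, coeff_sum]
  have h1 : ∀ a ∈ Finset.range (n + 1), coeff d (SymPow.val n (coeffL n a v • mono F n a)) =
      if a = d 0 ∧ n - a = d 1 then coeffL n a v else 0 := by
    intro a ha
    rw [map_smul, val_mono (Nat.lt_succ_iff.mp (Finset.mem_range.mp ha)), coeff_smul, hd,
      coeff_X_pow_mul]
    simp
  rw [Finset.sum_congr rfl h1]
  by_cases hdeg : d 0 + d 1 = n
  · rw [Finset.sum_eq_single (d 0)]
    · rw [if_pos ⟨rfl, by omega⟩, coeffL, LinearMap.comp_apply, lcoeff_apply,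
        show n - d 0 = d 1 by omega, ← hd]
    · intro a _ ha
      rw [if_neg (fun h => ha h.1)]
    · intro h
      exact absurd (Finset.mem_range.mpr (by omega)) h
  · rw [Finset.sum_eq_zero]
    · symm
      refine (SymPow.val_mem v).coeff_eq_zero ?_
      rw [Finsupp.degree_eq_sum, Fin.sum_univ_two]
      exact hdeg
    · intro a ha
      rw [if_neg]
      rintro ⟨rfl, h⟩
      have := Finset.mem_range.mp ha
      omega

/-- The basis of monomials of `Symⁿ F²`. -/
noncomputable def monoBasis (F : Type v) [Field F] (n : ℕ) :
    Module.Basis (Fin (n + 1)) F (SymPow F n) :=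
  Module.Basis.ofEquivFun
    { toFun := fun v a => coeffL n a v
      map_add' := fun v w => by ext; simp
      map_smul' := fun c v => by ext; simp
      invFun := fun c => ∑ a : Fin (n + 1), c a • mono F n a
      left_inv := fun v => by
        change ∑ a : Fin (n + 1), coeffL n a v • mono F n a = v
        rw [Fin.sum_univ_eq_sum_range (fun a => coeffL n a v • mono F n a), sum_coeffL_mono]
      right_inv := fun c => by
        funext a
        change coeffL n a (∑ b : Fin (n + 1), c b • mono F n b) = c a
        rw [map_sum, Finset.sum_eq_single a]
        · rw [map_smul, coeffL_mono (by omega), if_pos rfl, smul_eq_mul, mul_one]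
        · intro b _ hb
          rw [map_smul, coeffL_mono (by omega), if_neg (fun h => hb (Fin.ext h)), smul_zero]
        · simp }

lemma monoBasis_apply (n : ℕ) (a : Fin (n + 1)) : monoBasis F n a = mono F n a := by
  rw [monoBasis, Module.Basis.coe_ofEquivFun]
  change ∑ b : Fin (n + 1), (Pi.single a (1 : F) : Fin (n + 1) → F) b • mono F n b = _
  rw [Finset.sum_eq_single a] <;> simp +contextual

end Monomials

/-! ### Capelli's operator, Cayley's operator and an annihilating polynomial. -/

section Polarization

variable {F : Type v} [Field F]

variable (F) in
/-- Polynomials in two pairs of variables. -/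
abbrev BiPol : Type v := MvPolynomial (Fin 2) F ⊗[F] MvPolynomial (Fin 2) F

/-- The inclusion of `Symᵐ F² ⊗ Symⁿ F²` in the polynomials in two pairs of variables. -/
noncomputable def incl (m n : ℕ) : SymPow F m ⊗[F] SymPow F n →ₗ[F] BiPol F :=
  TensorProduct.map (SymPow.val m) (SymPow.val n)

lemma incl_injective (m n : ℕ) : Function.Injective (incl (F := F) m n) :=
  TensorProduct.map_injective_of_flat_flat _ _ (SymPow.val_injective m) (SymPow.val_injective n)

variable (F) in
/-- The determinant `x y' - y x'`. -/
noncomputable def detPol : BiPol F := X 0 ⊗ₜ X 1 - X 1 ⊗ₜ X 0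

variable (F) in
/-- Cayley's operator `∂/∂x ∂/∂y' - ∂/∂y ∂/∂x'`. -/
noncomputable def cayley : BiPol F →ₗ[F] BiPol F :=
  TensorProduct.map (pderiv 0).toLinearMap (pderiv 1).toLinearMap -
    TensorProduct.map (pderiv 1).toLinearMap (pderiv 0).toLinearMap

lemma cayley_tmul (P Q : MvPolynomial (Fin 2) F) : cayley F (P ⊗ₜ Q) =
    pderiv 0 P ⊗ₜ pderiv 1 Q - pderiv 1 P ⊗ₜ pderiv 0 Q := rfl

lemma incl_capelli (m n : ℕ) (v : SymPow F m ⊗[F] SymPow F n) :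
    incl m n (capelli F m n v) = detPol F * cayley F (incl m n v) := by
  induction v using TensorProduct.induction_on with
  | zero => simp
  | add v w hv hw => simp only [map_add, hv, hw, mul_add]
  | tmul P Q =>
    simp only [capelli, incl, LinearMap.add_apply, LinearMap.sub_apply, TensorProduct.map_tmul,
      map_add, map_sub, val_polar, cayley_tmul, detPol, mul_sub, sub_mul,
      Algebra.TensorProduct.tmul_mul_tmul]
    abel

variable (F) in
/-- Polynomials of bidegree `(m, n)`. -/
noncomputable def bihom (m n : ℕ) : Submodule F (BiPol F) := LinearMap.range (incl m n)

lemma tmul_mem_bihom {m n : ℕ} {P Q : MvPolynomial (Fin 2) F} (hP : P.IsHomogeneous m)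
    (hQ : Q.IsHomogeneous n) : P ⊗ₜ Q ∈ bihom F m n :=
  ⟨(⟨P, hP⟩ : SymPow F m) ⊗ₜ (⟨Q, hQ⟩ : SymPow F n), rfl⟩

lemma bihom_induction {m n : ℕ} {motive : BiPol F → Prop} (h0 : motive 0)
    (hadd : ∀ v w, motive v → motive w → motive (v + w))
    (htmul : ∀ P Q : MvPolynomial (Fin 2) F, P.IsHomogeneous m → Q.IsHomogeneous n →
      motive (P ⊗ₜ Q)) {v : BiPol F} (hv : v ∈ bihom F m n) : motive v := by
  obtain ⟨w, rfl⟩ := hv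
  induction w using TensorProduct.induction_on with
  | zero => simpa using h0
  | add v w hv hw => simpa using hadd _ _ hv hw
  | tmul P Q => exact htmul _ _ (SymPow.val_mem P) (SymPow.val_mem Q)

lemma mul_mem_bihom {m n m' n' : ℕ} {v w : BiPol F} (hv : v ∈ bihom F m n)
    (hw : w ∈ bihom F m' n') : v * w ∈ bihom F (m + m') (n + n') := by
  refine bihom_induction (motive := fun v => v * w ∈ bihom F (m + m') (n + n')) ?_ ?_ ?_ hv
  · simp
  · intro v v' h h'
    rw [add_mul]
    exact Submodule.add_mem _ h h'
  · intro P Q hP hQ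
    refine bihom_induction (motive := fun w => P ⊗ₜ Q * w ∈ bihom F (m + m') (n + n')) ?_ ?_ ?_ hw
    · simp
    · intro v v' h h'
      rw [mul_add]
      exact Submodule.add_mem _ h h'
    · intro P' Q' hP' hQ'
      rw [Algebra.TensorProduct.tmul_mul_tmul]
      exact tmul_mem_bihom (hP.mul hP') (hQ.mul hQ')

lemma detPol_mem : detPol F ∈ bihom F 1 1 :=
  Submodule.sub_mem _ (tmul_mem_bihom (isHomogeneous_X F 0) (isHomogeneous_X F 1))
    (tmul_mem_bihom (isHomogeneous_X F 1) (isHomogeneous_X F 0))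

lemma one_mem_bihom : (1 : BiPol F) ∈ bihom F 0 0 :=
  tmul_mem_bihom (isHomogeneous_one (Fin 2) F) (isHomogeneous_one (Fin 2) F)

lemma detPol_pow_mem : ∀ l : ℕ, detPol F ^ l ∈ bihom F l l
  | 0 => by simpa using one_mem_bihom
  | l + 1 => by rw [pow_succ]; exact mul_mem_bihom (detPol_pow_mem l) detPol_mem

/-- Truncated subtraction is harmless here: if `m` or `n` is zero, the operator vanishes on that
bidegree. -/
lemma cayley_mem {m n : ℕ} {v : BiPol F} (hv : v ∈ bihom F m n) :
    cayley F v ∈ bihom F (m - 1) (n - 1) := by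
  refine bihom_induction (motive := fun v => cayley F v ∈ bihom F (m - 1) (n - 1)) ?_ ?_ ?_ hv
  · simp
  · intro v w h h'
    rw [map_add]
    exact Submodule.add_mem _ h h'
  · intro P Q hP hQ
    exact Submodule.sub_mem _ (tmul_mem_bihom hP.pderiv hQ.pderiv)
      (tmul_mem_bihom hP.pderiv hQ.pderiv)

lemma pderiv_eq_zero_of_isHomogeneous_zero {P : MvPolynomial (Fin 2) F} (hP : P.IsHomogeneous 0)
    (i : Fin 2) : pderiv i P = 0 := by
  rw [totalDegree_eq_zero_iff_eq_C.mp (Nat.le_zero.mp hP.totalDegree_le), pderiv_C]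

lemma cayley_eq_zero_left {n : ℕ} {v : BiPol F} (hv : v ∈ bihom F 0 n) : cayley F v = 0 := by
  refine bihom_induction (motive := fun v => cayley F v = 0) (map_zero _) ?_ ?_ hv
  · intro v w h h'
    rw [map_add, h, h', add_zero]
  · intro P Q hP _
    simp [cayley_tmul, pderiv_eq_zero_of_isHomogeneous_zero hP]

lemma cayley_eq_zero_right {m : ℕ} {v : BiPol F} (hv : v ∈ bihom F m 0) : cayley F v = 0 := by
  refine bihom_induction (motive := fun v => cayley F v = 0) (map_zero _) ?_ ?_ hv
  · intro v w h h'
    rw [map_add, h, h', add_zero]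
  · intro P Q _ hQ
    simp [cayley_tmul, pderiv_eq_zero_of_isHomogeneous_zero hQ]

/-- By Leibniz the cross terms form the Euler operators in the two pairs of variables, which act by
`m` and `n`; the constant `2` is Cayley's operator applied to the determinant. -/
lemma cayley_detPol_mul {m n : ℕ} {v : BiPol F} (hv : v ∈ bihom F m n) :
    cayley F (detPol F * v) = detPol F * cayley F v + ((m : F) + n + 2) • v := by
  refine bihom_induction (motive := fun v => cayley F (detPol F * v) =
    detPol F * cayley F v + ((m : F) + n + 2) • v) (by simp) ?_ ?_ hv
  · intro v w h h'
    rw [mul_add, map_add, h, h', map_add, mul_add, smul_add]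
    abel
  · intro P Q hP hQ
    have eP : (m : F) • P = X 0 * pderiv 0 P + X 1 * pderiv 1 P := by
      have := hP.sum_X_mul_pderiv
      rw [Fin.sum_univ_two] at this
      rw [this, Nat.cast_smul_eq_nsmul]
    have eQ : (n : F) • Q = X 0 * pderiv 0 Q + X 1 * pderiv 1 Q := by
      have := hQ.sum_X_mul_pderiv
      rw [Fin.sum_univ_two] at this
      rw [this, Nat.cast_smul_eq_nsmul]
    have e1 : ((m : F) + n + 2) • (P ⊗ₜ[F] Q) =
        (X 0 * pderiv 0 P + X 1 * pderiv 1 P) ⊗ₜ[F] Q +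
        P ⊗ₜ[F] (X 0 * pderiv 0 Q + X 1 * pderiv 1 Q) + (P ⊗ₜ[F] Q + P ⊗ₜ[F] Q) := by
      rw [← eP, ← eQ, add_smul, add_smul, two_smul, TensorProduct.smul_tmul',
        TensorProduct.tmul_smul]
    have h01 : pderiv (0 : Fin 2) (X 1 : MvPolynomial (Fin 2) F) = 0 :=
      pderiv_X_of_ne (by decide)
    have h10 : pderiv (1 : Fin 2) (X 0 : MvPolynomial (Fin 2) F) = 0 :=
      pderiv_X_of_ne (by decide)
    rw [e1]
    simp only [detPol, sub_mul, mul_sub, Algebra.TensorProduct.tmul_mul_tmul, map_sub, cayley_tmul,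
      Derivation.leibniz, pderiv_X_self, h01, h10, smul_eq_mul, mul_zero, mul_one, add_zero,
      TensorProduct.add_tmul, TensorProduct.tmul_add]
    abel

lemma cayley_detPol_pow_mul {m n : ℕ} {v : BiPol F} (hv : v ∈ bihom F m n)
    (h0 : cayley F v = 0) : ∀ l : ℕ, cayley F (detPol F ^ (l + 1) * v) =
      (((l : F) + 1) * ((m : F) + n + l + 2)) • (detPol F ^ l * v)
  | 0 => by
    rw [zero_add, pow_one, cayley_detPol_mul hv, h0]
    simp
  | l + 1 => by
    rw [pow_succ', mul_assoc, cayley_detPol_mul (mul_mem_bihom (detPol_pow_mem (l + 1)) hv),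
      cayley_detPol_pow_mul hv h0 l, mul_smul_comm, ← mul_assoc, ← pow_succ', ← add_smul]
    congr 1
    push_cast
    ring

/-- The operator `detPol * cayley`. -/
noncomputable def detCayley : BiPol F →ₗ[F] BiPol F :=
  LinearMap.mulLeft F (detPol F) ∘ₗ cayley F

lemma detCayley_mem {m n : ℕ} {v : BiPol F} (hv : v ∈ bihom F m n) :
    detCayley v ∈ bihom F m n := by
  obtain ⟨w, rfl⟩ := hv
  exact ⟨capelli F m n w, incl_capelli m n w⟩

/-- By `cayley_detPol_mul`, Cayley's operator intertwines `detCayley` on bidegree `(m + 1, n + 1)`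
with `detCayley + (m + n + 2)` on bidegree `(m, n)`, so every root is shifted by `m + n + 2`. -/
lemma cayley_aeval_prod {m n : ℕ} {κ : Type*} (s : Finset κ) (c : κ → F) {v : BiPol F}
    (hv : v ∈ bihom F (m + 1) (n + 1)) :
    cayley F (Polynomial.aeval (R := F) (A := Module.End F (BiPol F)) detCayley
      (∏ j ∈ s, (Polynomial.X - Polynomial.C (c j))) v) =
    Polynomial.aeval (R := F) (A := Module.End F (BiPol F)) detCayley
      (∏ j ∈ s, (Polynomial.X - Polynomial.C (c j - ((m : F) + n + 2)))) (cayley F v) := by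
  classical
  induction s using Finset.induction_on generalizing v with
  | empty => simp
  | insert j s hj ih =>
    rw [Finset.prod_insert hj, Finset.prod_insert hj, mul_comm, mul_comm (Polynomial.X - _),
      map_mul, map_mul, Module.End.mul_apply, Module.End.mul_apply]
    have hev : ∀ (a : F) (w : BiPol F), Polynomial.aeval (R := F) (A := Module.End F (BiPol F))
        detCayley (Polynomial.X - Polynomial.C a) w = detCayley w - a • w := fun a w => by
      rw [map_sub, Polynomial.aeval_X, Polynomial.aeval_C, LinearMap.sub_apply,
        Module.algebraMap_end_apply]
    rw [hev, hev, ih (Submodule.sub_mem _ (detCayley_mem hv) (Submodule.smul_mem _ _ hv))]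
    congr 1
    rw [map_sub, map_smul, detCayley, LinearMap.comp_apply, LinearMap.comp_apply,
      LinearMap.mulLeft_apply, LinearMap.mulLeft_apply, cayley_detPol_mul (cayley_mem hv)]
    simp only [Nat.add_sub_cancel]
    module

/-- Induction along Cayley's operator: the root `j = 0` supplies one factor `detCayley`, and pulling
Cayley's operator through the other factors turns root `j + 1` for `(m + 1, n + 1)` into root `j`
for `(m, n)`. -/
lemma aeval_detCayley_eq_zero : ∀ (m n : ℕ) {v : BiPol F}, v ∈ bihom F m n →
    Polynomial.aeval (R := F) (A := Module.End F (BiPol F)) detCayley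
      (∏ j ∈ Finset.range (m + 1),
        (Polynomial.X - Polynomial.C ((j : F) * ((m : F) + n + 1 - j)))) v = 0 := by
  have hz : ∀ (m n : ℕ) {v : BiPol F}, cayley F v = 0 →
    Polynomial.aeval (R := F) (A := Module.End F (BiPol F)) detCayley
      (∏ j ∈ Finset.range (m + 1),
        (Polynomial.X - Polynomial.C ((j : F) * ((m : F) + n + 1 - j)))) v = 0 := by
    intro m n v hv
    rw [Finset.prod_range_succ', map_mul, Module.End.mul_apply]
    simp only [Nat.cast_zero, zero_mul, map_zero, sub_zero, Polynomial.aeval_X]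
    rw [detCayley, LinearMap.comp_apply, hv, map_zero, map_zero]
  intro m
  induction m with
  | zero => exact fun n v hv => hz 0 n (cayley_eq_zero_left hv)
  | succ m ih =>
    rintro (_ | n) v hv
    · exact hz _ _ (cayley_eq_zero_right hv)
    · rw [Finset.prod_range_succ', mul_comm, map_mul, Module.End.mul_apply]
      simp only [Nat.cast_zero, zero_mul, map_zero, sub_zero, Polynomial.aeval_X]
      rw [detCayley, LinearMap.comp_apply, ← detCayley, cayley_aeval_prod _ _ hv]
      have h1 : ∀ j : ℕ, ((j + 1 : ℕ) : F) * (((m + 1 : ℕ) : F) + ((n + 1 : ℕ) : F) + 1 -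
          ((j + 1 : ℕ) : F)) - ((m : F) + n + 2) = (j : F) * ((m : F) + n + 1 - j) := fun j => by
        push_cast
        ring
      simp only [h1]
      have hv' : cayley F v ∈ bihom F m n := by
        have := cayley_mem hv
        rwa [Nat.add_sub_cancel, Nat.add_sub_cancel] at this
      rw [ih n hv', map_zero]

lemma aeval_capelli_eq_zero (m n : ℕ) :
    Polynomial.aeval (R := F) (A := Module.End F (SymPow F m ⊗[F] SymPow F n)) (capelli F m n)
      (∏ j ∈ Finset.range (m + 1),
        (Polynomial.X - Polynomial.C ((j : F) * ((m : F) + n + 1 - j)))) = 0 := by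
  refine LinearMap.ext fun v => incl_injective m n ?_
  have hq : ∀ (q : Polynomial F) (v : SymPow F m ⊗[F] SymPow F n), incl m n
      (Polynomial.aeval (R := F) (A := Module.End F (SymPow F m ⊗[F] SymPow F n))
        (capelli F m n) q v) =
      Polynomial.aeval (R := F) (A := Module.End F (BiPol F)) detCayley q (incl m n v) := by
    intro q
    induction q using Polynomial.induction_on' with
    | add q q' h h' => intro v; simp only [map_add, LinearMap.add_apply, h, h']
    | monomial k c =>
      intro v
      rw [Polynomial.aeval_monomial, Polynomial.aeval_monomial]
      simp only [Module.End.mul_apply, Module.algebraMap_end_apply, map_smul]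
      congr 1
      induction k generalizing v with
      | zero => simp
      | succ k ih =>
        rw [pow_succ, pow_succ, Module.End.mul_apply, Module.End.mul_apply, ih, incl_capelli]
        rfl
  rw [hq, aeval_detCayley_eq_zero m n ⟨v, rfl⟩, LinearMap.zero_apply, map_zero]

end Polarization

end SocleB

namespace SocleB

universe u v

open MvPolynomial

/-- Consecutive binomials in row `p - 1` add up to an entry of row `p` that is divisible by `p`. -/
lemma cast_choose_prime_pred {F : Type*} [Field F] {p : ℕ} [hp : Fact p.Prime] [CharP F p] :
    ∀ {a : ℕ}, a ≤ p - 1 → (((p - 1).choose a : ℕ) : F) = (-1) ^ a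
  | 0, _ => by simp
  | a + 1, ha => by
    have h1 : (p - 1).choose a + (p - 1).choose (a + 1) = p.choose (a + 1) := by
      conv_rhs => rw [show p = p - 1 + 1 by have := hp.out.pos; omega]
      rw [Nat.choose_succ_succ]
    have h2 : ((p.choose (a + 1) : ℕ) : F) = 0 :=
      (CharP.cast_eq_zero_iff F p _).mpr (hp.out.dvd_choose_self (by omega) (by omega))
    rw [← h1, Nat.cast_add, cast_choose_prime_pred (by omega : a ≤ p - 1)] at h2
    rw [pow_succ, mul_neg_one]
    exact eq_neg_of_add_eq_zero_right h2

/-! ### Unipotent, diagonal and Weyl elements of `GL₂`. -/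

section Elements

variable {K : Type*} [Field K]

/-- The unipotent matrix with upper right entry `t`. -/
def unip (t : K) : GL (Fin 2) K :=
  ⟨!![1, t; 0, 1], !![1, -t; 0, 1], by simp [Matrix.one_fin_two], by simp [Matrix.one_fin_two]⟩

/-- The diagonal matrix with entries `1, c`. -/
def diagOne (c : Kˣ) : GL (Fin 2) K :=
  ⟨!![1, 0; 0, (c : K)], !![1, 0; 0, ((c⁻¹ : Kˣ) : K)], by simp [Matrix.one_fin_two],
    by simp [Matrix.one_fin_two]⟩

/-- The permutation matrix. -/
def weyl : GL (Fin 2) K :=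
  ⟨!![0, 1; 1, 0], !![0, 1; 1, 0], by simp [Matrix.one_fin_two], by simp [Matrix.one_fin_two]⟩

lemma coe_unip (t : K) : (unip t : Matrix (Fin 2) (Fin 2) K) = !![1, t; 0, 1] := rfl
lemma coe_diagOne (c : Kˣ) : (diagOne c : Matrix (Fin 2) (Fin 2) K) = !![1, 0; 0, (c : K)] := rfl
lemma coe_weyl : ((weyl : GL (Fin 2) K) : Matrix (Fin 2) (Fin 2) K) = !![0, 1; 1, 0] := rfl

lemma unip_add (s t : K) : unip (s + t) = unip s * unip t := by
  ext i j
  fin_cases i <;> fin_cases j <;> simp [coe_unip, Matrix.mul_apply, Fin.sum_univ_two, add_comm]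

lemma unip_zero : unip (0 : K) = 1 := by
  ext i j
  fin_cases i <;> fin_cases j <;> simp [coe_unip]

variable {L : Type*} [Field L] (φ : K →+* L)

lemma map_unip (t : K) : Matrix.GeneralLinearGroup.map φ (unip t) = unip (φ t) := by
  ext i j
  fin_cases i <;> fin_cases j <;> simp [coe_unip]

lemma map_diagOne (c : Kˣ) :
    Matrix.GeneralLinearGroup.map φ (diagOne c) = diagOne (Units.map (φ : K →* L) c) := by
  ext i j
  fin_cases i <;> fin_cases j <;> simp [coe_diagOne]

lemma map_weyl : Matrix.GeneralLinearGroup.map φ weyl = weyl := by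
  ext i j
  fin_cases i <;> fin_cases j <;> simp [coe_weyl]

end Elements

variable {F : Type v} [Field F]

/-! ### Action of these elements on monomials and on the determinant. -/

section Subst

lemma subst_X (g : Matrix (Fin 2) (Fin 2) F) (j : Fin 2) :
    subst g (X j) = C (g 0 j) * X 0 + C (g 1 j) * X 1 := by
  simp [subst, Fin.sum_univ_two]

lemma subst_unip (t : F) :
    subst (unip t : Matrix (Fin 2) (Fin 2) F) (X 0) = X 0 ∧
    subst (unip t : Matrix (Fin 2) (Fin 2) F) (X 1) = C t * X 0 + X 1 := by
  simp [subst_X, coe_unip]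

lemma subst_diagOne (c : Fˣ) :
    subst (diagOne c : Matrix (Fin 2) (Fin 2) F) (X 0) = X 0 ∧
    subst (diagOne c : Matrix (Fin 2) (Fin 2) F) (X 1) = C (c : F) * X 1 := by
  simp [subst_X, coe_diagOne]

lemma subst_weyl :
    subst ((weyl : GL (Fin 2) F) : Matrix (Fin 2) (Fin 2) F) (X 0) = X 1 ∧
    subst ((weyl : GL (Fin 2) F) : Matrix (Fin 2) (Fin 2) F) (X 1) = X 0 := by
  simp [subst_X, coe_weyl]

/-- The action of a matrix on polynomials in two pairs of variables. -/
noncomputable def biSubst (g : Matrix (Fin 2) (Fin 2) F) : BiPol F →ₐ[F] BiPol F :=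
  Algebra.TensorProduct.map (subst g) (subst g)

lemma biSubst_tmul (g : Matrix (Fin 2) (Fin 2) F) (P Q : MvPolynomial (Fin 2) F) :
    biSubst g (P ⊗ₜ Q) = subst g P ⊗ₜ subst g Q := rfl

lemma biSubst_detPol (g : Matrix (Fin 2) (Fin 2) F) :
    biSubst g (detPol F) = g.det • detPol F := by
  have h : ∀ (a b : F) (P Q : MvPolynomial (Fin 2) F),
      (C a * P) ⊗ₜ[F] (C b * Q) = (a * b) • (P ⊗ₜ[F] Q) := fun a b P Q => by
    rw [← smul_eq_C_mul, ← smul_eq_C_mul, TensorProduct.smul_tmul_smul]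
  rw [detPol, map_sub, biSubst_tmul, biSubst_tmul]
  simp only [subst_X, TensorProduct.add_tmul, TensorProduct.tmul_add, h, Matrix.det_fin_two]
  module

/-- The diagonal action on `Symᵐ F² ⊗ Symⁿ F²`. -/
noncomputable abbrev biRep (F : Type v) [Field F] (m n : ℕ) :
    Representation F (GL (Fin 2) F) (SymPow F m ⊗[F] SymPow F n) :=
  (symRep F m).tprod (symRep F n)

lemma incl_biRep (m n : ℕ) (g : GL (Fin 2) F) (v : SymPow F m ⊗[F] SymPow F n) :
    incl m n (biRep F m n g v) = biSubst (g : Matrix (Fin 2) (Fin 2) F) (incl m n v) := by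
  induction v using TensorProduct.induction_on with
  | zero => simp
  | add v w hv hw => simp only [map_add, hv, hw]
  | tmul P Q => rfl

lemma symRep_unip_mono_zero (n : ℕ) (t : F) : symRep F n (unip t) (mono F n 0) =
    ∑ a ∈ Finset.range (n + 1), t ^ a • ((n.choose a : F) • mono F n a) := by
  refine SymPow.val_injective n ?_
  rw [val_symRep, val_mono (Nat.zero_le n), map_mul, map_pow, map_pow, (subst_unip t).1,
    (subst_unip t).2, pow_zero, one_mul, Nat.sub_zero, add_pow, map_sum]
  refine Finset.sum_congr rfl fun a ha => ?_
  rw [map_smul, map_smul, val_mono (Nat.lt_succ_iff.mp (Finset.mem_range.mp ha)), mul_pow,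
    smul_eq_C_mul, smul_eq_C_mul, map_pow, map_natCast]
  ring

lemma symRep_weyl_mono {n a : ℕ} (ha : a ≤ n) :
    symRep F n weyl (mono F n a) = mono F n (n - a) := by
  refine SymPow.val_injective n ?_
  rw [val_symRep, val_mono ha, val_mono (Nat.sub_le _ _), map_mul, map_pow, map_pow,
    subst_weyl.1, subst_weyl.2, mul_comm, Nat.sub_sub_self ha]

lemma symRep_unip_mono_self (n : ℕ) (t : F) : symRep F n (unip t) (mono F n n) = mono F n n := by
  refine SymPow.val_injective n ?_
  rw [val_symRep, val_mono le_rfl, map_mul, map_pow, map_pow, (subst_unip t).1, Nat.sub_self,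
    pow_zero, pow_zero]

lemma symRep_diagOne_mono_self (n : ℕ) (c : Fˣ) :
    symRep F n (diagOne c) (mono F n n) = mono F n n := by
  refine SymPow.val_injective n ?_
  rw [val_symRep, val_mono le_rfl, map_mul, map_pow, map_pow, (subst_diagOne c).1, Nat.sub_self,
    pow_zero, pow_zero]

end Subst

/-! ### Highest weight vectors in `Symᵐ ⊗ Symⁿ`. -/

section HighestWeight

/-- The element of `Symᵐ F² ⊗ Symⁿ F²` given by a polynomial of bidegree `(m, n)`. -/
noncomputable def ofBihom {m n : ℕ} (v : BiPol F) (hv : v ∈ bihom F m n) :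
    SymPow F m ⊗[F] SymPow F n := hv.choose

lemma incl_ofBihom {m n : ℕ} (v : BiPol F) (hv : v ∈ bihom F m n) :
    incl m n (ofBihom v hv) = v := hv.choose_spec

lemma isHomogeneous_X_pow (i : Fin 2) (a : ℕ) :
    (X i ^ a : MvPolynomial (Fin 2) F).IsHomogeneous a := by
  simpa using (isHomogeneous_X F i).pow a

lemma hvec_mem {m n l : ℕ} (hl : l ≤ m) (hmn : m ≤ n) :
    detPol F ^ l * ((X 0 ^ (m - l)) ⊗ₜ (X 0 ^ (n - l))) ∈ bihom F m n := by
  have := mul_mem_bihom (detPol_pow_mem (F := F) l)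
    (tmul_mem_bihom (isHomogeneous_X_pow (F := F) 0 (m - l))
      (isHomogeneous_X_pow (F := F) 0 (n - l)))
  rwa [Nat.add_sub_cancel' hl, Nat.add_sub_cancel' (hl.trans hmn)] at this

variable (F) in
/-- The highest weight vector `(x y' - y x') ^ l * x ^ (m - l) * x' ^ (n - l)`. -/
noncomputable def hvec {m n l : ℕ} (hl : l ≤ m) (hmn : m ≤ n) : SymPow F m ⊗[F] SymPow F n :=
  ofBihom _ (hvec_mem hl hmn)

variable {m n l : ℕ} (hl : l ≤ m) (hmn : m ≤ n)

lemma incl_hvec : incl m n (hvec F hl hmn) =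
    detPol F ^ l * ((X 0 ^ (m - l)) ⊗ₜ (X 0 ^ (n - l))) := incl_ofBihom _ _

lemma cayley_X_zero_pow (a b : ℕ) :
    cayley F ((X 0 ^ a) ⊗ₜ (X 0 ^ b)) = 0 := by
  have h1 : ∀ a : ℕ, pderiv (1 : Fin 2) (X 0 ^ a : MvPolynomial (Fin 2) F) = 0 := fun a => by
    rw [Derivation.leibniz_pow, pderiv_X_of_ne (by decide), smul_zero, smul_zero]
  rw [cayley_tmul, h1, h1, TensorProduct.tmul_zero, TensorProduct.zero_tmul, sub_zero]

lemma capelli_hvec : capelli F m n (hvec F hl hmn) =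
    ((l : F) * ((m : F) + n + 1 - l)) • hvec F hl hmn := by
  refine incl_injective m n ?_
  rw [incl_capelli, map_smul, incl_hvec]
  rcases l with _ | l
  · simp [cayley_X_zero_pow]
  · rw [cayley_detPol_pow_mul (tmul_mem_bihom (isHomogeneous_X_pow 0 _) (isHomogeneous_X_pow 0 _))
      (cayley_X_zero_pow _ _), mul_smul_comm, ← mul_assoc, ← pow_succ']
    congr 1
    push_cast [Nat.cast_sub hl, Nat.cast_sub (hl.trans hmn)]
    ring

lemma biRep_unip_hvec (t : F) : biRep F m n (unip t) (hvec F hl hmn) = hvec F hl hmn := by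
  refine incl_injective m n ?_
  rw [incl_biRep, incl_hvec, map_mul, map_pow, biSubst_detPol, biSubst_tmul, map_pow, map_pow,
    (subst_unip t).1, coe_unip]
  simp [Matrix.det_fin_two]

lemma biRep_diagOne_hvec (c : Fˣ) :
    biRep F m n (diagOne c) (hvec F hl hmn) = (c : F) ^ l • hvec F hl hmn := by
  refine incl_injective m n ?_
  rw [incl_biRep, map_smul, incl_hvec, map_mul, map_pow, biSubst_detPol, biSubst_tmul, map_pow,
    map_pow, (subst_diagOne c).1, coe_diagOne, smul_pow, smul_mul_assoc]
  simp [Matrix.det_fin_two]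

end HighestWeight

/-! ### Contraction of the second tensor factor by evaluation. -/

section Contraction

/-- Contraction of the second factor by a linear form. -/
noncomputable def contr {m n : ℕ} (lam : SymPow F n →ₗ[F] F) :
    SymPow F m ⊗[F] SymPow F n →ₗ[F] SymPow F m :=
  (TensorProduct.rid F (SymPow F m)).toLinearMap ∘ₗ LinearMap.lTensor (SymPow F m) lam

lemma contr_tmul {m n : ℕ} (lam : SymPow F n →ₗ[F] F) (P : SymPow F m) (Q : SymPow F n) :
    contr lam (P ⊗ₜ Q) = lam Q • P := by
  simp [contr]

/-- The value of a homogeneous polynomial at `(1, c)`. -/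
noncomputable def evalL (n : ℕ) (c : F) : SymPow F n →ₗ[F] F :=
  (MvPolynomial.aeval ![1, c] : MvPolynomial (Fin 2) F →ₐ[F] F).toLinearMap ∘ₗ SymPow.val n

lemma evalL_apply (n : ℕ) (c : F) (Q : SymPow F n) :
    evalL n c Q = MvPolynomial.aeval ![1, c] (SymPow.val n Q) := rfl

lemma evalL_eq_sum (n : ℕ) (c : F) :
    evalL n c = ∑ j ∈ Finset.range (n + 1), c ^ (n - j) • coeffL n j := by
  refine LinearMap.ext fun Q => ?_
  conv_lhs => rw [← sum_coeffL_mono n Q]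
  rw [map_sum, LinearMap.sum_apply]
  refine Finset.sum_congr rfl fun j hj => ?_
  rw [map_smul, evalL_apply, val_mono (Nat.lt_succ_iff.mp (Finset.mem_range.mp hj))]
  simp [mul_comm]

lemma evalL_zero_unip (n : ℕ) (t : F) (Q : SymPow F n) :
    evalL n 0 (symRep F n (unip t) Q) = evalL n t Q := by
  rw [evalL_apply, evalL_apply, val_symRep]
  have : (MvPolynomial.aeval ![1, 0] : MvPolynomial (Fin 2) F →ₐ[F] F).comp
      (subst (unip t : Matrix (Fin 2) (Fin 2) F)) = MvPolynomial.aeval ![1, t] := by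
    refine MvPolynomial.algHom_ext fun j => ?_
    fin_cases j
    · simp [(subst_unip t).1]
    · simp [(subst_unip t).2]
  exact AlgHom.congr_fun this _

lemma contr_evalL_unip {m n : ℕ} (t : F) (v : SymPow F m ⊗[F] SymPow F n) :
    contr (evalL n 0) (biRep F m n (unip t) v) = symRep F m (unip t) (contr (evalL n t) v) := by
  induction v using TensorProduct.induction_on with
  | zero => simp
  | add v w hv hw => simp only [map_add, hv, hw]
  | tmul P Q =>
    rw [biRep, Representation.tprod_apply, TensorProduct.map_tmul, contr_tmul, contr_tmul,
      evalL_zero_unip, map_smul]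

lemma contr_sum {m n : ℕ} {κ : Type*} (s : Finset κ) (c : κ → F) (lam : κ → SymPow F n →ₗ[F] F) :
    contr (m := m) (∑ j ∈ s, c j • lam j) = ∑ j ∈ s, c j • contr (lam j) := by
  refine TensorProduct.ext' fun P Q => ?_
  rw [LinearMap.sum_apply, contr_tmul, LinearMap.sum_apply, Finset.sum_smul]
  exact Finset.sum_congr rfl fun j _ => by
    rw [LinearMap.smul_apply, LinearMap.smul_apply, contr_tmul, smul_smul, smul_eq_mul]

lemma sum_contr_coeffL (m n : ℕ) :
    ∑ j ∈ Finset.range (n + 1),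
      (TensorProduct.mk F (SymPow F m) (SymPow F n)).flip (mono F n j) ∘ₗ contr (coeffL n j) =
      LinearMap.id := by
  refine TensorProduct.ext' fun P Q => ?_
  rw [LinearMap.sum_apply]
  conv_rhs => rw [LinearMap.id_apply, ← sum_coeffL_mono n Q, TensorProduct.tmul_sum]
  refine Finset.sum_congr rfl fun j _ => ?_
  rw [LinearMap.comp_apply, contr_tmul, map_smul, LinearMap.flip_apply, TensorProduct.mk_apply,
    TensorProduct.tmul_smul]

variable (F) in
/-- Evaluation of the second pair of variables at `(1, 0)`. -/
noncomputable def evalSnd : BiPol F →ₐ[F] MvPolynomial (Fin 2) F :=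
  Algebra.TensorProduct.lift (AlgHom.id F _)
    (MvPolynomial.aeval (![1, 0] : Fin 2 → MvPolynomial (Fin 2) F)) fun _ _ => Commute.all _ _

lemma evalSnd_tmul (P Q : MvPolynomial (Fin 2) F) : evalSnd F (P ⊗ₜ Q) =
    P * MvPolynomial.aeval (![1, 0] : Fin 2 → MvPolynomial (Fin 2) F) Q := by
  simp [evalSnd]

lemma val_contr_evalL_zero {m n : ℕ} (v : SymPow F m ⊗[F] SymPow F n) :
    SymPow.val m (contr (evalL n 0) v) = evalSnd F (incl m n v) := by
  induction v using TensorProduct.induction_on with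
  | zero => simp
  | add v w hv hw => simp only [map_add, hv, hw]
  | tmul P Q =>
    rw [contr_tmul, map_smul, evalL_apply]
    change _ = evalSnd F (SymPow.val m P ⊗ₜ SymPow.val n Q)
    rw [evalSnd_tmul, smul_eq_C_mul, mul_comm]
    congr 1
    have : (Algebra.ofId F (MvPolynomial (Fin 2) F)).comp
        (MvPolynomial.aeval ![1, 0] : MvPolynomial (Fin 2) F →ₐ[F] F) =
        MvPolynomial.aeval (![1, 0] : Fin 2 → MvPolynomial (Fin 2) F) := by
      refine MvPolynomial.algHom_ext fun j => ?_
      fin_cases j <;> simp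
    exact AlgHom.congr_fun this _

/-- At `(x', y') = (1, 0)` the determinant becomes `-y` and `x'` becomes `1`. Thus the vectors
`hvec` contract, up to sign, to the whole monomial basis. -/
lemma contr_hvec {m n l : ℕ} (hl : l ≤ m) (hmn : m ≤ n) :
    contr (evalL n 0) (hvec F hl hmn) = (-1 : F) ^ l • mono F m (m - l) := by
  refine SymPow.val_injective m ?_
  rw [val_contr_evalL_zero, incl_hvec, map_mul, map_pow, detPol, map_sub, evalSnd_tmul,
    evalSnd_tmul, evalSnd_tmul, map_smul, val_mono (Nat.sub_le _ _), Nat.sub_sub_self hl,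
    smul_eq_C_mul]
  simp only [map_pow, MvPolynomial.aeval_X, Matrix.cons_val_zero, Matrix.cons_val_one, mul_zero,
    mul_one, zero_sub, one_pow, map_neg, map_one]
  rw [neg_pow]
  ring

end Contraction

end SocleB

namespace SocleB

universe u v

open MvPolynomial

variable {F : Type v} [Field F]

lemma detPol_pow_eq_sum (l : ℕ) : detPol F ^ l = ∑ a ∈ Finset.range (l + 1),
    ((-1 : F) ^ (l - a) * (l.choose a : F)) •
      ((X 0 ^ a * X 1 ^ (l - a)) ⊗ₜ[F] (X 0 ^ (l - a) * X 1 ^ a)) := by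
  have h : detPol F = X 0 ⊗ₜ X 1 + (-1 : F) • (X 1 ⊗ₜ X 0) := by
    rw [detPol]
    module
  rw [h, add_pow]
  refine Finset.sum_congr rfl fun a _ => ?_
  rw [smul_pow, Algebra.TensorProduct.tmul_pow, Algebra.TensorProduct.tmul_pow, mul_smul_comm,
    Algebra.TensorProduct.tmul_mul_tmul, smul_mul_assoc, mul_smul, mul_comm (X 1 ^ a),
    mul_comm _ ((l.choose a : ℕ) : BiPol F), ← nsmul_eq_mul, Nat.cast_smul_eq_nsmul]

/-! ### The copy of `Symʳ` spanned by multiples of the top determinant power. -/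

section Epsilon

variable {m n r : ℕ}

lemma detPol_pow_mul_mem (hr : m + r = n) (P : SymPow F r) :
    detPol F ^ m * ((1 : MvPolynomial (Fin 2) F) ⊗ₜ SymPow.val r P) ∈ bihom F m n := by
  have := mul_mem_bihom (detPol_pow_mem (F := F) m)
    (tmul_mem_bihom (isHomogeneous_one (Fin 2) F) (SymPow.val_mem P))
  rwa [add_zero, hr] at this

variable (F) in
/-- The embedding `P ↦ (x y' - y x') ^ m * P(x', y')` of `Symʳ F²` in `Symᵐ F² ⊗ Symᵐ⁺ʳ F²`. -/
noncomputable def eps (hr : m + r = n) : SymPow F r →ₗ[F] SymPow F m ⊗[F] SymPow F n :=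
  (LinearEquiv.ofInjective _ (incl_injective m n)).symm.toLinearMap ∘ₗ
    LinearMap.codRestrict _ (LinearMap.mulLeft F (detPol F ^ m) ∘ₗ
      TensorProduct.mk F _ _ (1 : MvPolynomial (Fin 2) F) ∘ₗ SymPow.val r)
      (fun P => detPol_pow_mul_mem hr P)

variable (hr : m + r = n)

lemma incl_eps (P : SymPow F r) :
    incl m n (eps F hr P) = detPol F ^ m * ((1 : MvPolynomial (Fin 2) F) ⊗ₜ SymPow.val r P) :=
  congrArg Subtype.val ((LinearEquiv.ofInjective _ (incl_injective m n)).apply_symm_apply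
    (LinearMap.codRestrict _ (LinearMap.mulLeft F (detPol F ^ m) ∘ₗ
      TensorProduct.mk F _ _ (1 : MvPolynomial (Fin 2) F) ∘ₗ SymPow.val r)
      (fun P => detPol_pow_mul_mem hr P) P))

lemma eps_symRep (g : GL (Fin 2) F) (P : SymPow F r) :
    (g : Matrix (Fin 2) (Fin 2) F).det ^ m • eps F hr (symRep F r g P) =
      biRep F m n g (eps F hr P) := by
  refine incl_injective m n ?_
  rw [incl_biRep, map_smul, incl_eps, incl_eps, map_mul, map_pow, biSubst_detPol, biSubst_tmul,
    val_symRep, map_one, smul_pow, smul_mul_assoc]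

lemma eps_injective : Function.Injective (eps F hr) := by
  rw [← LinearMap.ker_eq_bot, Submodule.eq_bot_iff]
  intro P hP
  -- Setting `(x, y) = (1, 0)` turns the determinant into `y'`, so that `P` reappears multiplied by
  -- a nonzero power of `y'`.
  let φ : BiPol F →ₐ[F] MvPolynomial (Fin 2) F := Algebra.TensorProduct.lift
    (MvPolynomial.aeval (![1, 0] : Fin 2 → MvPolynomial (Fin 2) F)) (AlgHom.id F _)
    fun _ _ => Commute.all _ _
  have hφ : ∀ P Q : MvPolynomial (Fin 2) F, φ (P ⊗ₜ Q) =
      MvPolynomial.aeval (![1, 0] : Fin 2 → MvPolynomial (Fin 2) F) P * Q := fun P Q => by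
    simp only [φ, Algebra.TensorProduct.lift_tmul, AlgHom.id_apply]
  have h := congrArg (fun v => φ (incl m n v)) (LinearMap.mem_ker.mp hP)
  simp only [incl_eps, map_mul, map_pow, detPol, map_sub, hφ, map_zero, MvPolynomial.aeval_X,
    Matrix.cons_val_zero, Matrix.cons_val_one, zero_mul, one_mul, sub_zero, map_one] at h
  refine SymPow.val_injective r ?_
  rw [map_zero]
  exact (mul_eq_zero.mp h).resolve_left (pow_ne_zero _ (X_ne_zero _))

lemma eps_mono_self (hmn : m ≤ n) : eps F hr (mono F r r) = hvec F le_rfl hmn := by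
  refine incl_injective m n ?_
  rw [incl_eps, incl_hvec, val_mono le_rfl, Nat.sub_self, pow_zero, mul_one, Nat.sub_self, pow_zero,
    show n - m = r by omega]

/-- Polynomials in `(x', y')` alone are killed by Cayley's operator, so `cayley_detPol_pow_mul`
applies, with a scalar divisible by `r + m + 1 = n + 1`, which vanishes in `F`. -/
lemma capelli_eps (hn : (n : F) + 1 = 0) (P : SymPow F r) : capelli F m n (eps F hr P) = 0 := by
  refine incl_injective m n ?_
  rw [incl_capelli, map_zero, incl_eps]
  have h1 := tmul_mem_bihom (isHomogeneous_one (Fin 2) F) (SymPow.val_mem P)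
  rcases m with _ | m
  · rw [pow_zero, one_mul, cayley_eq_zero_left h1, mul_zero]
  · rw [cayley_detPol_pow_mul h1 (cayley_eq_zero_left h1)]
    have : ((0 : ℕ) : F) + r + m + 2 = 0 := by
      rw [← hn, ← hr]
      push_cast
      ring
    rw [this, mul_zero, zero_smul, mul_zero]

end Epsilon

/-! ### Unipotent translates of reflected highest weight vectors. -/

section Expansion

variable {p m n : ℕ}

lemma hvec_zero (hmn : m ≤ n) : hvec F (Nat.zero_le m) hmn = mono F m m ⊗ₜ mono F n n := by
  refine incl_injective m n ?_
  rw [incl_hvec]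
  change _ = SymPow.val m (mono F m m) ⊗ₜ SymPow.val n (mono F n n)
  simp [val_mono]

lemma biRep_tmul (g : GL (Fin 2) F) (P : SymPow F m) (Q : SymPow F n) :
    biRep F m n g (P ⊗ₜ Q) = symRep F m g P ⊗ₜ symRep F n g Q := rfl

/-- The translate is `(y + t x)^m (y' + t x')^n`. Since `n = p - 1`, the second family of binomials
consists of signs, and the coefficient of `t ^ n` becomes the alternating binomial expansion of `(x
y' - y x')^m x'^(n-m)`. -/
lemma exists_expansion_zero [Fact p.Prime] [CharP F p] (hn : n = p - 1) (hmn : m ≤ n) :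
    ∃ w : ℕ → SymPow F m ⊗[F] SymPow F n,
      (∀ t : F, biRep F m n (unip t) (biRep F m n weyl (hvec F (Nat.zero_le m) hmn)) =
        ∑ a ∈ Finset.range (m + n + 1), t ^ a • w a) ∧
      w n = (-1 : F) ^ m • hvec F le_rfl hmn := by
  classical
  refine ⟨fun c => ∑ x ∈ (Finset.range (m + 1) ×ˢ Finset.range (n + 1)) with x.1 + x.2 = c,
    ((m.choose x.1 : F) * (n.choose x.2 : F)) • (mono F m x.1 ⊗ₜ mono F n x.2), fun t => ?_, ?_⟩
  · rw [hvec_zero, biRep_tmul, biRep_tmul, symRep_weyl_mono le_rfl, symRep_weyl_mono le_rfl,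
      Nat.sub_self, Nat.sub_self, symRep_unip_mono_zero, symRep_unip_mono_zero,
      TensorProduct.sum_tmul]
    simp only [TensorProduct.tmul_sum, TensorProduct.smul_tmul_smul]
    rw [← Finset.sum_product', ← Finset.sum_fiberwise_of_maps_to
      (g := fun x : ℕ × ℕ => x.1 + x.2) (t := Finset.range (m + n + 1))]
    · refine Finset.sum_congr rfl fun c _ => ?_
      rw [Finset.smul_sum]
      refine Finset.sum_congr rfl fun x hx => ?_
      rw [← (Finset.mem_filter.mp hx).2, pow_add]
    · intro x hx
      simp only [Finset.mem_product, Finset.mem_range] at hx ⊢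
      omega
  · have h1 : ∑ x ∈ (Finset.range (m + 1) ×ˢ Finset.range (n + 1)) with x.1 + x.2 = n,
        ((m.choose x.1 : F) * (n.choose x.2 : F)) • (mono F m x.1 ⊗ₜ[F] mono F n x.2) =
        ∑ a ∈ Finset.range (m + 1), ((m.choose a : F) * (-1) ^ a) •
          (mono F m a ⊗ₜ[F] mono F n (n - a)) := by
      refine Finset.sum_nbij' (fun x => x.1) (fun a => (a, n - a)) ?_ ?_ ?_ ?_ ?_
      · intro x hx
        simp only [Finset.mem_filter, Finset.mem_product, Finset.mem_range] at hx ⊢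
        omega
      · intro a ha
        simp only [Finset.mem_filter, Finset.mem_product, Finset.mem_range] at ha ⊢
        omega
      · intro x hx
        simp only [Finset.mem_filter, Finset.mem_product, Finset.mem_range] at hx
        exact Prod.ext rfl (by simp; omega)
      · intro a _
        rfl
      · intro x hx
        simp only [Finset.mem_filter, Finset.mem_product, Finset.mem_range] at hx
        have hx2 : x.2 = n - x.1 := by omega
        rw [hx2, Nat.choose_symm (by omega), hn, cast_choose_prime_pred (by omega)]
    refine h1.trans (incl_injective m n ?_)
    rw [map_smul, incl_hvec, map_sum, detPol_pow_eq_sum, Finset.sum_mul, Finset.smul_sum]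
    refine Finset.sum_congr rfl fun a ha => ?_
    have ha' : a ≤ m := Nat.lt_succ_iff.mp (Finset.mem_range.mp ha)
    rw [map_smul]
    change _ • (SymPow.val m (mono F m a) ⊗ₜ SymPow.val n (mono F n (n - a))) = _
    have e3 : (X 0 : MvPolynomial (Fin 2) F) ^ (n - a) = X 0 ^ (m - a) * X 0 ^ (n - m) := by
      rw [← pow_add]
      congr 1
      omega
    have e4 : (-1 : F) ^ a = (-1) ^ m * (-1) ^ (m - a) := by
      rw [← pow_add, show m + (m - a) = a + 2 * (m - a) by omega, pow_add, pow_mul]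
      simp
    rw [val_mono ha', val_mono (Nat.sub_le _ _), Nat.sub_sub_self (ha'.trans hmn), Nat.sub_self,
      pow_zero, smul_mul_assoc, Algebra.TensorProduct.tmul_mul_tmul, mul_one, smul_smul, e3, e4,
      mul_right_comm (X 0 ^ (m - a))]
    congr 1
    ring

/-- This vector is the image of `x^r` under `eps`, so the translate is, up to sign, the image of `(y
+ t x)^r`. -/
lemma exists_expansion_self {r : ℕ} (hr : m + r = n) (hmn : m ≤ n) :
    ∃ w : ℕ → SymPow F m ⊗[F] SymPow F n,
      (∀ t : F, biRep F m n (unip t) (biRep F m n weyl (hvec F le_rfl hmn)) =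
        ∑ a ∈ Finset.range (r + 1), t ^ a • w a) ∧
      w r = (-1 : F) ^ m • hvec F le_rfl hmn := by
  refine ⟨fun a => (-1 : F) ^ m • (r.choose a : F) • eps F hr (mono F r a), fun t => ?_, ?_⟩
  · rw [← eps_mono_self hr hmn, ← eps_symRep, map_smul, ← eps_symRep, symRep_weyl_mono le_rfl,
      Nat.sub_self, symRep_unip_mono_zero, coe_unip, coe_weyl, Matrix.det_fin_two_of,
      Matrix.det_fin_two_of]
    simp only [map_sum, map_smul, mul_one, mul_zero, sub_zero, one_pow, one_smul, zero_sub,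
      Finset.smul_sum]
    exact Finset.sum_congr rfl fun a _ => smul_comm _ _ _
  · simp [eps_mono_self hr hmn]

end Expansion

/-! ### A preimage of the socle vector under Capelli's operator. -/

section Harmonic

variable {p n : ℕ}

lemma pderiv_X_mul (a b : ℕ) :
    pderiv (0 : Fin 2) (X 0 ^ a * X 1 ^ b : MvPolynomial (Fin 2) F) =
      (a : F) • (X 0 ^ (a - 1) * X 1 ^ b) ∧
    pderiv (1 : Fin 2) (X 0 ^ a * X 1 ^ b : MvPolynomial (Fin 2) F) =
      (b : F) • (X 0 ^ a * X 1 ^ (b - 1)) := by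
  have h01 : pderiv (0 : Fin 2) (X 1 : MvPolynomial (Fin 2) F) = 0 := pderiv_X_of_ne (by decide)
  have h10 : pderiv (1 : Fin 2) (X 0 : MvPolynomial (Fin 2) F) = 0 := pderiv_X_of_ne (by decide)
  constructor
  · rw [Derivation.leibniz, Derivation.leibniz_pow, Derivation.leibniz_pow, pderiv_X_self, h01,
      Nat.cast_smul_eq_nsmul]
    simp only [smul_eq_mul, smul_zero, mul_zero, zero_add, mul_one, nsmul_eq_mul]
    ring
  · rw [Derivation.leibniz, Derivation.leibniz_pow, Derivation.leibniz_pow, pderiv_X_self, h10,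
      Nat.cast_smul_eq_nsmul]
    simp only [smul_eq_mul, smul_zero, mul_zero, add_zero, mul_one, nsmul_eq_mul]
    ring

/-- Weighting the terms of the binomial expansion of `(x y' - y x')^m x'^(n-m)` by harmonic numbers
`H_a` works: with constant weights Cayley's operator gives zero, and the differences `H_{a+1} - H_a
= 1/(a+1)` leave `m` times the expansion of `(x y' - y x')^(m-1) x'^(n-m)`. -/
lemma exists_capelli_eq_hvec [Fact p.Prime] [CharP F p] (hn : n = p - 1) {m : ℕ} (hm : 0 < m)
    (hmn : m ≤ n) : ∃ u : SymPow F m ⊗[F] SymPow F n, capelli F m n u = hvec F le_rfl hmn := by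
  have hp := (Fact.out : p.Prime)
  obtain ⟨M, rfl⟩ : ∃ M, m = M + 1 := ⟨m - 1, by omega⟩
  have hcast : ∀ a : ℕ, 0 < a → a < p → (a : F) ≠ 0 := fun a h0 h1 h => by
    exact absurd (Nat.le_of_dvd h0 ((CharP.cast_eq_zero_iff F p a).mp h)) (by omega)
  have hn1 : (n : F) + 1 = 0 := by
    have : ((n + 1 : ℕ) : F) = 0 := by
      rw [hn, Nat.sub_add_cancel hp.one_le, CharP.cast_eq_zero]
    exact_mod_cast this
  -- Harmonic numbers; only `a ≤ M + 1 < p` occurs, so no denominator vanishes in `F`.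
  let d : ℕ → F := fun a => ∑ j ∈ Finset.range a, ((j : F) + 1)⁻¹
  let co : ℕ → F := fun a => (-1) ^ (M + 1 - a) * ((M + 1).choose a : F) * d a
  let e : ℕ → BiPol F := fun a => (X 0 ^ a * X 1 ^ (M + 1 - a)) ⊗ₜ (X 0 ^ (n - a) * X 1 ^ a)
  let g : ℕ → BiPol F := fun a => (X 0 ^ a * X 1 ^ (M - a)) ⊗ₜ (X 0 ^ (n - 1 - a) * X 1 ^ a)
  have hmem : ∀ a, a ≤ M + 1 → e a ∈ bihom F (M + 1) n := by
    intro a ha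
    have h1 := (isHomogeneous_X_pow (F := F) 0 a).mul (isHomogeneous_X_pow 1 (M + 1 - a))
    have h2 := (isHomogeneous_X_pow (F := F) 0 (n - a)).mul (isHomogeneous_X_pow 1 a)
    rw [Nat.add_sub_cancel' ha] at h1
    rw [Nat.sub_add_cancel (by omega)] at h2
    exact tmul_mem_bihom h1 h2
  let U : BiPol F := ∑ a ∈ Finset.range (M + 1 + 1), co a • e a
  have hU : U ∈ bihom F (M + 1) n := Submodule.sum_mem _ fun a ha =>
    Submodule.smul_mem _ _ (hmem a (Nat.lt_succ_iff.mp (Finset.mem_range.mp ha)))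
  -- The second coefficient is `-(M + 1 - a)(n - a)`, rewritten with `n = -1` in `F`.
  have hce : ∀ a, a ≤ M + 1 → cayley F (e a) = ((a : F) * a) • g (a - 1) +
      (((M : F) + 1 - a) * ((a : F) + 1)) • g a := by
    intro a ha
    have h3 : ((n - a : ℕ) : F) = -((a : F) + 1) := by
      rw [Nat.cast_sub (by omega)]
      linear_combination hn1
    simp only [e, g]
    rw [cayley_tmul, (pderiv_X_mul a _).1, (pderiv_X_mul a _).2, (pderiv_X_mul (n - a) _).1,
      (pderiv_X_mul (n - a) _).2, TensorProduct.smul_tmul_smul, TensorProduct.smul_tmul_smul, h3,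
      Nat.cast_sub ha, show M + 1 - a - 1 = M - a by omega, show n - a - 1 = n - 1 - a by omega]
    rcases a with _ | a
    · simp
      module
    · rw [show M + 1 - (a + 1) = M - (a + 1 - 1) by omega,
        show n - (a + 1) = n - 1 - (a + 1 - 1) by omega]
      push_cast
      module
  have hcU : cayley F U =
      ((M : F) + 1) • (detPol F ^ M * ((X 0 ^ 0) ⊗ₜ (X 0 ^ (n - (M + 1))))) := by
    have h1 : cayley F U = ∑ a ∈ Finset.range (M + 1 + 1), ((co a * (a * a)) • g (a - 1) +
        (co a * (((M : F) + 1 - a) * ((a : F) + 1))) • g a) := by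
      simp only [U, map_sum, map_smul]
      refine Finset.sum_congr rfl fun a ha => ?_
      rw [hce a (Nat.lt_succ_iff.mp (Finset.mem_range.mp ha)), smul_add, smul_smul, smul_smul]
    rw [h1, Finset.sum_add_distrib, Finset.sum_range_succ', Finset.sum_range_succ _ (M + 1)]
    have h2 : (M : F) + 1 - ((M + 1 : ℕ) : F) = 0 := by push_cast; ring
    rw [h2]
    simp only [Nat.cast_zero, mul_zero, zero_mul, zero_smul, add_zero, Nat.add_sub_cancel]
    rw [← Finset.sum_add_distrib, detPol_pow_eq_sum, Finset.sum_mul, Finset.smul_sum]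
    refine Finset.sum_congr rfl fun a ha => ?_
    have ha' : a ≤ M := Nat.lt_succ_iff.mp (Finset.mem_range.mp ha)
    have e3 : g a = (X 0 ^ a * X 1 ^ (M - a)) ⊗ₜ
        (X 0 ^ (M - a) * X 1 ^ a * X 0 ^ (n - (M + 1))) := by
      simp only [g]
      rw [mul_right_comm, ← pow_add, show M - a + (n - (M + 1)) = n - 1 - a by omega]
    rw [smul_mul_assoc, pow_zero, Algebra.TensorProduct.tmul_mul_tmul, mul_one, smul_smul,
      ← add_smul, e3]
    congr 1
    have c1 : (((M + 1).choose (a + 1) : ℕ) : F) * ((a : F) + 1) =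
        ((M : F) + 1) * (M.choose a : F) := by
      have h3 := congrArg (Nat.cast : ℕ → F) (Nat.add_one_mul_choose_eq M a)
      push_cast at h3
      exact h3.symm
    have c2 : (((M + 1).choose a : ℕ) : F) * ((M : F) + 1 - a) =
        ((M : F) + 1) * (M.choose a : F) := by
      have := Nat.choose_mul_succ_eq M a
      have h3 : ((M.choose a * (M + 1) : ℕ) : F) = (((M + 1).choose a * (M + 1 - a) : ℕ) : F) := by
        rw [this]
      push_cast [Nat.cast_sub (by omega : a ≤ M + 1)] at h3
      rw [← h3]
      ring
    have c3 : d (a + 1) = d a + ((a : F) + 1)⁻¹ := Finset.sum_range_succ _ _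
    have c4 : ((a : F) + 1) * ((a : F) + 1)⁻¹ = 1 := by
      refine mul_inv_cancel₀ ?_
      exact_mod_cast hcast (a + 1) (by omega) (by have := hp.pos; omega)
    have c5 : (-1 : F) ^ (M + 1 - a) = - (-1) ^ (M - a) := by
      rw [show M + 1 - a = M - a + 1 by omega, pow_succ]
      ring
    simp only [co]
    rw [c5, show M + 1 - (a + 1) = M - a by omega, c3]
    push_cast
    linear_combination ((-1 : F) ^ (M - a) * (d a + ((a : F) + 1)⁻¹) * ((a : F) + 1)) * c1 -
      ((-1 : F) ^ (M - a) * d a * ((a : F) + 1)) * c2 +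
      ((-1 : F) ^ (M - a) * ((M : F) + 1) * (M.choose a : F)) * c4
  have hM : ((M : F) + 1) ≠ 0 := by exact_mod_cast hcast (M + 1) (by omega) (by omega)
  refine ⟨((M : F) + 1)⁻¹ • ofBihom U hU, incl_injective _ _ ?_⟩
  rw [map_smul, map_smul, incl_capelli, incl_ofBihom, hcU, incl_hvec, mul_smul_comm, smul_smul,
    inv_mul_cancel₀ hM, one_smul, ← mul_assoc, ← pow_succ', Nat.sub_self]

end Harmonic

/-! ### The summand `ker N²` as the image of a polynomial in `N`. -/

section Projection

variable {p m n : ℕ}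

/-- Since `n = -1` in `F`, the roots of the annihilating polynomial are `j (m - j)`, which vanish
exactly at `j = 0` and `j = m`. So the polynomial is `X² Q` with `Q` prime to `X²`, and the Bézout
term `b Q` projects onto the kernel of the square. -/
lemma exists_projection [Fact p.Prime] [CharP F p] (hn : n = p - 1) (hm : 0 < m) (hmn : m ≤ n) :
    ∃ e : Polynomial F, ∀ v : SymPow F m ⊗[F] SymPow F n,
      capelli F m n (capelli F m n (Polynomial.aeval (R := F)
        (A := Module.End F (SymPow F m ⊗[F] SymPow F n)) (capelli F m n) e v)) = 0 ∧
      (capelli F m n (capelli F m n v) = 0 → Polynomial.aeval (R := F)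
        (A := Module.End F (SymPow F m ⊗[F] SymPow F n)) (capelli F m n) e v = v) := by
  have hp := (Fact.out : p.Prime)
  obtain ⟨M, rfl⟩ : ∃ M, m = M + 1 := ⟨m - 1, by omega⟩
  have hcast : ∀ a : ℕ, 0 < a → a < p → (a : F) ≠ 0 := fun a h0 h1 h => by
    exact absurd (Nat.le_of_dvd h0 ((CharP.cast_eq_zero_iff F p a).mp h)) (by omega)
  have hn1 : (n : F) + 1 = 0 := by
    have : ((n + 1 : ℕ) : F) = 0 := by
      rw [hn, Nat.sub_add_cancel hp.one_le, CharP.cast_eq_zero]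
    exact_mod_cast this
  have h0 := aeval_capelli_eq_zero (F := F) (M + 1) n
  let c : ℕ → F := fun j => (j : F) * (((M + 1 : ℕ) : F) + n + 1 - j)
  have hc0 : c 0 = 0 := by simp [c]
  have hcm : c (M + 1) = 0 := by
    simp only [c]
    linear_combination ((M + 1 : ℕ) : F) * hn1
  let Q : Polynomial F := ∏ j ∈ Finset.range M, (Polynomial.X - Polynomial.C (c (j + 1)))
  have hfac : (∏ j ∈ Finset.range (M + 1 + 1), (Polynomial.X - Polynomial.C (c j))) =
      Polynomial.X ^ 2 * Q := by
    rw [Finset.prod_range_succ, Finset.prod_range_succ', hc0, hcm, map_zero, sub_zero]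
    ring
  have hcop : IsCoprime (Polynomial.X ^ 2 : Polynomial F) Q := by
    refine IsCoprime.prod_right fun j hj => IsCoprime.pow_left ?_
    have hj' := Finset.mem_range.mp hj
    have hcj : c (j + 1) ≠ 0 := by
      refine mul_ne_zero (hcast (j + 1) (by omega) (by omega)) ?_
      have : (((M + 1 : ℕ) : F) + n + 1 - ((j + 1 : ℕ) : F)) = ((M - j : ℕ) : F) := by
        rw [Nat.cast_sub (by omega)]
        push_cast
        linear_combination hn1
      rw [this]
      exact hcast _ (by omega) (by omega)
    have := Polynomial.isCoprime_X_sub_C_of_isUnit_sub (a := (0 : F)) (b := c (j + 1))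
      (by simpa using hcj)
    simpa using this
  obtain ⟨a, b, hab⟩ := hcop
  refine ⟨b * Q, fun v => ⟨?_, fun hv => ?_⟩⟩
  · have h1 : (Polynomial.aeval (R := F) (A := Module.End F (SymPow F (M + 1) ⊗[F] SymPow F n))
        (capelli F (M + 1) n) (Polynomial.X ^ 2 * (b * Q))) v = 0 := by
      rw [show Polynomial.X ^ 2 * (b * Q) = b * (Polynomial.X ^ 2 * Q) by ring, ← hfac, map_mul,
        h0, mul_zero, LinearMap.zero_apply]
    rw [map_mul, map_pow, Polynomial.aeval_X, pow_two] at h1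
    exact h1
  · have h1 := congrArg (fun q => Polynomial.aeval (R := F)
      (A := Module.End F (SymPow F (M + 1) ⊗[F] SymPow F n)) (capelli F (M + 1) n) q v) hab
    simp only [map_add, LinearMap.add_apply, map_one, Module.End.one_apply] at h1
    rw [map_mul, map_pow, Polynomial.aeval_X, pow_two, Module.End.mul_apply, Module.End.mul_apply,
      hv, map_zero, zero_add] at h1
    exact h1

end Projection

end SocleB

namespace SocleB

universe u v

/-! ### Frobenius twists and separation of torus weights. -/

section Frobenius

variable {k : Type u} [Field k] (F : Type v) [Field F] [Algebra k F]
  (p : ℕ) [Fact p.Prime] [CharP k p]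

lemma frob_unip (i : ℕ) (t : k) : frob k F p i (unip t) = unip ((algebraMap k F t) ^ p ^ i) := by
  rw [frob, map_unip, RingHom.comp_apply, iterateFrobenius_def, map_pow]

lemma frob_diagOne (i : ℕ) (c : kˣ) :
    frob k F p i (diagOne c) = diagOne ((Units.map (algebraMap k F : k →* F) c) ^ p ^ i) := by
  rw [frob, map_diagOne]
  congr 1
  ext
  simp [iterateFrobenius_def]

lemma frob_weyl (i : ℕ) : frob k F p i (weyl : GL (Fin 2) k) = weyl := by
  rw [frob, map_weyl]

omit [Fact p.Prime] in
lemma prod_pow_pow {f : ℕ} (t : F) (a : Fin f → ℕ) :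
    ∏ i : Fin f, (t ^ p ^ (i : ℕ)) ^ a i = t ^ ∑ i : Fin f, p ^ (i : ℕ) * a i := by
  simp only [← pow_mul, Finset.prod_pow_eq_pow_sum]

end Frobenius

lemma piTensor_tprod {F : Type v} [Field F] {G : Type u} [Group G] {ι : Type*} {V : ι → Type*}
    [∀ i, AddCommMonoid (V i)] [∀ i, Module F (V i)] (ρ : ∀ i, Representation F G (V i)) (g : G)
    (x : ∀ i, V i) :
    piTensor ρ g (PiTensorProduct.tprod F x) = PiTensorProduct.tprod F fun i => ρ i g (x i) :=
  PiTensorProduct.map_tprod _ _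

lemma piTensor_apply {F : Type v} [Field F] {G : Type u} [Group G] {ι : Type*} {V : ι → Type*}
    [∀ i, AddCommMonoid (V i)] [∀ i, Module F (V i)] (ρ : ∀ i, Representation F G (V i)) (g : G) :
    piTensor ρ g = PiTensorProduct.map fun i => ρ i g := rfl

variable {k : Type u} [Field k] [Fintype k] {F : Type v} [Field F] [Algebra k F]
  {p f : ℕ} [Fact p.Prime] [CharP k p]

-- One `m i` is smaller than `p - 1`, so all exponents are below `q - 1`, where `q` is the
-- cardinality of `k`, and distinct tuples give distinct characters of `kˣ`.
omit [CharP k p] in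
lemma mem_of_forall_unit_sum_mem (hk : Fintype.card k = p ^ f) {X : Type*} [AddCommGroup X]
    [Module F X] (M : Submodule F X) {m : Fin f → ℕ} (hm : ∀ i, m i ≤ p - 1)
    (hex : ∃ i, m i < p - 1) (w : (∀ i, Fin (m i + 1)) → X)
    (h : ∀ c : kˣ, ∑ l, (algebraMap k F c) ^ (∑ i : Fin f, p ^ (i : ℕ) * (l i : ℕ)) • w l ∈ M)
    (l : ∀ i, Fin (m i + 1)) : w l ∈ M := by
  have hp := (Fact.out : p.Prime).two_le
  have hlt : ∀ l : ∀ i, Fin (m i + 1),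
      ∑ i : Fin f, p ^ (i : ℕ) * (l i : ℕ) < Fintype.card k - 1 := by
    intro l
    obtain ⟨i₀, hi₀⟩ := hex
    refine lt_of_lt_of_le (Finset.sum_lt_sum (g := fun i : Fin f => p ^ (i : ℕ) * (p - 1))
      (fun i _ => ?_) ⟨i₀, Finset.mem_univ _, ?_⟩) (sum_digits_le hk hp fun _ => le_rfl)
    · have := (l i).2
      have := hm i
      exact Nat.mul_le_mul_left _ (by omega)
    · have := (l i₀).2
      exact Nat.mul_lt_mul_of_pos_left (by omega) (by positivity)
  -- The hypothesis concerns units only. Multiplying by `t` raises all exponents by one and makes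
  -- the condition at `t = 0` trivial; the strict bound `hlt` leaves room for this.
  refine coeff_mem_of_forall_sum_mem (k := k) M Finset.univ w
    (fun l => ∑ i : Fin f, p ^ (i : ℕ) * (l i : ℕ) + 1) (fun t => ?_) (Finset.mem_univ l) (hlt l) ?_
  · by_cases ht : t = 0
    · subst ht
      simp
    · have := M.smul_mem (algebraMap k F t) (h (Units.mk0 t ht))
      rw [Finset.smul_sum] at this
      simpa only [smul_smul, ← pow_succ', Units.val_mk0] using this
  · intro l' _ _ hdvd
    have h1 := hlt l
    have h2 : Fintype.card k - 1 - (∑ i : Fin f, p ^ (i : ℕ) * (l i : ℕ) + 1) +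
        (∑ i : Fin f, p ^ (i : ℕ) * (l' i : ℕ) + 1) =
        p ^ f - 1 - ∑ i : Fin f, p ^ (i : ℕ) * (l i : ℕ) +
        ∑ i : Fin f, p ^ (i : ℕ) * (l' i : ℕ) := by
      rw [← hk]
      omega
    rw [h2, hk] at hdvd
    have hle : ∀ (l : ∀ i, Fin (m i + 1)) (i), (l i : ℕ) ≤ p - 1 := fun l i => by
      have := (l i).2
      have := hm i
      omega
    have := tuple_eq_of_dvd (p := p) (f := f) hp (d := m) (a := fun i => (l' i : ℕ))
      (a₀ := fun i => (l i : ℕ)) (fun i => Nat.lt_succ_iff.mp (l' i).2)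
      (hle l) (fun i => by have := hm i; omega) (hex.imp fun i hi => by omega) (by omega) hdvd
    funext i
    exact Fin.ext (congrFun this i)

variable (k F p) in
/-- The representation `⨂ i, (Symᵐⁱ ⊗ Symᵖ⁻¹)^(Fr^i)` of `GL₂(k)`. -/
noncomputable abbrev ambient (m : Fin f → ℕ) : Representation F (GL (Fin 2) k)
    (⨂[F] i, SymPow F (m i) ⊗[F] SymPow F (p - 1)) :=
  piTensor fun i : Fin f => (biRep F (m i) (p - 1)).comp (frob k F p i)

/-! ### Invariants of the unipotent group in the ambient representation. -/

section Invariants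

variable {m : Fin f → ℕ}

/-- By invariance, the contraction at `(1, 0)` determines those at all points `(1, t^(p^i))`. These
form a polynomial in `t` whose exponents have base `p` digits at most `p - 1`, so all coefficients
vanish, and they reconstruct `x`. -/
lemma eq_zero_of_map_contr_eq_zero (hk : Fintype.card k = p ^ f)
    {x : ⨂[F] i, SymPow F (m i) ⊗[F] SymPow F (p - 1)}
    (hx : ∀ t : k, ambient k F p m (unip t) x = x)
    (h : PiTensorProduct.map (fun i => contr (m := m i) (evalL (F := F) (p - 1) 0)) x = 0) :
    x = 0 := by
  classical
  have hp := (Fact.out : p.Prime).two_le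
  have h1 : ∀ t : k, PiTensorProduct.map (fun i : Fin f => contr (m := m i)
      (evalL (F := F) (p - 1) ((algebraMap k F t) ^ p ^ (i : ℕ)))) x = 0 := by
    intro t
    have e1 : PiTensorProduct.map (fun i => contr (m := m i) (evalL (F := F) (p - 1) 0)) ∘ₗ
        ambient k F p m (unip t) =
        PiTensorProduct.map (fun i : Fin f =>
          symRep F (m i) (unip ((algebraMap k F t) ^ p ^ (i : ℕ)))) ∘ₗ
        PiTensorProduct.map (fun i : Fin f => contr (m := m i)
          (evalL (F := F) (p - 1) ((algebraMap k F t) ^ p ^ (i : ℕ)))) := by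
      rw [piTensor_apply, ← PiTensorProduct.map_comp, ← PiTensorProduct.map_comp]
      congr 1
      funext i
      refine LinearMap.ext fun v => ?_
      simp only [LinearMap.comp_apply, MonoidHom.comp_apply, frob_unip]
      exact contr_evalL_unip _ v
    have e2 := LinearMap.congr_fun e1 x
    rw [LinearMap.comp_apply, hx, h, LinearMap.comp_apply] at e2
    have e3 : PiTensorProduct.map (fun i : Fin f =>
          symRep F (m i) (unip ((algebraMap k F t) ^ p ^ (i : ℕ)))⁻¹) ∘ₗ
        PiTensorProduct.map (fun i : Fin f =>
          symRep F (m i) (unip ((algebraMap k F t) ^ p ^ (i : ℕ)))) = LinearMap.id := by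
      rw [← PiTensorProduct.map_comp, ← PiTensorProduct.map_id]
      congr 1
      funext i
      refine LinearMap.ext fun v => ?_
      exact Representation.inv_self_apply (symRep F (m i))
        (unip ((algebraMap k F t) ^ p ^ (i : ℕ))) v
    have e4 := LinearMap.congr_fun e3 (PiTensorProduct.map (fun i : Fin f => contr (m := m i)
      (evalL (F := F) (p - 1) ((algebraMap k F t) ^ p ^ (i : ℕ)))) x)
    rw [LinearMap.comp_apply, ← e2, map_zero] at e4
    exact e4.symm
  have h2 : ∀ a : Fin f → ℕ, (∀ i, a i ≤ p - 1) →
      PiTensorProduct.map (fun i => contr (m := m i) (coeffL (F := F) (p - 1) (a i))) x = 0 := by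
    intro a ha
    -- In `evalL` the parameter occurs with exponent `p - 1 - j` next to `coeffL _ j`, hence the
    -- reflection of indices.
    have h3 := tuple_coeff_eq_zero (k := k) (F := F) hk hp
      (fun b : Fin f → ℕ => PiTensorProduct.map
        (fun i => contr (m := m i) (coeffL (F := F) (p - 1) (p - 1 - b i))) x) (fun t => ?_)
      (a₀ := fun i => p - 1 - a i) (fun i => Nat.sub_le _ _)
    · simpa only [Nat.sub_sub_self (ha _)] using h3
    · rw [← h1 t]
      have e : (fun i : Fin f => contr (m := m i)
          (evalL (F := F) (p - 1) ((algebraMap k F t) ^ p ^ (i : ℕ)))) = fun i : Fin f =>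
          ∑ j ∈ Finset.range (p - 1 + 1), ((algebraMap k F t) ^ p ^ (i : ℕ)) ^ j •
            contr (m := m i) (coeffL (F := F) (p - 1) (p - 1 - j)) := by
        funext i
        rw [evalL_eq_sum, contr_sum, ← Finset.sum_range_reflect]
        refine Finset.sum_congr rfl fun j hj => ?_
        have := Finset.mem_range.mp hj
        rw [show p - 1 - (p - 1 + 1 - 1 - j) = j by omega,
          show p - 1 + 1 - 1 - j = p - 1 - j by omega]
      rw [e, map_sum_smul, LinearMap.sum_apply]
      refine Finset.sum_congr rfl fun a _ => ?_
      rw [prod_pow_pow, LinearMap.smul_apply]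
  have h3 : PiTensorProduct.map (fun i => ∑ j ∈ Finset.range (p - 1 + 1), (1 : F) •
      ((TensorProduct.mk F (SymPow F (m i)) (SymPow F (p - 1))).flip (mono F (p - 1) j) ∘ₗ
        contr (coeffL (p - 1) j))) x = x := by
    simp only [one_smul, sum_contr_coeffL]
    exact LinearMap.congr_fun PiTensorProduct.map_id x
  rw [← h3, map_sum_smul, LinearMap.sum_apply]
  refine Finset.sum_eq_zero fun a ha => ?_
  rw [LinearMap.smul_apply, PiTensorProduct.map_comp, LinearMap.comp_apply, h2 a, map_zero,
    smul_zero]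
  exact fun i => Nat.lt_succ_iff.mp (Finset.mem_range.mp (Fintype.mem_piFinset.mp ha i))

variable (hm : ∀ i, m i ≤ p - 1)

variable (F) in
/-- The tensor product of the highest weight vectors `hvec`. -/
noncomputable def piHvec (hm : ∀ i, m i ≤ p - 1) (l : ∀ i, Fin (m i + 1)) :
    ⨂[F] i, SymPow F (m i) ⊗[F] SymPow F (p - 1) :=
  PiTensorProduct.tprod F fun i => hvec F (Nat.lt_succ_iff.mp (l i).2) (hm i)

omit [Fintype k] in
lemma ambient_unip_piHvec (l : ∀ i, Fin (m i + 1)) (t : k) :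
    ambient k F p m (unip t) (piHvec F hm l) = piHvec F hm l := by
  rw [piHvec, piTensor_tprod]
  congr 1
  funext i
  rw [MonoidHom.comp_apply, frob_unip]
  exact biRep_unip_hvec _ _ _

omit [Fintype k] in
lemma ambient_diagOne_piHvec (l : ∀ i, Fin (m i + 1)) (c : kˣ) :
    ambient k F p m (diagOne c) (piHvec F hm l) =
      (algebraMap k F c) ^ (∑ i : Fin f, p ^ (i : ℕ) * (l i : ℕ)) • piHvec F hm l := by
  rw [piHvec, piTensor_tprod, ← prod_pow_pow, ← MultilinearMap.map_smul_univ]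
  congr 1
  funext i
  rw [MonoidHom.comp_apply, frob_diagOne]
  refine (biRep_diagOne_hvec _ _ _).trans ?_
  simp

omit [Fact p.Prime] in
lemma map_contr_piHvec (l : ∀ i, Fin (m i + 1)) :
    PiTensorProduct.map (fun i => contr (m := m i) (evalL (F := F) (p - 1) 0)) (piHvec F hm l) =
      (∏ i, (-1 : F) ^ (l i : ℕ)) •
        Basis.piTensorProduct (fun i => monoBasis F (m i)) fun i => (l i).rev := by
  rw [piHvec, PiTensorProduct.map_tprod, Basis.piTensorProduct_apply,
    ← MultilinearMap.map_smul_univ]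
  congr 1
  funext i
  rw [contr_hvec, monoBasis_apply, Fin.val_rev, Nat.add_sub_add_right]

omit [Fact p.Prime] in
lemma piHvec_ne_zero (l : ∀ i, Fin (m i + 1)) : piHvec F hm l ≠ 0 := by
  intro h
  have h1 := map_contr_piHvec (F := F) hm l
  rw [h, map_zero] at h1
  refine (smul_ne_zero ?_ ((Basis.piTensorProduct fun i => monoBasis F (m i)).ne_zero _)) h1.symm
  exact Finset.prod_ne_zero_iff.mpr fun i _ => pow_ne_zero _ (by simp)

/-- Contraction at `(1, 0)` is injective on invariants, while the invariant vectors `piHvec` already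
contract, up to sign, to a full basis of the target. -/
lemma mem_span_piHvec (hk : Fintype.card k = p ^ f)
    {x : ⨂[F] i, SymPow F (m i) ⊗[F] SymPow F (p - 1)}
    (hx : ∀ t : k, ambient k F p m (unip t) x = x) :
    x ∈ Submodule.span F (Set.range (piHvec F hm)) := by
  let κ := PiTensorProduct.map (fun i => contr (m := m i) (evalL (F := F) (p - 1) 0))
  have htop : (Submodule.span F (Set.range (piHvec F hm))).map κ = ⊤ := by
    rw [eq_top_iff, ← (Basis.piTensorProduct fun i => monoBasis F (m i)).span_eq,
      Submodule.span_le]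
    rintro _ ⟨b, rfl⟩
    have h1 := map_contr_piHvec (F := F) hm fun i => (b i).rev
    simp only [Fin.rev_rev] at h1
    have hne : (∏ i, (-1 : F) ^ ((b i).rev : ℕ)) ≠ 0 :=
      Finset.prod_ne_zero_iff.mpr fun i _ => pow_ne_zero _ (by simp)
    refine ⟨(∏ i, (-1 : F) ^ ((b i).rev : ℕ))⁻¹ • piHvec F hm fun i => (b i).rev,
      Submodule.smul_mem _ _ (Submodule.subset_span ⟨_, rfl⟩), ?_⟩
    rw [map_smul]
    exact (congrArg _ h1).trans (inv_smul_smul₀ hne _)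
  obtain ⟨y, hy, hyx⟩ := htop.ge (Submodule.mem_top (x := κ x))
  have hinv : ∀ t : k, ambient k F p m (unip t) y = y := by
    intro t
    have : Submodule.span F (Set.range (piHvec F hm)) ≤
        LinearMap.ker (ambient k F p m (unip t) - LinearMap.id) := by
      rw [Submodule.span_le]
      rintro _ ⟨l, rfl⟩
      simp only [SetLike.mem_coe, LinearMap.mem_ker, LinearMap.sub_apply, LinearMap.id_apply,
        ambient_unip_piHvec, sub_self]
    exact sub_eq_zero.mp (LinearMap.mem_ker.mp (this hy))
  have : y - x = 0 := by
    refine eq_zero_of_map_contr_eq_zero (k := k) hk (fun t => ?_) ?_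
    · rw [map_sub, hx, hinv]
    · exact (map_sub κ y x).trans (sub_eq_zero.mpr hyx)
  rwa [← sub_eq_zero.mp this]

end Invariants

end SocleB

namespace SocleB

universe u v

variable {k : Type u} [Field k] [Fintype k] {F : Type v} [Field F] [Algebra k F]
  {p f : ℕ} [Fact p.Prime] [CharP k p]

/-! ### From an arbitrary subrepresentation to the socle vector. -/

section Generation

variable {m : Fin f → ℕ} (hm : ∀ i, m i ≤ p - 1)

omit [Fact p.Prime] in
lemma factorMap_capelli_piHvec (l : ∀ i, Fin (m i + 1)) (i : Fin f) :
    factorMap i (capelli F (m i) (p - 1)) (piHvec F hm l) =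
      (((l i : ℕ) : F) * ((m i : F) + (p - 1 : ℕ) + 1 - (l i : ℕ))) • piHvec F hm l := by
  rw [piHvec, factorMap_tprod, capelli_hvec, MultilinearMap.map_update_smul,
    Function.update_eq_self]

omit [Fintype k] in
lemma cast_pred_add_one [CharP F p] : ((p - 1 : ℕ) : F) + 1 = 0 := by
  have : ((p - 1 + 1 : ℕ) : F) = 0 := by
    rw [Nat.sub_add_cancel (Fact.out : p.Prime).one_le, CharP.cast_eq_zero]
  exact_mod_cast this

/-- A `U`-fixed vector of `M` is a combination of the `piHvec`, which the torus splits inside `M`.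
On `piHvec` the `i`-th Capelli operator acts by `l i * (m i - l i)` in `F`, and its square is zero
on `M`. -/
lemma exists_piHvec_mem [CharP F p] (hk : Fintype.card k = p ^ f) (hex : ∃ i, m i < p - 1)
    {M : Submodule F (⨂[F] i, SymPow F (m i) ⊗[F] SymPow F (p - 1))} (hM : M ≠ ⊥)
    (hstab : ∀ g, ∀ x ∈ M, ambient k F p m g x ∈ M)
    (hN : ∀ x ∈ M, ∀ i, factorMap i (capelli F (m i) (p - 1))
      (factorMap i (capelli F (m i) (p - 1)) x) = 0) :
    ∃ l : ∀ i, Fin (m i + 1), (∀ i, (l i : ℕ) = 0 ∨ (l i : ℕ) = m i) ∧ piHvec F hm l ∈ M := by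
  obtain ⟨x, hxM, hx0, hx⟩ := exists_fixed_of_add_hom (k := k) p (fun t => by simp)
    (fun t => ambient k F p m (unip t)) (by rw [unip_zero, map_one])
    (fun s t => by rw [unip_add, map_mul]) M hM fun t => hstab _
  obtain ⟨c, hc⟩ := (Submodule.mem_span_range_iff_exists_fun F).mp (mem_span_piHvec hm hk hx)
  obtain ⟨l, hl⟩ : ∃ l, c l ≠ 0 := by
    by_contra! h
    exact hx0 (by rw [← hc]; simp [h])
  have hmem : piHvec F hm l ∈ M := by
    have h1 := mem_of_forall_unit_sum_mem (k := k) hk M hm hex (fun l => c l • piHvec F hm l)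
      (fun t => ?_) l
    · exact (M.smul_mem_iff hl).mp h1
    · have := hstab (diagOne t) x hxM
      rw [← hc, map_sum] at this
      simpa only [map_smul, ambient_diagOne_piHvec, smul_comm (c _)] using this
  refine ⟨l, fun i => ?_, hmem⟩
  have h2 := hN _ hmem i
  rw [factorMap_capelli_piHvec, map_smul, factorMap_capelli_piHvec, smul_smul] at h2
  have h3 := mul_self_eq_zero.mp ((smul_eq_zero.mp h2).resolve_right (piHvec_ne_zero hm l))
  have hli := Nat.lt_succ_iff.mp (l i).2
  have hp := (Fact.out : p.Prime).pos
  have hmi := hm i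
  have hzero : ∀ a : ℕ, a < p → (a : F) = 0 → a = 0 := fun a ha h =>
    Nat.eq_zero_of_dvd_of_lt ((CharP.cast_eq_zero_iff F p a).mp h) ha
  rcases mul_eq_zero.mp h3 with h | h
  · exact Or.inl (hzero _ (by omega) h)
  · refine Or.inr ?_
    have h4 : ((m i - (l i : ℕ) : ℕ) : F) = 0 := by
      rw [Nat.cast_sub hli]
      linear_combination h - cast_pred_add_one (F := F) (p := p)
    have := hzero _ (by omega) h4
    omega

/-- In each factor, whether `l i` is `0` or `m i`, the translate by `unip t * weyl` has a power of
`t` whose coefficient is, up to sign, the vector with `l = m i`. Extracting these powers in all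
factors at once stays inside `M`. -/
lemma piHvec_last_mem [CharP F p] (hk : Fintype.card k = p ^ f) (hex : ∃ i, m i < p - 1)

    {M : Submodule F (⨂[F] i, SymPow F (m i) ⊗[F] SymPow F (p - 1))} (hM : M ≠ ⊥)
    (hstab : ∀ g, ∀ x ∈ M, ambient k F p m g x ∈ M)
    (hN : ∀ x ∈ M, ∀ i, factorMap i (capelli F (m i) (p - 1))
      (factorMap i (capelli F (m i) (p - 1)) x) = 0) :
    piHvec F hm (fun i => Fin.last (m i)) ∈ M := by
  classical
  have hp := (Fact.out : p.Prime).two_le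
  obtain ⟨l, hl, hmem⟩ := exists_piHvec_mem hm hk hex hM hstab hN
  -- Here `d` bounds the degree in `t` and `a₀` is the exponent to extract. The last two bounds are
  -- those under which no other tuple has a congruent exponent; `hex` supplies one strict index.
  have hexp : ∀ i, ∃ (d a₀ : ℕ) (w : ℕ → SymPow F (m i) ⊗[F] SymPow F (p - 1)),
      (∀ t : F, biRep F (m i) (p - 1) (unip t) (biRep F (m i) (p - 1) weyl
        (hvec F (Nat.lt_succ_iff.mp (l i).2) (hm i))) = ∑ a ∈ Finset.range (d + 1), t ^ a • w a) ∧
      w a₀ = (-1 : F) ^ m i • hvec F le_rfl (hm i) ∧ a₀ ≤ d ∧ a₀ ≤ p - 1 ∧ d ≤ a₀ + (p - 1) ∧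
      (m i < p - 1 → d < a₀ + (p - 1)) := by
    intro i
    have hmi := hm i
    rcases hl i with h | h
    · obtain ⟨w, hw, hw₀⟩ := exists_expansion_zero (F := F) (p := p) rfl (hm i)
      refine ⟨m i + (p - 1), p - 1, w, fun t => ?_, hw₀, by omega, by omega, by omega, by omega⟩
      rw [← hw t]
      congr 3
    · obtain ⟨w, hw, hw₀⟩ := exists_expansion_self (F := F) (r := p - 1 - m i) (by omega) (hm i)
      refine ⟨p - 1 - m i, p - 1 - m i, w, fun t => ?_, hw₀, by omega, by omega, by omega,
        by omega⟩
      rw [← hw t]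
      congr 3
  choose d a₀ w hw hw₀ h₀ ha₀ hd hlt using hexp
  have h1 := tuple_coeff_mem (k := k) hk hp M d
    (fun a => PiTensorProduct.tprod F fun i => w i (a i)) (fun t => ?_) h₀ ha₀ hd
    (hex.imp fun i hi => hlt i hi)
  · simp only [hw₀, MultilinearMap.map_smul_univ] at h1
    exact (M.smul_mem_iff (Finset.prod_ne_zero_iff.mpr fun i _ => pow_ne_zero _ (by simp))).mp h1
  · have h2 := hstab (unip t) _ (hstab weyl _ hmem)
    rw [piHvec, piTensor_tprod, piTensor_tprod] at h2
    simp only [MonoidHom.comp_apply, frob_unip, frob_weyl, hw, tprod_sum_smul, prod_pow_pow] at h2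
    exact h2

/-- Highest weight vectors of regular weights generate. -/
lemma eq_top_of_tprod_mono_mem (hk : Fintype.card k = p ^ f) (hf : 0 < f) {r : Fin f → ℕ}
    (hr : ∀ i, r i < p - 1) {M : Submodule F (⨂[F] i, SymPow F (r i))} [CharP F p]
    (hstab : ∀ g, ∀ x ∈ M, piTensor (fun i : Fin f => (symRep F (r i)).comp (frob k F p i)) g x ∈ M)
    (hmem : PiTensorProduct.tprod F (fun i => mono F (r i) (r i)) ∈ M) : M = ⊤ := by
  classical
  have hp := (Fact.out : p.Prime)
  rw [eq_top_iff, ← (Basis.piTensorProduct fun i => monoBasis F (r i)).span_eq, Submodule.span_le]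
  rintro _ ⟨b, rfl⟩
  have hb : ∀ i, (b i : ℕ) ≤ r i := fun i => Nat.lt_succ_iff.mp (b i).2
  have h1 := tuple_coeff_mem (k := k) hk hp.two_le M r (fun a => PiTensorProduct.tprod F fun i =>
    ((r i).choose (a i) : F) • mono F (r i) (a i)) (fun t => ?_) (a₀ := fun i => b i) hb
    (fun i => (hb i).trans (hr i).le) (fun i => by have := hr i; omega)
    ⟨⟨0, hf⟩, by have := hr ⟨0, hf⟩; omega⟩
  · rw [MultilinearMap.map_smul_univ] at h1
    rw [SetLike.mem_coe, Basis.piTensorProduct_apply]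
    simp only [monoBasis_apply]
    refine (M.smul_mem_iff (Finset.prod_ne_zero_iff.mpr fun i _ => ?_)).mp h1
    intro h
    -- The binomial divides the factorial of `r i`, which is prime to `p` because `r i < p`.
    have h2 := (CharP.cast_eq_zero_iff F p _).mp h
    have := (Nat.choose_pos (hb i)).ne'
    have h3 := (hp.dvd_factorial).mp (h2.trans
      ⟨_, (Nat.choose_mul_factorial_mul_factorial (hb i)).symm.trans (mul_assoc _ _ _)⟩)
    have := hr i
    omega
  · have h2 := hstab (unip t) _ (hstab weyl _ hmem)
    rw [piTensor_tprod, piTensor_tprod] at h2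
    simp only [MonoidHom.comp_apply, frob_unip, frob_weyl, symRep_weyl_mono le_rfl, Nat.sub_self,
      symRep_unip_mono_zero, tprod_sum_smul, prod_pow_pow] at h2
    exact h2

end Generation

end SocleB

namespace SocleB

universe u v

/-! ### Capelli's operator and the embedded `Symʳ` inside `R_r`. -/

section Blocks

variable {F : Type v} [Field F] {p : ℕ} {r : ℕ}

variable (F p r) in
/-- The inclusion of `R_r` in `Symᵖ⁻¹⁻ʳ ⊗ Symᵖ⁻¹`. -/
noncomputable def projRIncl :
    (projR F p r).toSubmodule →ₗ[F] SymPow F (p - 1 - r) ⊗[F] SymPow F (p - 1) :=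
  (projR F p r).toSubmodule.subtype

lemma projRIncl_injective : Function.Injective (projRIncl F p r) := Subtype.val_injective

lemma capelli_capelli_projRIncl (x : (projR F p r).toSubmodule) :
    capelli F (p - 1 - r) (p - 1) (capelli F (p - 1 - r) (p - 1) (projRIncl F p r x)) = 0 := x.2

lemma projRIncl_rep (g : GL (Fin 2) F) (x : (projR F p r).toSubmodule) :
    projRIncl F p r ((projR F p r).toRepresentation g x) =
      biRep F (p - 1 - r) (p - 1) g (projRIncl F p r x) := rfl

variable {X : Type*} [AddCommGroup X] [Module F X]

/-- A linear map to `R_r` from a linear map to `Symᵖ⁻¹⁻ʳ ⊗ Symᵖ⁻¹`. -/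
noncomputable def projRLift (φ : X →ₗ[F] SymPow F (p - 1 - r) ⊗[F] SymPow F (p - 1))
    (h : ∀ x, capelli F (p - 1 - r) (p - 1) (capelli F (p - 1 - r) (p - 1) (φ x)) = 0) :
    X →ₗ[F] (projR F p r).toSubmodule :=
  LinearMap.codRestrict (M₂ := BigSpace F p r) (projR F p r).toSubmodule φ h

lemma projRIncl_lift (φ : X →ₗ[F] SymPow F (p - 1 - r) ⊗[F] SymPow F (p - 1))
    (h : ∀ x, capelli F (p - 1 - r) (p - 1) (capelli F (p - 1 - r) (p - 1) (φ x)) = 0) (x : X) :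
    projRIncl F p r (projRLift φ h x) = φ x := rfl

variable (F p r) in
/-- The restriction of the polarised determinant to `R_r`. -/
noncomputable def projRCapelli : (projR F p r).toSubmodule →ₗ[F] (projR F p r).toSubmodule :=
  projRLift (capelli F (p - 1 - r) (p - 1) ∘ₗ projRIncl F p r) fun x => by
    rw [LinearMap.comp_apply, capelli_capelli_projRIncl, map_zero]

lemma projRIncl_capelli (x : (projR F p r).toSubmodule) :
    projRIncl F p r (projRCapelli F p r x) =
      capelli F (p - 1 - r) (p - 1) (projRIncl F p r x) := rfl

lemma projRCapelli_projRCapelli (x : (projR F p r).toSubmodule) :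
    projRCapelli F p r (projRCapelli F p r x) = 0 :=
  projRIncl_injective (by
    rw [projRIncl_capelli, projRIncl_capelli, capelli_capelli_projRIncl, map_zero])

lemma projRCapelli_rep (g : GL (Fin 2) F) (x : (projR F p r).toSubmodule) :
    projRCapelli F p r ((projR F p r).toRepresentation g x) =
      (projR F p r).toRepresentation g (projRCapelli F p r x) :=
  projRIncl_injective (LinearMap.congr_fun (capelli_comm (p - 1 - r) (p - 1) g)
    (projRIncl F p r x))

lemma projW_toSubmodule : (projW F p r).toSubmodule = LinearMap.ker (projRCapelli F p r) := by
  refine Submodule.ext fun x => ?_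
  change capelli F (p - 1 - r) (p - 1) (projRIncl F p r x) = 0 ↔ projRCapelli F p r x = 0
  rw [← projRIncl_capelli]
  exact ⟨fun h => projRIncl_injective (h.trans (map_zero _).symm), fun h => by rw [h, map_zero]⟩

/-- The harmonic preimage `u` of the highest weight vector lies in `R_r`, because Capelli's operator
kills that vector. -/
lemma exists_projRCapelli_eq [Fact p.Prime] [CharP F p] (hr : r < p - 1)
    (y : (projR F p r).toSubmodule)
    (hy : projRIncl F p r y = hvec F le_rfl (Nat.sub_le (p - 1) r)) :
    ∃ x, projRCapelli F p r x = y := by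
  obtain ⟨u, hu⟩ := exists_capelli_eq_hvec (F := F) (p := p) rfl (m := p - 1 - r) (by omega)
    (Nat.sub_le _ _)
  have hc : ((p - 1 - r : ℕ) : F) *
      (((p - 1 - r : ℕ) : F) + (p - 1 : ℕ) + 1 - (p - 1 - r : ℕ)) = 0 := by
    linear_combination ((p - 1 - r : ℕ) : F) * cast_pred_add_one (F := F) (p := p)
  refine ⟨projRLift (LinearMap.toSpanSingleton F _ u) (fun c => ?_) 1, projRIncl_injective ?_⟩
  · rw [LinearMap.toSpanSingleton_apply, map_smul, map_smul, hu, capelli_hvec, hc, zero_smul,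
      smul_zero]
  · rw [projRIncl_capelli, projRIncl_lift, LinearMap.toSpanSingleton_apply, one_smul, hu, hy]

variable (F) in
/-- The embedding of `Symʳ` in `R_r`. -/
noncomputable def projREps [Fact p.Prime] [CharP F p] (hr : r ≤ p - 1) :
    SymPow F r →ₗ[F] (projR F p r).toSubmodule :=
  projRLift (eps F (Nat.sub_add_cancel hr)) fun P => by
    rw [capelli_eps _ cast_pred_add_one, map_zero]

variable [Fact p.Prime] [CharP F p] (hr : r ≤ p - 1)

lemma projRIncl_eps (P : SymPow F r) :
    projRIncl F p r (projREps F hr P) = eps F (Nat.sub_add_cancel hr) P := rfl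

lemma projREps_injective : Function.Injective (projREps F hr) := fun _ _ h =>
  eps_injective (Nat.sub_add_cancel hr) (congrArg (projRIncl F p r) h)

lemma projRCapelli_eps (P : SymPow F r) : projRCapelli F p r (projREps F hr P) = 0 :=
  projRIncl_injective (by
    rw [projRIncl_capelli, projRIncl_eps, capelli_eps _ cast_pred_add_one, map_zero])

lemma projREps_symRep (g : GL (Fin 2) F) (P : SymPow F r) :
    (g : Matrix (Fin 2) (Fin 2) F).det ^ (p - 1 - r) • projREps F hr (symRep F r g P) =
      (projR F p r).toRepresentation g (projREps F hr P) :=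
  projRIncl_injective (by
    rw [map_smul, projRIncl_rep, projRIncl_eps, projRIncl_eps, eps_symRep])

end Blocks

/-! ### Injectivity and vanishing of tensor products of linear maps. -/

section PiTensor

variable {F : Type*} [Field F] {ι : Type*} {V W : ι → Type*}
  [∀ i, AddCommGroup (V i)] [∀ i, Module F (V i)] [∀ i, AddCommGroup (W i)] [∀ i, Module F (W i)]

lemma piMap_injective {φ : ∀ i, V i →ₗ[F] W i} (h : ∀ i, Function.Injective (φ i)) :
    Function.Injective (PiTensorProduct.map φ) := by
  choose s hs using fun i => (φ i).exists_leftInverse_of_injective (LinearMap.ker_eq_bot.mpr (h i))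
  refine Function.LeftInverse.injective (g := PiTensorProduct.map s) fun x => ?_
  rw [← LinearMap.comp_apply, ← PiTensorProduct.map_comp]
  simp [hs]

lemma factorMap_eq_zero [DecidableEq ι] (i : ι) (N : V i →ₗ[F] V i) (hN : ∀ x, N x = 0)
    (x : ⨂[F] i, V i) : factorMap i N x = 0 := by
  refine LinearMap.congr_fun (g := 0) (PiTensorProduct.ext (MultilinearMap.ext fun x => ?_)) x
  simp only [LinearMap.compMultilinearMap_apply, factorMap_tprod, LinearMap.zero_apply]
  exact (PiTensorProduct.tprod F).map_coord_zero i (by simp [hN])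

end PiTensor

/-! ### Determinant twists, the embedding of `σ` and the common kernel. -/

section Weights

variable {k : Type u} [Field k] {F : Type v} [Field F] [Algebra k F]
  {p f : ℕ} [Fact p.Prime] [CharP k p]

lemma det_frob (i : ℕ) (g : GL (Fin 2) k) : (frob k F p i g : Matrix (Fin 2) (Fin 2) F).det =
    (algebraMap k F (g : Matrix (Fin 2) (Fin 2) k).det) ^ p ^ i := by
  have : (frob k F p i g : Matrix (Fin 2) (Fin 2) F) =
      ((algebraMap k F).comp (iterateFrobenius k p i)).mapMatrix
        (g : Matrix (Fin 2) (Fin 2) k) := rfl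
  rw [this, ← RingHom.map_det, RingHom.comp_apply, iterateFrobenius_def, map_pow]

omit [Fact p.Prime] [CharP k p] in
lemma detPow_apply (a : ℤ) (g : GL (Fin 2) k) : detPow k F a g =
    (Units.map (algebraMap k F : k →* F) (Matrix.GeneralLinearGroup.det g)) ^ a := rfl

lemma sum_add_sum_sub {r : Fin f → ℕ} (hr : ∀ i, r i ≤ p - 1) :
    (∑ i : Fin f, (p : ℤ) ^ (i : ℕ) * (r i : ℤ)) +
      ((∑ i : Fin f, p ^ (i : ℕ) * (p - 1 - r i) : ℕ) : ℤ) = (p : ℤ) ^ f - 1 := by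
  rw [← sum_pow_mul_pred, Nat.cast_sum, ← Finset.sum_add_distrib]
  refine Finset.sum_congr rfl fun i _ => ?_
  have := (Fact.out : p.Prime).one_le
  push_cast [Nat.cast_sub (hr i), Nat.cast_sub this]
  ring

-- The embeddings of the factors contribute the determinant to the powers `p^i (p-1-r i)`. With the
-- normalisation `∑ p^i r i` of `R_σ` they add up to `p ^ f - 1`, which is trivial on `kˣ`.
omit [CharP k p] in
lemma units_zpow_eq [Fintype k] (hk : Fintype.card k = p ^ f) {r : Fin f → ℕ}
    (hr : ∀ i, r i ≤ p - 1) (a : ℤ) (c : kˣ) :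
    (Units.map (algebraMap k F : k →* F) c) ^
      (a + ∑ i : Fin f, (p : ℤ) ^ (i : ℕ) * (r i : ℤ)) *
      (Units.map (algebraMap k F : k →* F) c) ^ (∑ i : Fin f, p ^ (i : ℕ) * (p - 1 - r i)) =
      (Units.map (algebraMap k F : k →* F) c) ^ a := by
  classical
  rw [← zpow_natCast, ← zpow_add, add_assoc, sum_add_sum_sub hr, zpow_add, ← map_zpow _ c]
  have h1 : (p : ℤ) ^ f - 1 = ((Fintype.card kˣ : ℕ) : ℤ) := by
    rw [Fintype.card_units, hk, Nat.cast_sub (Nat.one_le_pow _ _ (Fact.out : p.Prime).pos)]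
    simp
  rw [← map_zpow _ c ((p : ℤ) ^ f - 1), h1, zpow_natCast, pow_card_eq_one, map_one, mul_one]

lemma twist_smul_apply {G V : Type*} [Group G] [AddCommMonoid V] [Module F V]
    (ρ : Representation F G V) (χ : G →* Fˣ) (g : G) (v : V) :
    twist ρ χ g v = χ g • ρ g v := rfl

variable [CharP F p]

/-- The embedding of a weight `σ` in `R_σ`. -/
noncomputable def weightEmb [Fintype k] (hk : Fintype.card k = p ^ f) {r : Fin f → ℕ}
    (hr : ∀ i, r i ≤ p - 1) (a : ℤ) :
    (weight k F p r a).IntertwiningMap (repR k F p r a) :=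
  LinearMap.intertwiningMap_of_isIntertwiningMap _ _
    (PiTensorProduct.map fun i => projREps F (hr i)) fun g x => by
  have h1 : PiTensorProduct.map (fun i => (projR F p (r i)).toRepresentation (frob k F p i g)) ∘ₗ
      PiTensorProduct.map (fun i => projREps F (hr i)) =
      ((Units.map (algebraMap k F : k →* F) (Matrix.GeneralLinearGroup.det g)) ^
        (∑ i : Fin f, p ^ (i : ℕ) * (p - 1 - r i)) : Fˣ) •
      PiTensorProduct.map (fun i => projREps F (hr i)) ∘ₗ
        PiTensorProduct.map (fun i => symRep F (r i) (frob k F p i g)) := by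
    rw [← PiTensorProduct.map_comp, ← PiTensorProduct.map_comp, Units.smul_def,
      Units.val_pow_eq_pow_val, ← prod_pow_pow, ← map_smul_univ']
    congr 1
    funext i
    refine LinearMap.ext fun P => ?_
    rw [LinearMap.comp_apply, ← projREps_symRep, det_frob]
    rfl
  have h2 := LinearMap.congr_fun h1 x
  rw [weight, repR, twist_smul_apply, twist_smul_apply, piTensor_apply, piTensor_apply,
    Units.smul_def, map_smul, ← Units.smul_def]
  refine Eq.trans ?_ (congrArg _ h2).symm
  rw [LinearMap.smul_apply, smul_smul, detPow_apply, detPow_apply, units_zpow_eq hk hr]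
  rfl

/-- The action of the polarised determinant of the `i`-th factor on `R_σ`. -/
noncomputable def capelliAt (r : Fin f → ℕ) (a : ℤ) (i : Fin f) :
    (repR k F p r a).IntertwiningMap (repR k F p r a) :=
  LinearMap.intertwiningMap_of_isIntertwiningMap _ _ (factorMap i (projRCapelli F p (r i)))
    fun g x => by
  rw [repR, twist_smul_apply, twist_smul_apply, piTensor_apply, Units.smul_def, map_smul,
    ← Units.smul_def]
  exact congrArg _ (factorMap_comm_map i _ _ _ (fun x => (projRCapelli_rep _ x).symm) x).symm

omit [CharP F p] in
lemma repA_toSubmodule (r : Fin f → ℕ) (a : ℤ) : (repA k F p r a).toSubmodule =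
    ⨅ i, LinearMap.ker (capelliAt (k := k) (F := F) (p := p) r a i).toLinearMap := by
  have h : (fun i => (projW F p (r i)).toSubmodule) =
      fun i => LinearMap.ker (projRCapelli F p (r i)) := funext fun i => projW_toSubmodule
  have h' : ∀ S S' : ∀ i, Submodule F (projR F p (r i)).toSubmodule, S = S' →
      LinearMap.range (PiTensorProduct.mapIncl S) =
        LinearMap.range (PiTensorProduct.mapIncl S') := by
    rintro _ _ rfl
    rfl
  exact (h' _ _ h).trans (range_mapIncl_ker _)

end Weights

end SocleB

namespace SocleB

universe u v

variable {k : Type u} [Field k] {F : Type v} [Field F] [Algebra k F]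
  {p f : ℕ} [Fact p.Prime] [CharP k p]

variable (F p) in
/-- The embedding of `R_σ` in the ambient tensor product. -/
noncomputable def repRIncl (r : Fin f → ℕ) : (⨂[F] i, (projR F p (r i)).toSubmodule) →ₗ[F]
    ⨂[F] i, SymPow F (p - 1 - r i) ⊗[F] SymPow F (p - 1) :=
  PiTensorProduct.map fun i => projRIncl F p (r i)

omit [Fact p.Prime] in
lemma repRIncl_injective (r : Fin f → ℕ) : Function.Injective (repRIncl F p r) :=
  piMap_injective fun _ => projRIncl_injective

lemma repRIncl_repR (r : Fin f → ℕ) (a : ℤ) (g : GL (Fin 2) k)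
    (x : ⨂[F] i, (projR F p (r i)).toSubmodule) :
    repRIncl F p r (repR k F p r a g x) =
      detPow k F (a + ∑ i : Fin f, (p : ℤ) ^ (i : ℕ) * (r i : ℤ)) g •
        ambient k F p (fun i => p - 1 - r i) g (repRIncl F p r x) := by
  rw [repR, twist_smul_apply, Units.smul_def, map_smul, ← Units.smul_def]
  congr 1
  rw [repRIncl, piTensor_apply, piTensor_apply, ← LinearMap.comp_apply, ← LinearMap.comp_apply,
    ← PiTensorProduct.map_comp, ← PiTensorProduct.map_comp]
  rfl

omit [Fact p.Prime] in
lemma repRIncl_factorMap (r : Fin f → ℕ) (i : Fin f)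
    (x : ⨂[F] i, (projR F p (r i)).toSubmodule) :
    repRIncl F p r (factorMap i (projRCapelli F p (r i)) x) =
      factorMap i (capelli F (p - 1 - r i) (p - 1)) (repRIncl F p r x) :=
  factorMap_comm_map i _ _ _ projRIncl_capelli x

lemma detPow_unip (a : ℤ) (t : k) : detPow k F a (unip t) = 1 := by
  have : Matrix.GeneralLinearGroup.det (unip t) = 1 := by
    ext
    simp [coe_unip, Matrix.det_fin_two_of]
  rw [detPow_apply, this, map_one, one_zpow]

lemma detPow_diagOne (a : ℤ) (c : kˣ) : detPow k F a (diagOne c) =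
    (Units.map (algebraMap k F : k →* F) c) ^ a := by
  have : Matrix.GeneralLinearGroup.det (diagOne c) = c := by
    ext
    simp [coe_diagOne, Matrix.det_fin_two_of]
  rw [detPow_apply, this]

variable [CharP F p]

/-! ### Highest weight vectors of `σ` and their images in `R_σ`. -/

section Vectors

variable {r : Fin f → ℕ} (hr : ∀ i, r i ≤ p - 1)

variable (F r) in
/-- The highest weight vector of a weight. -/
noncomputable def topVec : ⨂[F] i, SymPow F (r i) :=
  PiTensorProduct.tprod F fun i => mono F (r i) (r i)

omit [CharP F p] in
lemma weight_unip_topVec (a : ℤ) (t : k) :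
    weight k F p r a (unip t) (topVec F r) = topVec F r := by
  rw [weight, twist_smul_apply, detPow_unip, one_smul, topVec, piTensor_tprod]
  simp only [MonoidHom.comp_apply, frob_unip, symRep_unip_mono_self]

omit [CharP F p] in
lemma weight_diagOne_topVec (a : ℤ) (c : kˣ) :
    weight k F p r a (diagOne c) (topVec F r) =
      (Units.map (algebraMap k F : k →* F) c) ^ a • topVec F r := by
  rw [weight, twist_smul_apply, detPow_diagOne, topVec, piTensor_tprod]
  simp only [MonoidHom.comp_apply, frob_diagOne, symRep_diagOne_mono_self]

variable [Fintype k] (hk : Fintype.card k = p ^ f)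

lemma weightEmb_topVec (a : ℤ) : weightEmb hk hr a (topVec F r) =
    PiTensorProduct.tprod F fun i => projREps F (hr i) (mono F (r i) (r i)) :=
  PiTensorProduct.map_tprod _ _

lemma repRIncl_weightEmb_topVec (a : ℤ) : repRIncl F p r (weightEmb hk hr a (topVec F r)) =
    piHvec F (fun i => Nat.sub_le (p - 1) (r i)) fun _ => Fin.last _ := by
  rw [weightEmb_topVec, repRIncl, PiTensorProduct.map_tprod, piHvec]
  simp only [projRIncl_eps, eps_mono_self _ (Nat.sub_le (p - 1) _)]

lemma weightEmb_injective (a : ℤ) : Function.Injective (weightEmb (F := F) hk hr a) :=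
  piMap_injective (F := F) fun i => projREps_injective (hr i)

lemma topVec_ne_zero : topVec F r ≠ 0 := by
  have h : topVec F r = Basis.piTensorProduct (fun i => monoBasis F (r i)) fun i => Fin.last _ := by
    rw [Basis.piTensorProduct_apply, topVec]
    simp only [monoBasis_apply, Fin.val_last]
  rw [h]
  exact Module.Basis.ne_zero _ _

include hk in
lemma eq_top_of_topVec_mem (hf : 0 < f) (hr : ∀ i, r i < p - 1) {a : ℤ}
    {M : Submodule F (⨂[F] i, SymPow F (r i))}
    (hstab : ∀ g, ∀ x ∈ M, weight k F p r a g x ∈ M) (h : topVec F r ∈ M) : M = ⊤ := by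
  refine eq_top_of_tprod_mono_mem (k := k) hk hf hr (fun g x hx => ?_) h
  have := hstab g x hx
  rwa [weight, twist_smul_apply, Units.smul_def, M.smul_mem_iff (Units.ne_zero _)] at this

lemma weightEmb_topVec_mem (hex : ∃ i, r i ≠ 0) (a : ℤ) (M : Subrepresentation (repR k F p r a))
    (hM : M.toSubmodule ≠ ⊥) : weightEmb hk hr a (topVec F r) ∈ M.toSubmodule := by
  have hp := (Fact.out : p.Prime).two_le
  have h := piHvec_last_mem (k := k) (F := F) (fun i => Nat.sub_le (p - 1) (r i)) hk
    (hex.imp fun i hi => by omega) (M := M.toSubmodule.map (repRIncl F p r)) ?_ ?_ ?_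
  · obtain ⟨y, hy, hyx⟩ := h
    rw [← repRIncl_weightEmb_topVec hr hk a] at hyx
    rwa [← repRIncl_injective r hyx]
  · intro hb
    refine hM ((Submodule.eq_bot_iff _).mpr fun y hy => repRIncl_injective (F := F) (p := p) r ?_)
    rw [map_zero]
    exact (Submodule.eq_bot_iff _).mp hb _ ⟨y, hy, rfl⟩
  · rintro g _ ⟨y, hy, rfl⟩
    have h1 : repRIncl F p r (repR k F p r a g y) ∈ M.toSubmodule.map (repRIncl F p r) :=
      ⟨_, M.apply_mem_toSubmodule g hy, rfl⟩
    rwa [repRIncl_repR, Units.smul_def, Submodule.smul_mem_iff _ (Units.ne_zero _)] at h1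
  · rintro _ ⟨y, hy, rfl⟩ i
    have h1 := LinearMap.congr_fun
      (factorMap_comp i (projRCapelli F p (r i)) (projRCapelli F p (r i))) y
    rw [factorMap_eq_zero (V := fun i => (projR F p (r i)).toSubmodule) i _
      (fun x => projRCapelli_projRCapelli x)] at h1
    rw [← repRIncl_factorMap, ← repRIncl_factorMap]
    exact (congrArg _ h1.symm).trans (map_zero _)

/-- The image of the highest weight vector is `U`-invariant and has the torus weight of `piHvec` at
the last indices. This weight occurs only once among the `piHvec`. -/
lemma exists_map_topVec_eq (hex : ∃ i, r i ≠ 0) (a : ℤ)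
    (ψ : (weight k F p r a).IntertwiningMap (repR k F p r a)) :
    ∃ c : F, ψ (topVec F r) = c • weightEmb hk hr a (topVec F r) := by
  classical
  have hp := (Fact.out : p.Prime).two_le
  let m : Fin f → ℕ := fun i => p - 1 - r i
  have hm : ∀ i, m i ≤ p - 1 := fun i => Nat.sub_le (p - 1) (r i)
  let x := repRIncl F p r (ψ (topVec F r))
  have hx : ∀ t : k, ambient k F p m (unip t) x = x := by
    intro t
    have h := repRIncl_repR r a (unip t) (ψ (topVec F r))
    rw [detPow_unip, one_smul, ← ψ.isIntertwining _ _ (unip t), weight_unip_topVec] at h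
    exact h.symm
  have hx' : ∀ c : kˣ, ambient k F p m (diagOne c) x =
      (algebraMap k F c) ^ (∑ i : Fin f, p ^ (i : ℕ) * m i) • x := by
    intro c
    have h := repRIncl_repR r a (diagOne c) (ψ (topVec F r))
    rw [detPow_diagOne, ← ψ.isIntertwining _ _ (diagOne c), weight_diagOne_topVec, Units.smul_def,
      map_smul, map_smul, ← Units.smul_def, ← units_zpow_eq hk hr a c, mul_smul] at h
    exact (smul_left_cancel _ h).symm
  obtain ⟨c, hc⟩ := (Submodule.mem_span_range_iff_exists_fun F).mp (mem_span_piHvec hm hk hx)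
  -- Subtracting `x` at the last index makes the weighted sum vanish for every torus element, so
  -- weight separation with the zero submodule compares coefficients.
  have h0 := mem_of_forall_unit_sum_mem (k := k) (F := F) hk ⊥ hm
    (hex.imp fun i hi => by simp only [m]; omega)
    (fun l => c l • piHvec F hm l - if l = fun i => Fin.last _ then x else 0) (fun t => ?_)
    fun i => Fin.last _
  · rw [if_pos rfl, Submodule.mem_bot, sub_eq_zero] at h0
    refine ⟨c fun i => Fin.last _, repRIncl_injective (F := F) (p := p) r ?_⟩
    rw [map_smul, repRIncl_weightEmb_topVec]
    exact h0.symm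
  · have h1 := hx' t
    conv_lhs at h1 => rw [← hc, map_sum]
    simp only [map_smul, ambient_diagOne_piHvec] at h1
    simp only [Submodule.mem_bot, smul_sub, Finset.sum_sub_distrib, smul_ite, smul_zero,
      Finset.sum_ite_eq', Finset.mem_univ, if_true, smul_comm _ (c _)]
    rw [h1]
    exact sub_self _

end Vectors

variable [Fintype k]

/-- The socle of `R_σ`. -/
noncomputable def socleData (hk : Fintype.card k = p ^ f) {r : Fin f → ℕ}
    (hr : ∀ i, r i < p - 1) (hex : ∃ i, r i ≠ 0) (a : ℤ) :
    SocleData (weight k F p r a) (repR k F p r a) f where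
  N := capelliAt r a
  ε := weightEmb hk (fun i => (hr i).le) a
  v₀ := topVec F r
  v₀_ne := topVec_ne_zero
  ε_inj := weightEmb_injective _ hk a
  le_of_ne_bot M hM := by
    have hf : 0 < f := hex.elim fun i _ => i.pos
    rw [LinearMap.range_le_iff_comap]
    refine eq_top_of_topVec_mem (k := k) (a := a) hk hf hr (fun g x hx => ?_)
      (weightEmb_topVec_mem (fun i => (hr i).le) hk hex a M hM)
    rw [Submodule.mem_comap] at hx ⊢
    exact (congrArg (· ∈ M.toSubmodule)
      ((weightEmb hk (fun i => (hr i).le) a).isIntertwining _ _ g x)).mpr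
      (M.apply_mem_toSubmodule g hx)
  hom_eq ψ := by
    have hf : 0 < f := hex.elim fun i _ => i.pos
    obtain ⟨c, hc⟩ := exists_map_topVec_eq (fun i => (hr i).le) hk hex a ψ
    refine ⟨c, Representation.IntertwiningMap.ext (LinearMap.ext fun x => ?_)⟩
    have htop := eq_top_of_topVec_mem (k := k) (a := a) hk hf hr
      (M := LinearMap.eqLocus ψ.toLinearMap (c • weightEmb hk (fun i => (hr i).le) a).toLinearMap)
      (fun g x hx => ?_) hc
    · exact htop.ge (Submodule.mem_top (x := x))
    · exact (ψ.isIntertwining _ _ g x).trans ((congrArg _ hx).trans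
        ((c • weightEmb hk (fun i => (hr i).le) a).isIntertwining _ _ g x).symm)
  -- Only the `i`-th factor of the socle vector is replaced by a Capelli preimage; the other factors
  -- remain in the kernels of their operators.
  exists_lift i := by
    obtain ⟨z, hz⟩ := exists_projRCapelli_eq (hr i)
      (projREps F (hr i).le (mono F (r i) (r i))) (eps_mono_self (Nat.sub_add_cancel (hr i).le) _)
    refine ⟨PiTensorProduct.tprod F (Function.update
      (fun j => projREps F (hr j).le (mono F (r j) (r j))) i z), ?_, fun j hj => ?_⟩
    · rw [weightEmb_topVec]
      refine (factorMap_tprod i _ _).trans ?_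
      rw [Function.update_self, Function.update_idem, hz, Function.update_eq_self]
    · refine (factorMap_tprod j _ _).trans ?_
      rw [Function.update_of_ne hj, projRCapelli_eps]
      exact (PiTensorProduct.tprod F).map_coord_zero j (by simp)
  N_ε i v := by
    have h := factorMap_comm_map i (0 : SymPow F (r i) →ₗ[F] SymPow F (r i))
      (projRCapelli F p (r i)) (fun i => projREps F (hr i).le)
      (fun x => by rw [projRCapelli_eps]; simp) v
    rw [factorMap_eq_zero (V := fun i => SymPow F (r i)) i 0 (fun _ => rfl), map_zero] at h
    exact h.symm

end SocleB

namespace SocleB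

universe u v

/-! ### Sums of monomials in matrix entries over `GL₂` of a finite field. -/

section MatrixSums

variable {k : Type*} [Field k] [Fintype k]

/-- Multiplied by `x - y`, the sum telescopes to `x ^ q - y ^ q = x - y`, where `q` is the
cardinality of `k`; for `x = y` it consists of `q` equal terms and vanishes. -/
lemma sub_pow_card_sub_one (x y : k) : (x - y) ^ (Fintype.card k - 1) =
    ∑ s ∈ Finset.range (Fintype.card k - 1 + 1), x ^ s * y ^ (Fintype.card k - 1 - s) := by
  have hq : 1 < Fintype.card k := Fintype.one_lt_card
  have h := (Commute.all x y).geom_sum₂_mul (Fintype.card k - 1 + 1)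
  rw [Nat.add_sub_cancel] at h
  by_cases hxy : x = y
  · subst hxy
    rw [sub_self, zero_pow (by omega)]
    rw [Finset.sum_congr rfl fun s hs => by
      rw [← pow_add, Nat.add_sub_cancel' (Nat.lt_succ_iff.mp (Finset.mem_range.mp hs))]]
    rw [Finset.sum_const, Finset.card_range, Nat.sub_add_cancel hq.le, nsmul_eq_mul,
      FiniteField.cast_card_eq_zero, zero_mul]
  · have hne := sub_ne_zero.mpr hxy
    rw [Nat.sub_add_cancel hq.le, FiniteField.pow_card, FiniteField.pow_card] at h
    rw [FiniteField.pow_card_sub_one_eq_one _ hne, Nat.sub_add_cancel hq.le]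
    exact (mul_right_cancel₀ hne (h.trans (one_mul _).symm)).symm

lemma sum_matrix_prod_pow (e : Fin 2 → Fin 2 → ℕ) :
    ∑ A : Matrix (Fin 2) (Fin 2) k, ∏ i, ∏ j, A i j ^ e i j = ∏ i, ∏ j, ∑ x : k, x ^ e i j := by
  classical
  have h1 := Finset.prod_univ_sum (fun _ : Fin 2 => (Finset.univ : Finset (Fin 2 → k)))
    (fun i v => ∏ j, v j ^ e i j)
  have h2 : ∀ i, ∏ j, ∑ x : k, x ^ e i j = ∑ v : Fin 2 → k, ∏ j, v j ^ e i j := fun i => by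
    have := Finset.prod_univ_sum (fun _ : Fin 2 => (Finset.univ : Finset k))
      (fun j x => x ^ e i j)
    rwa [Fintype.piFinset_univ] at this
  rw [Fintype.piFinset_univ] at h1
  simp only [h2]
  exact h1.symm

/-- The power `det ^ (q - 1)`, where `q` is the cardinality of `k`, is the indicator function of
invertibility. -/
lemma sum_gl_eq_sum_matrix [Fintype (GL (Fin 2) k)] (φ : Matrix (Fin 2) (Fin 2) k → k) :
    ∑ g : GL (Fin 2) k, φ g =
      ∑ A : Matrix (Fin 2) (Fin 2) k, A.det ^ (Fintype.card k - 1) * φ A := by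
  classical
  have hq : 1 < Fintype.card k := Fintype.one_lt_card
  rw [← Finset.sum_subset (Finset.subset_univ
    (Finset.univ.image fun g : GL (Fin 2) k => (g : Matrix (Fin 2) (Fin 2) k)))]
  · rw [Finset.sum_image fun _ _ _ _ h => Units.ext h]
    refine Finset.sum_congr rfl fun g _ => ?_
    rw [FiniteField.pow_card_sub_one_eq_one, one_mul]
    exact (Matrix.GeneralLinearGroup.det g).ne_zero
  · intro A _ hA
    have : A.det = 0 := by
      by_contra h
      exact hA (Finset.mem_image.mpr ⟨Matrix.GeneralLinearGroup.mkOfDetNeZero A h,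
        Finset.mem_univ _, rfl⟩)
    rw [this, zero_pow (by omega), zero_mul]

/-- Expanding `det ^ (q - 1)` makes the four entries independent. A power sum is nonzero only at
positive multiples of `q - 1`, which forces the expansion index to equal both `M` and `J`; the
surviving term is a product of four factors `-1` with an even sign. -/
lemma sum_gl_monomial [Fintype (GL (Fin 2) k)] {M J : ℕ} (hM : M ≤ Fintype.card k - 1)
    (hJ : J ≤ Fintype.card k - 1) :
    ∑ g : GL (Fin 2) k, ((-(g 1 0)) ^ M * (g 0 0) ^ (Fintype.card k - 1 - M) *
      ((-(g 0 1)) ^ J * (g 1 1) ^ (Fintype.card k - 1 - J))) = if M = J then 1 else 0 := by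
  have hq : 1 < Fintype.card k := Fintype.one_lt_card
  have h1 := sum_gl_eq_sum_matrix fun A : Matrix (Fin 2) (Fin 2) k =>
    (-(A 1 0)) ^ M * (A 0 0) ^ (Fintype.card k - 1 - M) *
      ((-(A 0 1)) ^ J * (A 1 1) ^ (Fintype.card k - 1 - J))
  refine h1.trans ?_
  simp only [Matrix.det_fin_two, sub_pow_card_sub_one]
  have hQ : 0 < Fintype.card k - 1 := by omega
  generalize hQe : Fintype.card k - 1 = Q at *
  have h2 : ∀ A : Matrix (Fin 2) (Fin 2) k,
      (∑ s ∈ Finset.range (Q + 1), (A 0 0 * A 1 1) ^ s * (A 0 1 * A 1 0) ^ (Q - s)) *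
        ((-(A 1 0)) ^ M * (A 0 0) ^ (Q - M) * ((-(A 0 1)) ^ J * (A 1 1) ^ (Q - J))) =
      ∑ s ∈ Finset.range (Q + 1), (-1) ^ (M + J) * ∏ i, ∏ j, A i j ^
        ((![![s + (Q - M), Q - s + J], ![Q - s + M, s + (Q - J)]] : Fin 2 → Fin 2 → ℕ) i j) := by
    intro A
    rw [Finset.sum_mul]
    refine Finset.sum_congr rfl fun s _ => ?_
    simp only [Fin.prod_univ_two, Matrix.cons_val_zero, Matrix.cons_val_one, mul_pow, pow_add,
      neg_pow (A 1 0), neg_pow (A 0 1)]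
    ring
  simp only [h2]
  rw [Finset.sum_comm]
  simp only [← Finset.mul_sum, sum_matrix_prod_pow]
  simp only [sum_pow_eq_ite, hQe, Fin.prod_univ_two,
    Matrix.cons_val_zero, Matrix.cons_val_one]
  have hdvd : ∀ x : ℕ, x ≤ 2 * Q → 0 < x → Q ∣ x → x = Q ∨ x = 2 * Q := by
    rintro x hx h0 ⟨y, rfl⟩
    have : y ≤ 2 := by
      by_contra! h
      nlinarith
    interval_cases y <;> omega
  -- The two exponents are positive multiples of `Q` with sum `2 * Q`, so each equals `Q`.
  have key : ∀ M, M ≤ Q → ∀ s ≤ Q, 0 < s + (Q - M) → Q ∣ s + (Q - M) → 0 < Q - s + M →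
      Q ∣ Q - s + M → s = M := by
    intro M hM s hs h1 h2 h3 h4
    have := hdvd _ (by omega) h1 h2
    have := hdvd _ (by omega) h3 h4
    omega
  split_ifs with hMJ
  · subst hMJ
    rw [Finset.sum_eq_single M]
    · rw [Nat.add_sub_cancel' hM, Nat.sub_add_cancel hM, ← two_mul, pow_mul]
      simp [hQ]
    · intro s hs hne
      have hs' := Nat.lt_succ_iff.mp (Finset.mem_range.mp hs)
      by_cases c1 : 0 < s + (Q - M) ∧ Q ∣ s + (Q - M)
      · by_cases c2 : 0 < Q - s + M ∧ Q ∣ Q - s + M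
        · exact absurd (key M hM s hs' c1.1 c1.2 c2.1 c2.2) hne
        · simp only [c2, if_false, mul_zero, zero_mul]
      · simp only [c1, if_false, mul_zero, zero_mul]
    · intro h
      exact absurd (Finset.mem_range.mpr (Nat.lt_succ_iff.mpr hM)) h
  · refine mul_eq_zero_of_right _ (Finset.sum_eq_zero fun s hs => ?_)
    have hs' := Nat.lt_succ_iff.mp (Finset.mem_range.mp hs)
    by_cases c1 : 0 < s + (Q - M) ∧ Q ∣ s + (Q - M)
    · by_cases c2 : 0 < Q - s + M ∧ Q ∣ Q - s + M
      · by_cases c3 : 0 < s + (Q - J) ∧ Q ∣ s + (Q - J)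
        · by_cases c4 : 0 < Q - s + J ∧ Q ∣ Q - s + J
          · exact absurd ((key M hM s hs' c1.1 c1.2 c2.1 c2.2).symm.trans
              (key J hJ s hs' c3.1 c3.2 c4.1 c4.2)) hMJ
          · simp only [c4, if_false, mul_zero, zero_mul]
        · simp only [c3, if_false, mul_zero]
      · simp only [c2, if_false, mul_zero, zero_mul]
    · simp only [c1, if_false, zero_mul]

end MatrixSums

end SocleB

namespace SocleB

universe u v

/-! ### Conjugates of a rank one endomorphism and the retraction onto `R_r`. -/

section Conjugation

open MvPolynomial

variable {F : Type v} [Field F]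

/-- Evaluation of homogeneous polynomials of degree `n` at a point. -/
noncomputable def evalAt (n : ℕ) (x : Fin 2 → F) : SymPow F n →ₗ[F] F :=
  (MvPolynomial.aeval x : MvPolynomial (Fin 2) F →ₐ[F] F).toLinearMap ∘ₗ SymPow.val n

lemma evalAt_eq_sum (n : ℕ) (x : Fin 2 → F) :
    evalAt n x = ∑ j ∈ Finset.range (n + 1), (x 0 ^ j * x 1 ^ (n - j)) • coeffL n j := by
  refine LinearMap.ext fun Q => ?_
  conv_lhs => rw [← sum_coeffL_mono n Q]
  rw [map_sum, LinearMap.sum_apply]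
  refine Finset.sum_congr rfl fun j hj => ?_
  rw [map_smul, evalAt, LinearMap.comp_apply,
    val_mono (Nat.lt_succ_iff.mp (Finset.mem_range.mp hj))]
  simp [mul_comm]

lemma coeffL_zero_eq_evalAt (n : ℕ) : coeffL n 0 = evalAt (F := F) n ![0, 1] := by
  rw [evalAt_eq_sum, Finset.sum_eq_single 0]
  · simp
  · intro j _ hj
    simp [hj]
  · simp

lemma evalAt_symRep (n : ℕ) (x : Fin 2 → F) (g : GL (Fin 2) F) :
    evalAt n x ∘ₗ symRep F n g =
      evalAt n fun j => ∑ i, (g : Matrix (Fin 2) (Fin 2) F) i j * x i := by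
  have : (MvPolynomial.aeval x : MvPolynomial (Fin 2) F →ₐ[F] F).comp
      (subst (g : Matrix (Fin 2) (Fin 2) F)) =
      MvPolynomial.aeval fun j => ∑ i, (g : Matrix (Fin 2) (Fin 2) F) i j * x i := by
    refine MvPolynomial.algHom_ext fun j => ?_
    simp [subst_X, Fin.sum_univ_two]
  exact LinearMap.ext fun P => AlgHom.congr_fun this (SymPow.val n P)

lemma symRep_mono_zero (n : ℕ) (g : GL (Fin 2) F) : symRep F n g (mono F n 0) =
    ∑ j ∈ Finset.range (n + 1), ((n.choose j : F) * ((g : Matrix (Fin 2) (Fin 2) F) 0 1 ^ j *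
      (g : Matrix (Fin 2) (Fin 2) F) 1 1 ^ (n - j))) • mono F n j := by
  refine SymPow.val_injective n ?_
  rw [val_symRep, val_mono (Nat.zero_le n), map_mul, map_pow, map_pow, subst_X, subst_X, pow_zero,
    one_mul, Nat.sub_zero, add_pow, map_sum]
  refine Finset.sum_congr rfl fun j hj => ?_
  rw [map_smul, val_mono (Nat.lt_succ_iff.mp (Finset.mem_range.mp hj)), smul_eq_C_mul]
  simp only [map_mul, map_pow, map_natCast]
  ring

/-- The coefficient functional is evaluation at `(0, 1)`. Composed with `g⁻¹` it becomes evaluation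
at the second row of `g⁻¹`, which is `(-g₁₀, g₀₀) / det g`. -/
lemma det_pow_smul_coeffL_symRep_inv (n : ℕ) (g : GL (Fin 2) F) :
    (g : Matrix (Fin 2) (Fin 2) F).det ^ n • (coeffL n 0 ∘ₗ symRep F n g⁻¹) =
      ∑ j ∈ Finset.range (n + 1), ((-(g : Matrix (Fin 2) (Fin 2) F) 1 0) ^ j *
        (g : Matrix (Fin 2) (Fin 2) F) 0 0 ^ (n - j)) • coeffL n j := by
  have hd : (g : Matrix (Fin 2) (Fin 2) F).det ≠ 0 := (Matrix.GeneralLinearGroup.det g).ne_zero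
  have h0 : (g : Matrix (Fin 2) (Fin 2) F).det * (g⁻¹ : GL (Fin 2) F) 1 0 =
      -(g : Matrix (Fin 2) (Fin 2) F) 1 0 := by
    rw [Matrix.coe_units_inv, Matrix.inv_def, Matrix.adjugate_fin_two, Ring.inverse_eq_inv']
    simp [hd]
  have h1 : (g : Matrix (Fin 2) (Fin 2) F).det * (g⁻¹ : GL (Fin 2) F) 1 1 =
      (g : Matrix (Fin 2) (Fin 2) F) 0 0 := by
    rw [Matrix.coe_units_inv, Matrix.inv_def, Matrix.adjugate_fin_two, Ring.inverse_eq_inv']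
    simp [hd]
  rw [coeffL_zero_eq_evalAt, evalAt_symRep, evalAt_eq_sum, Finset.smul_sum]
  refine Finset.sum_congr rfl fun j hj => ?_
  have hj' := Nat.lt_succ_iff.mp (Finset.mem_range.mp hj)
  rw [smul_smul]
  congr 1
  simp only [Fin.sum_univ_two, Matrix.cons_val_zero, Matrix.cons_val_one, mul_zero, zero_add,
    mul_one]
  rw [← h0, ← h1, mul_pow, mul_pow, mul_mul_mul_comm, ← pow_add, Nat.add_sub_cancel' hj']

variable {p : ℕ} [Fact p.Prime] [CharP F p]

variable (F) in
/-- The elementary endomorphism of `Symⁿ` sending the `j`-th monomial to the `l`-th one. -/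
noncomputable def elemMap (n j l : ℕ) : SymPow F n →ₗ[F] SymPow F n :=
  (coeffL n j).smulRight (mono F n l)

lemma sum_elemMap (n : ℕ) : ∑ j ∈ Finset.range (n + 1), elemMap F n j j = LinearMap.id :=
  LinearMap.ext fun v => by
    simpa [elemMap, LinearMap.sum_apply] using sum_coeffL_mono n v

lemma det_pow_smul_conj_elemMap (g : GL (Fin 2) F) :
    (g : Matrix (Fin 2) (Fin 2) F).det ^ (p - 1) •
      (symRep F (p - 1) g ∘ₗ elemMap F (p - 1) 0 0 ∘ₗ symRep F (p - 1) g⁻¹) =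
    ∑ x ∈ Finset.range (p - 1 + 1) ×ˢ Finset.range (p - 1 + 1),
      ((-(g : Matrix (Fin 2) (Fin 2) F) 1 0) ^ x.1 *
        (g : Matrix (Fin 2) (Fin 2) F) 0 0 ^ (p - 1 - x.1) *
      ((-(g : Matrix (Fin 2) (Fin 2) F) 0 1) ^ x.2 *
        (g : Matrix (Fin 2) (Fin 2) F) 1 1 ^ (p - 1 - x.2))) • elemMap F (p - 1) x.1 x.2 := by
  refine LinearMap.ext fun P => ?_
  have h1 := LinearMap.congr_fun (det_pow_smul_coeffL_symRep_inv (p - 1) g) P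
  rw [LinearMap.smul_apply, LinearMap.comp_apply, LinearMap.comp_apply, elemMap,
    LinearMap.smulRight_apply, map_smul, smul_smul]
  rw [LinearMap.smul_apply, LinearMap.comp_apply, smul_eq_mul] at h1
  rw [h1, symRep_mono_zero, LinearMap.sum_apply, LinearMap.sum_apply, Finset.sum_smul_sum,
    Finset.sum_product]
  refine Finset.sum_congr rfl fun j _ => Finset.sum_congr rfl fun l hl => ?_
  rw [cast_choose_prime_pred (Nat.lt_succ_iff.mp (Finset.mem_range.mp hl)), LinearMap.smul_apply,
    LinearMap.smul_apply, elemMap, LinearMap.smulRight_apply, smul_smul, smul_smul, smul_eq_mul,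
    neg_pow ((g : Matrix (Fin 2) (Fin 2) F) 0 1)]
  congr 1
  ring

omit [Fact p.Prime] [CharP F p] in
lemma commute_aeval {A : Type*} [Ring A] [Algebra F A] {a b : A} (h : Commute a b)
    (e : Polynomial F) : Commute a (Polynomial.aeval b e) := by
  induction e using Polynomial.induction_on' with
  | add q q' hq hq' =>
    rw [map_add]
    exact hq.add_right hq'
  | monomial n c =>
    rw [Polynomial.aeval_monomial]
    exact (Algebra.commute_algebraMap_right c a).mul_right (h.pow_right n)

/-- The projection onto `ker N²` is a polynomial in the equivariant operator `N`, hence equivariant.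
-/
lemma exists_retraction {r : ℕ} (hr : r < p - 1) :
    ∃ π : SymPow F (p - 1 - r) ⊗[F] SymPow F (p - 1) →ₗ[F] (projR F p r).toSubmodule,
      (∀ x, π (projRIncl F p r x) = x) ∧ ∀ g v,
        π (biRep F (p - 1 - r) (p - 1) g v) = (projR F p r).toRepresentation g (π v) := by
  obtain ⟨e, he⟩ := exists_projection (F := F) (p := p) rfl (m := p - 1 - r) (by omega)
    (Nat.sub_le (p - 1) r)
  refine ⟨projRLift _ fun x => (he x).1, fun x => projRIncl_injective ?_,
    fun g v => projRIncl_injective ?_⟩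
  · rw [projRIncl_lift]
    exact (he _).2 (capelli_capelli_projRIncl x)
  · rw [projRIncl_lift, projRIncl_rep, projRIncl_lift]
    have hc : Commute (biRep F (p - 1 - r) (p - 1) g)
        (capelli F (p - 1 - r) (p - 1) : Module.End F _) := (capelli_comm _ _ g).symm
    exact (LinearMap.congr_fun (commute_aeval hc e).eq v).symm

end Conjugation

/-! ### The trace identity and injectivity of `R_σ`. -/

section Trace

variable {k : Type u} [Field k] [Fintype k] {F : Type v} [Field F] [Algebra k F]
  {p f : ℕ} [Fact p.Prime] [CharP k p] [CharP F p]

omit [Fintype k] [CharP F p] in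
lemma frob_apply (i : ℕ) (g : GL (Fin 2) k) (a b : Fin 2) :
    (frob k F p i g : Matrix (Fin 2) (Fin 2) F) a b = (algebraMap k F (g a b)) ^ p ^ i := by
  have : (frob k F p i g : Matrix (Fin 2) (Fin 2) F) a b =
      ((algebraMap k F).comp (iterateFrobenius k p i)) (g a b) := rfl
  rw [this, RingHom.comp_apply, iterateFrobenius_def, map_pow]

omit [Fintype k] in
lemma neg_frob_apply (i : ℕ) (g : GL (Fin 2) k) (a b : Fin 2) :
    -(frob k F p i g : Matrix (Fin 2) (Fin 2) F) a b = (algebraMap k F (-(g a b))) ^ p ^ i := by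
  rw [frob_apply, map_neg, ← iterateFrobenius_def p i (algebraMap k F (g a b)),
    ← iterateFrobenius_def p i (-algebraMap k F (g a b)), map_neg]

omit [CharP k p] [CharP F p] [Field k] in
lemma sum_pow_mul_sub (hk : Fintype.card k = p ^ f) {a : Fin f → ℕ} (ha : ∀ i, a i ≤ p - 1) :
    ∑ i : Fin f, p ^ (i : ℕ) * (p - 1 - a i) =
      Fintype.card k - 1 - ∑ i : Fin f, p ^ (i : ℕ) * a i := by
  have h := sum_add_sum_sub ha
  have h1 : 1 ≤ p ^ f := Nat.one_le_pow _ _ (Fact.out : p.Prime).pos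
  rw [hk]
  refine Nat.eq_sub_of_add_eq ?_
  zify [h1] at h ⊢
  linarith

omit [CharP F p] in
lemma prod_det_frob_pow (hk : Fintype.card k = p ^ f) (g : GL (Fin 2) k) :
    ∏ i : Fin f, (frob k F p i g : Matrix (Fin 2) (Fin 2) F).det ^ (p - 1) = 1 := by
  have h := sum_pow_mul_sub (k := k) (a := fun _ : Fin f => 0) hk fun _ => Nat.zero_le _
  simp only [Nat.sub_zero, mul_zero, Finset.sum_const_zero] at h
  simp only [det_frob, prod_pow_pow, h]
  rw [← map_pow, FiniteField.pow_card_sub_one_eq_one, map_one]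
  exact (Matrix.GeneralLinearGroup.det g).ne_zero

variable {m : Fin f → ℕ}

lemma conj_ambient (hk : Fintype.card k = p ^ f) (g : GL (Fin 2) k) :
    ambient k F p m g ∘ₗ PiTensorProduct.map (fun i =>
      LinearMap.lTensor (SymPow F (m i)) (elemMap F (p - 1) 0 0)) ∘ₗ ambient k F p m g⁻¹ =
    ∑ x ∈ Fintype.piFinset fun _ : Fin f => Finset.range (p - 1 + 1) ×ˢ Finset.range (p - 1 + 1),
      algebraMap k F ((-(g 1 0)) ^ (∑ i : Fin f, p ^ (i : ℕ) * (x i).1) *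
        (g 0 0) ^ (Fintype.card k - 1 - ∑ i : Fin f, p ^ (i : ℕ) * (x i).1) *
        ((-(g 0 1)) ^ (∑ i : Fin f, p ^ (i : ℕ) * (x i).2) *
        (g 1 1) ^ (Fintype.card k - 1 - ∑ i : Fin f, p ^ (i : ℕ) * (x i).2))) •
      PiTensorProduct.map (fun i =>
        LinearMap.lTensor (SymPow F (m i)) (elemMap F (p - 1) (x i).1 (x i).2)) := by
  classical
  have h1 : ∀ i : Fin f, (frob k F p i g : Matrix (Fin 2) (Fin 2) F).det ^ (p - 1) •
      (biRep F (m i) (p - 1) (frob k F p i g) ∘ₗ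
        LinearMap.lTensor (SymPow F (m i)) (elemMap F (p - 1) 0 0) ∘ₗ
        biRep F (m i) (p - 1) (frob k F p i g)⁻¹) =
      ∑ x ∈ Finset.range (p - 1 + 1) ×ˢ Finset.range (p - 1 + 1),
      ((-(frob k F p i g : Matrix (Fin 2) (Fin 2) F) 1 0) ^ x.1 *
        (frob k F p i g : Matrix (Fin 2) (Fin 2) F) 0 0 ^ (p - 1 - x.1) *
      ((-(frob k F p i g : Matrix (Fin 2) (Fin 2) F) 0 1) ^ x.2 *
        (frob k F p i g : Matrix (Fin 2) (Fin 2) F) 1 1 ^ (p - 1 - x.2))) •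
      LinearMap.lTensor (SymPow F (m i)) (elemMap F (p - 1) x.1 x.2) := by
    intro i
    have h2 := congrArg (LinearMap.lTensorHom (SymPow F (m i)))
      (det_pow_smul_conj_elemMap (p := p) (frob k F p i g))
    simp only [map_smul, map_sum, LinearMap.coe_lTensorHom] at h2
    rw [← h2]
    congr 1
    refine TensorProduct.ext' fun P Q => ?_
    simp only [LinearMap.comp_apply, biRep_tmul, LinearMap.lTensor_tmul]
    rw [Representation.self_inv_apply]
  have h2 := map_smul_univ' (F := F) (fun i : Fin f =>
    (frob k F p i g : Matrix (Fin 2) (Fin 2) F).det ^ (p - 1)) fun i : Fin f =>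
    (biRep F (m i) (p - 1) (frob k F p i g) ∘ₗ
        LinearMap.lTensor (SymPow F (m i)) (elemMap F (p - 1) 0 0) ∘ₗ
        biRep F (m i) (p - 1) (frob k F p i g)⁻¹)
  rw [prod_det_frob_pow hk, one_smul] at h2
  simp only [h1, map_sum_smul] at h2
  rw [piTensor_apply, piTensor_apply, ← PiTensorProduct.map_comp, ← PiTensorProduct.map_comp]
  simp only [MonoidHom.comp_apply, map_inv]
  refine h2.symm.trans (Finset.sum_congr rfl fun x hx => ?_)
  have hx' : ∀ i, (x i).1 ≤ p - 1 ∧ (x i).2 ≤ p - 1 := fun i => by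
    have := Fintype.mem_piFinset.mp hx i
    simp only [Finset.mem_product, Finset.mem_range] at this
    omega
  congr 1
  rw [← sum_pow_mul_sub hk fun i => (hx' i).1, ← sum_pow_mul_sub hk fun i => (hx' i).2]
  simp only [neg_frob_apply]
  simp only [Finset.prod_mul_distrib, frob_apply, prod_pow_pow, map_mul, map_pow]

/-- By `sum_gl_monomial` only tuples with equal base `p` values survive the sum. Digits are unique,
so these are the diagonal ones, and the diagonal elementary maps add up to the identity. -/
lemma sum_conj_ambient [Fintype (GL (Fin 2) k)] (hk : Fintype.card k = p ^ f) :
    ∑ g, ambient k F p m g ∘ₗ PiTensorProduct.map (fun i =>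
      LinearMap.lTensor (SymPow F (m i)) (elemMap F (p - 1) 0 0)) ∘ₗ ambient k F p m g⁻¹ =
    LinearMap.id := by
  classical
  have hp := (Fact.out : p.Prime).two_le
  simp only [conj_ambient hk]
  rw [Finset.sum_comm]
  simp only [← Finset.sum_smul, ← map_sum]
  have h1 : (LinearMap.id : (⨂[F] i, SymPow F (m i) ⊗[F] SymPow F (p - 1)) →ₗ[F] _) =
      ∑ x ∈ Fintype.piFinset fun _ : Fin f => Finset.range (p - 1 + 1),
      PiTensorProduct.map (fun i =>
        LinearMap.lTensor (SymPow F (m i)) (elemMap F (p - 1) (x i) (x i))) := by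
    have h2 := map_sum_smul (F := F) (fun _ : Fin f => Finset.range (p - 1 + 1)) (fun _ _ => 1)
      fun i j => LinearMap.lTensor (SymPow F (m i)) (elemMap F (p - 1) j j)
    simp only [Finset.prod_const_one, one_smul] at h2
    rw [← h2, ← PiTensorProduct.map_id]
    congr 1
    funext i
    have h3 := congrArg (LinearMap.lTensorHom (SymPow F (m i))) (sum_elemMap (F := F) (p - 1))
    simp only [map_sum, LinearMap.coe_lTensorHom, LinearMap.lTensor_id] at h3
    exact h3.symm
  rw [h1]
  symm
  refine Finset.sum_of_injOn (fun x i => (x i, x i)) ?_ ?_ ?_ ?_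
  · intro x _ y _ hxy
    funext i
    exact congrArg Prod.fst (congrFun hxy i)
  · intro x hx
    simp only [Finset.mem_coe, Fintype.mem_piFinset, Finset.mem_product] at hx ⊢
    exact fun i => ⟨hx i, hx i⟩
  · intro x hx hne
    have hx' : ∀ i, (x i).1 ≤ p - 1 ∧ (x i).2 ≤ p - 1 := fun i => by
      have := Fintype.mem_piFinset.mp hx i
      simp only [Finset.mem_product, Finset.mem_range] at this
      omega
    rw [sum_gl_monomial (sum_digits_le hk hp fun i => (hx' i).1)
      (sum_digits_le hk hp fun i => (hx' i).2), if_neg, map_zero, zero_smul]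
    intro heq
    refine hne ⟨fun i => (x i).1, ?_, ?_⟩
    · simp only [Finset.mem_coe, Fintype.mem_piFinset, Finset.mem_range]
      exact fun i => Nat.lt_succ_iff.mpr (hx' i).1
    · have h2 := digits_eq_zero (p := p) (fun i => ((x i).1 : ℤ) - (x i).2) (fun i => by
        have := hx' i
        rw [abs_le]
        omega) (by
        have := congrArg (Nat.cast : ℕ → ℤ) heq
        push_cast at this
        simp only [mul_sub, Finset.sum_sub_distrib, this, sub_self])
      funext i
      have := h2 i
      exact Prod.ext rfl (by simp only; omega)
  · intro x hx
    have hx' : ∀ i, x i ≤ p - 1 := fun i => by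
      have := Fintype.mem_piFinset.mp hx i
      simp only [Finset.mem_range] at this
      omega
    rw [sum_gl_monomial (sum_digits_le hk hp hx') (sum_digits_le hk hp hx'), if_pos rfl, map_one,
      one_smul]

/-- Compressing the ambient endomorphism with the equivariant retractions keeps its trace equal to
the identity; the determinant twist cancels between `g` and `g⁻¹`. -/
lemma injective_repR (hk : Fintype.card k = p ^ f) {r : Fin f → ℕ} (hr : ∀ i, r i < p - 1)
    (a : ℤ) : Injective (Rep.of (repR k F p r a)) := by
  classical
  choose π hπ hπ' using fun i => exists_retraction (F := F) (p := p) (hr i)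
  refine injective_of_sum_conj _ (PiTensorProduct.map π ∘ₗ PiTensorProduct.map (fun i =>
      LinearMap.lTensor (SymPow F (p - 1 - r i)) (elemMap F (p - 1) 0 0)) ∘ₗ repRIncl F p r) ?_
  have h1 : ∀ g, PiTensorProduct.map π ∘ₗ ambient k F p (fun i => p - 1 - r i) g =
      piTensor (fun i : Fin f => (projR F p (r i)).toRepresentation.comp (frob k F p i)) g ∘ₗ
        PiTensorProduct.map π := fun g => by
    rw [piTensor_apply, piTensor_apply, ← PiTensorProduct.map_comp, ← PiTensorProduct.map_comp]
    congr 1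
    funext i
    exact LinearMap.ext fun v => hπ' i _ v
  have h2 : ∀ x, PiTensorProduct.map π (repRIncl F p r x) = x := fun x => by
    rw [repRIncl, ← LinearMap.comp_apply, ← PiTensorProduct.map_comp]
    have : (fun i => π i ∘ₗ projRIncl F p (r i)) = fun i => LinearMap.id :=
      funext fun i => LinearMap.ext fun x => hπ i x
    rw [this]
    simp
  refine LinearMap.ext fun x => ?_
  have h3 := LinearMap.congr_fun (sum_conj_ambient (k := k) (F := F) (p := p)
    (m := fun i => p - 1 - r i) hk) (repRIncl F p r x)
  rw [LinearMap.sum_apply] at h3 ⊢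
  have h4 := congrArg (PiTensorProduct.map π) h3
  rw [map_sum, LinearMap.id_apply, h2] at h4
  refine Eq.trans (Finset.sum_congr rfl fun g _ => ?_) h4
  have h5 := LinearMap.congr_fun (h1 g) (PiTensorProduct.map (fun i =>
    LinearMap.lTensor (SymPow F (p - 1 - r i)) (elemMap F (p - 1) 0 0))
    (ambient k F p (fun i => p - 1 - r i) g⁻¹ (repRIncl F p r x)))
  simp only [LinearMap.comp_apply] at h5 ⊢
  rw [h5, repRIncl_repR, Units.smul_def, map_smul, map_smul, map_smul, repR, twist_smul_apply,
    ← Units.smul_def, smul_smul, ← map_mul, inv_mul_cancel, map_one, one_smul]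

end Trace

end SocleB

namespace SocleB

universe u v

lemma finrank_piTensor_symPow {F : Type v} [Field F] {f : ℕ} (r : Fin f → ℕ) :
    Module.finrank F (⨂[F] i, SymPow F (r i)) = ∏ i, (r i + 1) := by
  rw [Module.finrank_eq_card_basis (Basis.piTensorProduct fun i => monoBasis F (r i)),
    Fintype.card_pi]
  simp

end SocleB
theorem mainTheorem5 {k : Type*} [Field k] [Finite k] {F : Type*} [Field F] [Algebra k F]
    (p f : ℕ) [Fact p.Prime] [CharP k p] (hp : 3 ≤ p) (hk : Nat.card k = p ^ f)
    (r : Fin f → ℕ) (hr : ∀ i, r i ≤ p - 1) (a : ℤ)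
    (hreg : SocleB.IsRegular p r)
    (hdim : 2 ≤ Module.finrank F (⨂[F] i, SocleB.SymPow F (r i))) :
    Nonempty
      ((SocleB.socle (SocleB.quot (SocleB.repA k F p r a))).toRepresentation.Equiv
        (Representation.directSum fun _ : Fin f => SocleB.weight k F p r a)) ∧
    Module.finrank F
      (CategoryTheory.Abelian.Ext (Rep.of (SocleB.weight k F p r a))
        (Rep.of (X := (SocleB.repA k F p r a).toSubmodule)
          (SocleB.repA k F p r a).toRepresentation) 1) = f := by

  have := Fintype.ofFinite k
  have : CharP F p := charP_of_injective_algebraMap (algebraMap k F).injective p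
  rw [Nat.card_eq_fintype_card] at hk
  have hr' : ∀ i, r i < p - 1 := fun i => lt_of_le_of_ne (hr i) (hreg i)
  -- The dimension is the product of the `r i + 1`. A nonzero `r i` gives `f > 0` and an index with
  -- `p - 1 - r i < p - 1`, which separates the torus weights.
  have hex : ∃ i, r i ≠ 0 := by
    by_contra! h
    rw [SocleB.finrank_piTensor_symPow] at hdim
    simp [h] at hdim
  have hA := SocleB.repA_toSubmodule (k := k) (F := F) (p := p) r a
  have := SocleB.injective_repR (F := F) hk hr' a
  exact ⟨(SocleB.socleData hk hr' hex a).nonempty_socle_equiv hA,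
    (SocleB.socleData hk hr' hex a).finrank_ext hA⟩
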